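/- Let $d\ge 2$, let $\Omega\subset\mathbb R^d$ be a bounded open set, $0<T<\infty$, $N\ge 1$, and let $0=\alpha_0<\alpha_1<\dots<\alpha_N$ be real numbers. Put $s=\alpha_N+2$ and $s^*=s/(s-1)$, and let $$W(\mathrm{div};\Omega)=\{\mathbf v\in (L^s(\Omega))^d:\ \nabla\cdot\mathbf v\in L^2(\Omega)\},\qquad \|\mathbf v\|_{W(\mathrm{div};\Omega)}=\|\mathbf v\|_{L^s}+\|\nabla\cdot\mathbf v\|_{L^2},$$ $$R(\Omega)=L^2(\Omega)\cap W^{1,s^*}_0(\Omega),\qquad \|r\|_{R(\Omega)}=\|r\|_{L^2}+\|\nabla r\|_{L^{s^*}},$$ where $W_0^{1,s^*}(\Omega)$ is the closure of $C_c^\infty(\Omega)$ in $W^{1,s^*}(\Omega)$ and $\nabla\cdot$, $\nabla$ are taken in the sense of distributions. Let $(\cdot,\cdot)$ denote the integral over $\Omega$ of the product (scalar product) of two functions. Assume: 1. $\phi:\Omega\to\mathbb R$ is measurable with $0<\underline\phi\le\phi(x)\le\overline\phi<\infty$; 2. $a_i(\cdot,t)\in L^\infty(\Omega)$ for $0\le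 i\le N$, $t\in[0,T]$, with $0\le a_i\le\bar a<\infty$ for all $i$ and $a_0,a_N\ge\underline a>0$; 3. $f\in L^\infty(0,T;L^2(\Omega))$; 4. there is a constant $L$ such that $\|a_i(t_1)-a_i(t_2)\|_{L^\infty}\le L|t_1-t_2|$ for all $i$ and $\|f(t_1)-f(t_2)\|_{L^2}\le L|t_1-t_2|$, for all $t_1,t_2\in[0,T]$; 5. $\rho_0\in R(\Omega)$. Write $F(x,t,z)=\sum_{i=0}^N a_i(x,t)z^{\alpha_i}$ for $z\ge 0$. Then there exists a pair $$(\mathbf m,\rho)\in L^\infty(0,T;W(\mathrm{div};\Omega))\times L^\infty(0,T;R(\Omega))$$ such that $\rho$ has a distributional time derivative $\partial_t\rho\in L^\infty(0,T;L^2(\Omega))$ and $$\int_0^T (F(x,t,|\mathbf m|)\mathbf m,\mathbf v)\,dt-\int_0^T(\nabla\cdot\mathbf v,\rho)\,dt=0\qquad\text{for all }\mathbf v\in L^1(0,T;W(\mathrm{div};\Omega)),$$ $$\int_0^T(\phi\,\partial_t\rho,q)\,dt+\int_0^T(\nabla\cdot\mathbf m,q)\,dt=\int_0^T(f,q)\,dt\qquad\text{for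 all }q\in L^1(0,T;L^2(\Omega)).$$ Moreover, if there is $\mathbf m_0\in W(\mathrm{div};\Omega)$ with $F(x,0,|\mathbf m_0|)\mathbf m_0=-\nabla\rho_0$ a.e. in $\Omega$, then $(\mathbf m,\rho)$ can be chosen so that in addition $\rho(0)=\rho_0$, where $\rho$ is identified with its representative in $C([0,T];L^2(\Omega))$. -/

import Mathlib

open MeasureTheory TopologicalSpace Set Filter
open scoped ENNReal NNReal Topology Distributions Gradient

/-- `ℝ^d` with its Euclidean norm. -/
abbrev Euc (d : ℕ) : Type := EuclideanSpace ℝ (Fin d)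

/-- Lebesgue measure on the open set `Ω`. -/
noncomputable abbrev volOn {d : ℕ} (Ω : Opens (Euc d)) : Measure (Euc d) :=
  volume.restrict (Ω : Set (Euc d))

/-- Lebesgue measure on the time interval `(0,T)`. -/
noncomputable abbrev timeMeas (T : ℝ) : Measure ℝ := volume.restrict (Ioo 0 T)

/-- The exponents `0 = α₀ < α₁ < ⋯ < α_N` of a generalized Forchheimer polynomial, `N ≥ 1`. -/
structure ForchheimerExponents (N : ℕ) where
  α : Fin (N + 1) → ℝ
  one_le : 1 ≤ N
  zero : α 0 = 0
  strictMono : StrictMono α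

namespace ForchheimerExponents

variable {N : ℕ} (e : ForchheimerExponents N)

/-- The exponent `s = α_N + 2`. -/
noncomputable def s : ℝ≥0∞ := ENNReal.ofReal (e.α (Fin.last N) + 2)

/-- The conjugate exponent `s* = s / (s - 1) = (α_N + 2) / (α_N + 1)`. -/
noncomputable def sStar : ℝ≥0∞ :=
  ENNReal.ofReal ((e.α (Fin.last N) + 2) / (e.α (Fin.last N) + 1))

theorem α_last_nonneg : 0 ≤ e.α (Fin.last N) := by
  rw [← e.zero]
  exact e.strictMono.monotone (Fin.zero_le _)

instance : Fact (1 ≤ e.s) := by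
  refine ⟨?_⟩
  rw [s, ENNReal.one_le_ofReal]
  linarith [e.α_last_nonneg]

instance : Fact (1 ≤ e.sStar) := by
  refine ⟨?_⟩
  have h := e.α_last_nonneg
  rw [sStar, ENNReal.one_le_ofReal, one_le_div (by linarith)]
  linarith

/-- The generalized polynomial `F(z) = ∑ i, c i * z ^ α i` with coefficients `c`, for `z ≥ 0`. -/
noncomputable def poly (c : Fin (N + 1) → ℝ) (z : ℝ) : ℝ := ∑ i, c i * z ^ e.α i

end ForchheimerExponents

section Spaces

variable {d : ℕ} (Ω : Opens (Euc d))

/-- `g` is the divergence of `v` in the sense of distributions on `Ω`. -/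
def IsWeakDiv (v : Euc d → Euc d) (g : Euc d → ℝ) : Prop :=
  ∀ ψ : 𝓓(Ω, ℝ), ∫ x in Ω, ψ x * g x = - ∫ x in Ω, inner ℝ (v x) (∇ ψ x)

theorem testFunction_continuous_gradient {Ω : Opens (Euc d)} (ψ : 𝓓(Ω, ℝ)) :
    Continuous (∇ (ψ : Euc d → ℝ)) :=
  (InnerProductSpace.toDual ℝ (Euc d)).symm.continuous.comp
    (ψ.contDiff.continuous_fderiv (by simp))

theorem testFunction_hasCompactSupport_gradient {Ω : Opens (Euc d)} (ψ : 𝓓(Ω, ℝ)) :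
    HasCompactSupport (∇ (ψ : Euc d → ℝ)) :=
  (ψ.hasCompactSupport.fderiv (𝕜 := ℝ)).comp_left (map_zero _)

theorem integrable_testFunction_mul {Ω : Opens (Euc d)} {p : ℝ≥0∞} (hp : 1 ≤ p) (ψ : 𝓓(Ω, ℝ))
    {g : Euc d → ℝ} (hg : MemLp g p (volOn Ω)) :
    Integrable (fun x => ψ x * g x) (volOn Ω) :=
  (hg.locallyIntegrable hp).integrable_smul_left_of_hasCompactSupport ψ.continuous
    ψ.hasCompactSupport

theorem integrable_inner_gradient {Ω : Opens (Euc d)} {p : ℝ≥0∞} (hp : 1 ≤ p) (ψ : 𝓓(Ω, ℝ))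
    {v : Euc d → Euc d} (hv : MemLp v p (volOn Ω)) :
    Integrable (fun x => inner ℝ (v x) (∇ ψ x)) (volOn Ω) := by
  have hc := testFunction_continuous_gradient ψ
  have hn : LocallyIntegrable (fun x => ‖v x‖) (volOn Ω) := hv.norm.locallyIntegrable hp
  have h := hn.integrable_smul_left_of_hasCompactSupport hc.norm
    (testFunction_hasCompactSupport_gradient ψ).norm
  refine h.mono (hv.1.inner hc.aestronglyMeasurable) (ae_of_all _ fun x => ?_)
  rw [norm_smul, norm_norm, norm_norm, mul_comm]
  exact norm_inner_le_norm _ _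

/-- The space `W(div; Ω) = {v ∈ L^p(Ω)^d : div v ∈ L²(Ω)}`; an element is stored as the pair
`(v, div v)`, so that the norm inherited from `L^p × L²` is equivalent to
`‖v‖_{L^p} + ‖div v‖_{L²}`. -/
def Wdiv (p : ℝ≥0∞) [hp : Fact (1 ≤ p)] :
    Submodule ℝ (Lp (Euc d) p (volOn Ω) × Lp ℝ 2 (volOn Ω)) where
  carrier := {w | IsWeakDiv Ω w.1 w.2}
  zero_mem' := by
    intro ψ
    have h1 : (fun x => ψ x * (0 : Lp ℝ 2 (volOn Ω)) x) =ᵐ[volOn Ω] fun _ => 0 := by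
      filter_upwards [Lp.coeFn_zero ℝ 2 (volOn Ω)] with x hx
      rw [hx]; simp
    have h2 : (fun x => inner ℝ ((0 : Lp (Euc d) p (volOn Ω)) x) (∇ ψ x)) =ᵐ[volOn Ω]
        fun _ => (0 : ℝ) := by
      filter_upwards [Lp.coeFn_zero (Euc d) p (volOn Ω)] with x hx
      rw [hx]; simp
    change ∫ x in Ω, ψ x * (0 : Lp ℝ 2 (volOn Ω)) x
      = - ∫ x in Ω, inner ℝ ((0 : Lp (Euc d) p (volOn Ω)) x) (∇ ψ x)
    rw [integral_congr_ae h1, integral_congr_ae h2]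
    simp
  add_mem' := by
    intro w z hw hz ψ
    have h1 : (fun x => ψ x * (w.2 + z.2) x) =ᵐ[volOn Ω]
        fun x => ψ x * w.2 x + ψ x * z.2 x := by
      filter_upwards [Lp.coeFn_add w.2 z.2] with x hx
      rw [hx, Pi.add_apply, mul_add]
    have h2 : (fun x => inner ℝ ((w.1 + z.1) x) (∇ ψ x)) =ᵐ[volOn Ω]
        fun x => inner ℝ (w.1 x) (∇ ψ x) + inner ℝ (z.1 x) (∇ ψ x) := by
      filter_upwards [Lp.coeFn_add w.1 z.1] with x hx
      rw [hx, Pi.add_apply, inner_add_left]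
    change ∫ x in Ω, ψ x * (w.2 + z.2) x = - ∫ x in Ω, inner ℝ ((w.1 + z.1) x) (∇ ψ x)
    rw [integral_congr_ae h1, integral_congr_ae h2,
      integral_add (integrable_testFunction_mul one_le_two ψ (Lp.memLp _))
        (integrable_testFunction_mul one_le_two ψ (Lp.memLp _)),
      integral_add (integrable_inner_gradient hp.out ψ (Lp.memLp _))
        (integrable_inner_gradient hp.out ψ (Lp.memLp _)), hw ψ, hz ψ]
    ring
  smul_mem' := by
    intro c w hw ψ
    have h1 : (fun x => ψ x * (c • w.2) x) =ᵐ[volOn Ω] fun x => c * (ψ x * w.2 x) := by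
      filter_upwards [Lp.coeFn_smul c w.2] with x hx
      rw [hx, Pi.smul_apply, smul_eq_mul]
      ring
    have h2 : (fun x => inner ℝ ((c • w.1) x) (∇ ψ x)) =ᵐ[volOn Ω]
        fun x => c * inner ℝ (w.1 x) (∇ ψ x) := by
      filter_upwards [Lp.coeFn_smul c w.1] with x hx
      rw [hx, Pi.smul_apply, real_inner_smul_left]
    change ∫ x in Ω, ψ x * (c • w.2) x = - ∫ x in Ω, inner ℝ ((c • w.1) x) (∇ ψ x)
    rw [integral_congr_ae h1, integral_congr_ae h2, integral_const_mul, integral_const_mul, hw ψ]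
    ring

/-- `r` belongs to `W₀^{1,p}(Ω)`, the closure of the test functions in `W^{1,p}(Ω)`, and `g` is
its weak gradient. -/
def IsW0 (p : ℝ≥0∞) (r : Euc d → ℝ) (g : Euc d → Euc d) : Prop :=
  ∃ ψ : ℕ → 𝓓(Ω, ℝ),
    Tendsto (fun n => eLpNorm (fun x => ψ n x - r x) p (volOn Ω)) atTop (𝓝 0) ∧
    Tendsto (fun n => eLpNorm (fun x => ∇ (ψ n) x - g x) p (volOn Ω)) atTop (𝓝 0)

theorem tendsto_eLpNorm_add_zero {F : Type*} [NormedAddCommGroup F] {p : ℝ≥0∞} (hp : 1 ≤ p)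
    {Ω : Opens (Euc d)} {u v w : ℕ → Euc d → F}
    (hu : ∀ n, AEStronglyMeasurable (u n) (volOn Ω))
    (hv : ∀ n, AEStronglyMeasurable (v n) (volOn Ω))
    (hw : ∀ n, w n =ᵐ[volOn Ω] u n + v n)
    (h1 : Tendsto (fun n => eLpNorm (u n) p (volOn Ω)) atTop (𝓝 0))
    (h2 : Tendsto (fun n => eLpNorm (v n) p (volOn Ω)) atTop (𝓝 0)) :
    Tendsto (fun n => eLpNorm (w n) p (volOn Ω)) atTop (𝓝 0) := by
  have h := h1.add h2
  rw [add_zero] at h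
  refine tendsto_of_tendsto_of_tendsto_of_le_of_le tendsto_const_nhds h (fun _ => zero_le)
    fun n => ?_
  rw [eLpNorm_congr_ae (hw n)]
  exact eLpNorm_add_le (hu n) (hv n) hp

theorem tendsto_eLpNorm_smul_zero {F : Type*} [NormedAddCommGroup F] [NormedSpace ℝ F]
    {p : ℝ≥0∞} {Ω : Opens (Euc d)} {u w : ℕ → Euc d → F} (c : ℝ)
    (hw : ∀ n, w n =ᵐ[volOn Ω] c • u n)
    (h1 : Tendsto (fun n => eLpNorm (u n) p (volOn Ω)) atTop (𝓝 0)) :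
    Tendsto (fun n => eLpNorm (w n) p (volOn Ω)) atTop (𝓝 0) := by
  have h := ENNReal.Tendsto.const_mul (a := ‖c‖ₑ) h1 (Or.inr enorm_ne_top)
  rw [mul_zero] at h
  refine h.congr fun n => ?_
  rw [eLpNorm_congr_ae (hw n), eLpNorm_const_smul]

theorem gradient_testFunction_add {Ω : Opens (Euc d)} (ψ η : 𝓓(Ω, ℝ)) (x : Euc d) :
    ∇ (ψ + η : 𝓓(Ω, ℝ)) x = ∇ ψ x + ∇ η x := by
  have h1 := (ψ.contDiff.differentiable (by simp)) x
  have h2 := (η.contDiff.differentiable (by simp)) x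
  change ∇ (fun y => ψ y + η y) x = _
  simp only [gradient]
  rw [fderiv_fun_add h1 h2, map_add]

theorem gradient_testFunction_smul {Ω : Opens (Euc d)} (c : ℝ) (ψ : 𝓓(Ω, ℝ)) (x : Euc d) :
    ∇ (c • ψ : 𝓓(Ω, ℝ)) x = c • ∇ ψ x := by
  have h1 := (ψ.contDiff.differentiable (by simp)) x
  change ∇ (fun y => c • ψ y) x = _
  simp only [gradient]
  rw [fderiv_fun_const_smul h1]
  simp

/-- The space `L²(Ω) ∩ W₀^{1,p}(Ω)` of square integrable functions with gradient in `L^p` and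
vanishing trace; an element is stored as the pair `(r, ∇ r)`, so that the norm inherited from
`L² × L^p` is equivalent to `‖r‖_{L²} + ‖∇ r‖_{L^p}`. -/
def L2W0 (p : ℝ≥0∞) [hp : Fact (1 ≤ p)] :
    Submodule ℝ (Lp ℝ 2 (volOn Ω) × Lp (Euc d) p (volOn Ω)) where
  carrier := {w | IsW0 Ω p w.1 w.2}
  zero_mem' := by
    refine ⟨fun _ => 0, ?_, ?_⟩
    · refine tendsto_const_nhds.congr fun n => ?_
      rw [eq_comm, ← eLpNorm_zero (α := Euc d) (ε := ℝ) (p := p) (μ := volOn Ω)]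
      refine eLpNorm_congr_ae ?_
      filter_upwards [Lp.coeFn_zero ℝ 2 (volOn Ω)] with x hx
      change (0 : ℝ) - (0 : Lp ℝ 2 (volOn Ω)) x = 0
      rw [hx]; simp
    · refine tendsto_const_nhds.congr fun n => ?_
      rw [eq_comm, ← eLpNorm_zero (α := Euc d) (ε := Euc d) (p := p) (μ := volOn Ω)]
      refine eLpNorm_congr_ae ?_
      filter_upwards [Lp.coeFn_zero (Euc d) p (volOn Ω)] with x hx
      change ∇ (fun _ => (0 : ℝ)) x - (0 : Lp (Euc d) p (volOn Ω)) x = 0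
      rw [hx]; simp [gradient]
  add_mem' := by
    rintro w z ⟨ψ, h1, h2⟩ ⟨η, h3, h4⟩
    refine ⟨fun n => ψ n + η n, ?_, ?_⟩
    · refine tendsto_eLpNorm_add_zero hp.out
        (fun n => (ψ n).continuous.aestronglyMeasurable.sub (Lp.aestronglyMeasurable w.1))
        (fun n => (η n).continuous.aestronglyMeasurable.sub (Lp.aestronglyMeasurable z.1))
        (fun n => ?_) h1 h3
      filter_upwards [Lp.coeFn_add w.1 z.1] with x hx
      change (ψ n x + η n x) - (w.1 + z.1) x = (ψ n x - w.1 x) + (η n x - z.1 x)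
      rw [hx, Pi.add_apply]
      ring
    · refine tendsto_eLpNorm_add_zero hp.out
        (fun n => (testFunction_continuous_gradient (ψ n)).aestronglyMeasurable.sub
          (Lp.aestronglyMeasurable w.2))
        (fun n => (testFunction_continuous_gradient (η n)).aestronglyMeasurable.sub
          (Lp.aestronglyMeasurable z.2))
        (fun n => ?_) h2 h4
      filter_upwards [Lp.coeFn_add w.2 z.2] with x hx
      change ∇ (ψ n + η n : 𝓓(Ω, ℝ)) x - (w.2 + z.2) x
        = (∇ (ψ n) x - w.2 x) + (∇ (η n) x - z.2 x)
      rw [hx, Pi.add_apply, gradient_testFunction_add]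
      abel
  smul_mem' := by
    rintro c w ⟨ψ, h1, h2⟩
    refine ⟨fun n => c • ψ n, ?_, ?_⟩
    · refine tendsto_eLpNorm_smul_zero c (fun n => ?_) h1
      filter_upwards [Lp.coeFn_smul c w.1] with x hx
      change c • ψ n x - (c • w.1) x = c • (ψ n x - w.1 x)
      rw [hx, Pi.smul_apply, smul_sub]
    · refine tendsto_eLpNorm_smul_zero c (fun n => ?_) h2
      filter_upwards [Lp.coeFn_smul c w.2] with x hx
      change ∇ (c • ψ n : 𝓓(Ω, ℝ)) x - (c • w.2) x = c • (∇ (ψ n) x - w.2 x)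
      rw [hx, Pi.smul_apply, gradient_testFunction_smul, smul_sub]

end Spaces

section Accessors

variable {d : ℕ} {Ω : Opens (Euc d)} {p : ℝ≥0∞} [Fact (1 ≤ p)]

/-- The vector field underlying an element of `W(div; Ω)`. -/
noncomputable def Wdiv.field (w : Wdiv Ω p) : Euc d → Euc d := w.1.1

/-- The divergence of an element of `W(div; Ω)`. -/
noncomputable def Wdiv.div (w : Wdiv Ω p) : Euc d → ℝ := w.1.2

/-- The class in `L²(Ω)` of an element of `L²(Ω) ∩ W₀^{1,p}(Ω)`. -/
def L2W0.toL2 (r : L2W0 Ω p) : Lp ℝ 2 (volOn Ω) := r.1.1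

/-- The weak gradient of an element of `L²(Ω) ∩ W₀^{1,p}(Ω)`. -/
noncomputable def L2W0.grad (r : L2W0 Ω p) : Euc d → Euc d := r.1.2

end Accessors

/-- The open time interval `(0,T)`. -/
def timeInterval (T : ℝ) : Opens ℝ := ⟨Ioo 0 T, isOpen_Ioo⟩

/-- `u'` is the time derivative of `u` in the sense of distributions on `(0,T)` with values
in `X`. -/
def HasWeakTimeDeriv {X : Type*} [NormedAddCommGroup X] [NormedSpace ℝ X] (T : ℝ)
    (u u' : ℝ → X) : Prop :=
  ∀ θ : 𝓓(timeInterval T, ℝ),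
    ∫ t in Ioo 0 T, θ t • u' t = - ∫ t in Ioo 0 T, deriv θ t • u t

/-- `u` has a representative that is continuous on `[0,T]` and takes the value `u₀` at `t = 0`. -/
def HasInitialValue {X : Type*} [NormedAddCommGroup X] (T : ℝ) (u : ℝ → X) (u₀ : X) : Prop :=
  ∃ r : ℝ → X, ContinuousOn r (Icc 0 T) ∧ u =ᵐ[timeMeas T] r ∧ r 0 = u₀

/-! Put `ρ = Q u`, where `Q` is multiplication by `φ ^ (-1/2)`. The mass equation becomes `u' + Q
(div m) = Q f` in `L²(Ω)`, where `m` solves the momentum equation `(F(|m|) m, v) = (Q u, div v)` for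
all `v` in `W(div; Ω)`. Since `Q` is symmetric, the relation between `u` and `a = Q (div m)` is
monotone at each fixed time. The problem is thus an evolution equation for a time-dependent family
of monotone relations.

Three facts make this family tractable. The range condition holds because the resolvent equation is
the Euler equation of a uniformly convex functional on `W(div; Ω)` (`exists_resolvent`). Changing
the time from `r` to `t` costs only `K (t - r) ^ 2` times the nonnegative quantity `inner b w`,
because the strong monotonicity of the flux absorbs the linear part of the change of coefficients
(`ForchheimerExponents.strong_mono_flux`). The graph is demiclosed: if densities converge strongly
and divergences stay bounded, then strong monotonicity makes the fields converge in `L^s`, hence the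
fluxes in `L^{s*}`, and the divergences converge weakly (`IsMomentum.tendsto`).

For such a family the implicit Euler scheme has bounded difference quotients. Halving the step moves
the approximation by `O(√τ)`, so along the steps `T / 2 ^ k` the approximations form a Cauchy
sequence at each time. The limit is Lipschitz and solves the equation
(`MonotoneFamily.exists_solution`); no compactness is used.

The momentum equation says that `(ρ, -F(|m|) m)` annihilates `W(div; Ω)`. By Hahn–Banach and `L^p`
duality such a pair is a limit of pairs `(ψ, ∇ψ)`, which gives the zero trace and the gradient of
`ρ` (`mem_L2W0_of_forall_Wdiv`). Conversely, integration by parts turns the compatibility condition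
on `ρ₀` into the momentum equation at time `0`, so that the scheme can start from `ρ₀`. Without that
condition it starts from zero. -/

/-! ### Implicit Euler scheme: existence and a priori bounds. -/

section Rothe

variable {H : Type*} [NormedAddCommGroup H] [InnerProductSpace ℝ H]

/-- A time-dependent family of monotone relations on a Hilbert space that satisfies the range
condition and depends on time in a quadratically controlled way. -/
structure MonotoneFamily (G : ℝ → H → H → Prop) (K : ℝ) : Prop where
  K_nonneg : 0 ≤ K
  nonneg : ∀ {t u a}, G t u a → 0 ≤ inner ℝ a u
  mono : ∀ {t r u a w b}, G t u a → G r w b →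
    -(K * (t - r) ^ 2 * inner ℝ b w) ≤ inner ℝ (a - b) (u - w)
  range : ∀ (t τ : ℝ) (h : H), 0 < τ → ∃ u a, G t u a ∧ u + τ • a = h

/-- `(u, a)` is an implicit Euler sequence with step `τ` for `u' + G t u ∋ f`. -/
structure IsRothe (G : ℝ → H → H → Prop) (f : ℝ → H) (τ : ℝ) (u a : ℕ → H) : Prop where
  mem : ∀ j : ℕ, G (j * τ) (u j) (a j)
  step : ∀ j : ℕ, u (j + 1) - u j = τ • (f ((j + 1 : ℕ) * τ) - a (j + 1))

theorem MonotoneFamily.exists_isRothe {G : ℝ → H → H → Prop} {K : ℝ} (hG : MonotoneFamily G K)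
    (f : ℝ → H) {τ : ℝ} (hτ : 0 < τ) {u₀ a₀ : H} (h₀ : G 0 u₀ a₀) :
    ∃ u a : ℕ → H, IsRothe G f τ u a ∧ u 0 = u₀ ∧ a 0 = a₀ := by
  choose U A hUA using fun (t : ℝ) (h : H) => hG.range t τ h hτ
  let z : ℕ → H × H := fun j => Nat.rec (u₀, a₀) (fun j p =>
    (U ((j + 1 : ℕ) * τ) (p.1 + τ • f ((j + 1 : ℕ) * τ)),
      A ((j + 1 : ℕ) * τ) (p.1 + τ • f ((j + 1 : ℕ) * τ)))) j
  refine ⟨fun j => (z j).1, fun j => (z j).2, ⟨fun j => ?_, fun j => ?_⟩, rfl, rfl⟩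
  · cases j with
    | zero => simpa [z] using h₀
    | succ j => exact (hUA ((j + 1 : ℕ) * τ) ((z j).1 + τ • f ((j + 1 : ℕ) * τ))).1
  · have h := (hUA ((j + 1 : ℕ) * τ) ((z j).1 + τ • f ((j + 1 : ℕ) * τ))).2
    change U ((j + 1 : ℕ) * τ) ((z j).1 + τ • f ((j + 1 : ℕ) * τ)) - (z j).1 = τ •
      (f ((j + 1 : ℕ) * τ) - A ((j + 1 : ℕ) * τ) ((z j).1 + τ • f ((j + 1 : ℕ) * τ)))
    rw [smul_sub, sub_eq_sub_iff_add_eq_add, h, add_comm]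

namespace IsRothe

variable {G : ℝ → H → H → Prop} {K : ℝ} {f : ℝ → H} {τ : ℝ} {u a : ℕ → H}

/-- Test the step with `u (j + 1)`, drop the nonnegative term `inner a u`, and divide by `‖u (j +
1)‖`. -/
theorem norm_le (h : IsRothe G f τ u a) (hG : MonotoneFamily G K) (hτ : 0 < τ) {F : ℝ}
    (hF : ∀ t, ‖f t‖ ≤ F) (j : ℕ) : ‖u j‖ ≤ ‖u 0‖ + j * τ * F := by
  induction j with
  | zero => simp
  | succ j ih =>
    have h1 := h.step j
    have h2 := hG.nonneg (h.mem (j + 1))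
    set g := f ((j + 1 : ℕ) * τ)
    have h3 : inner ℝ (u (j + 1)) (u (j + 1)) =
        inner ℝ (u j) (u (j + 1)) + τ * inner ℝ g (u (j + 1))
          - τ * inner ℝ (a (j + 1)) (u (j + 1)) := by
      have : u (j + 1) = u j + τ • (g - a (j + 1)) := by rw [← h1]; abel
      conv_lhs => rw [this, inner_add_left, real_inner_smul_left, inner_sub_left, ← this]
      ring
    rw [real_inner_self_eq_norm_sq] at h3
    have h4 := real_inner_le_norm (u j) (u (j + 1))
    have h5 := real_inner_le_norm g (u (j + 1))
    have h6 : ‖g‖ ≤ F := hF _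
    by_cases h0 : ‖u (j + 1)‖ = 0
    · rw [h0]
      have : 0 ≤ F := (norm_nonneg _).trans h6
      positivity
    · have hpos : 0 < ‖u (j + 1)‖ := lt_of_le_of_ne (norm_nonneg _) (Ne.symm h0)
      have h7 : ‖u (j + 1)‖ * ‖u (j + 1)‖ ≤ (‖u j‖ + τ * F) * ‖u (j + 1)‖ := by
        have e1 : τ * inner ℝ g (u (j + 1)) ≤ τ * (F * ‖u (j + 1)‖) :=
          mul_le_mul_of_nonneg_left (h5.trans (mul_le_mul_of_nonneg_right h6 hpos.le)) hτ.le
        have e2 : 0 ≤ τ * inner ℝ (a (j + 1)) (u (j + 1)) := mul_nonneg hτ.le h2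
        nlinarith
      have h8 := le_of_mul_le_mul_right h7 hpos
      push_cast
      nlinarith

/-- The residual `g = f - a` is the difference quotient of `u`. Monotonicity between consecutive
nodes, tested with the increment `τ • g` and divided by `τ`, compares `g` with its predecessor up to
`O(τ)` terms that grow with the predecessor. The maximum with `1` allows division by `‖g‖`; it turns
the `F` in the bound `F + ‖g'‖` for `‖a j‖` into a multiple of `‖g‖` too, so the growth per step is
additive and no Gronwall argument is needed. -/
theorem norm_residual_step (h : IsRothe G f τ u a) (hG : MonotoneFamily G K) (hτ : 0 < τ)
    {F L U : ℝ} (hF : ∀ t, ‖f t‖ ≤ F) (hL : ∀ t r, ‖f t - f r‖ ≤ L * |t - r|)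
    {j : ℕ} (hU : ‖u j‖ ≤ U) :
    max ‖f ((j + 1 : ℕ) * τ) - a (j + 1)‖ 1 ≤
      max ‖f (j * τ) - a j‖ 1 + (L + K * U * (F + 1)) * τ := by
  have hF0 : 0 ≤ F := (norm_nonneg _).trans (hF 0)
  have hU0 : 0 ≤ U := (norm_nonneg _).trans hU
  have hL0 : 0 ≤ L := by simpa using (norm_nonneg _).trans (hL 1 0)
  have hK := hG.K_nonneg
  have h1 := h.step j
  have h2 := hG.mono (h.mem (j + 1)) (h.mem j)
  have ht : ((j + 1 : ℕ) : ℝ) * τ - j * τ = τ := by push_cast; ring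
  rw [ht, h1] at h2
  have h3 := hL ((j + 1 : ℕ) * τ) (j * τ)
  rw [ht, abs_of_pos hτ] at h3
  have h4 : ‖a j‖ ≤ F + ‖f (j * τ) - a j‖ := by
    have : a j = f (j * τ) - (f (j * τ) - a j) := by abel
    calc ‖a j‖ = ‖f (j * τ) - (f (j * τ) - a j)‖ := by rw [← this]
      _ ≤ _ := (norm_sub_le _ _).trans (by gcongr; exact hF _)
  have h5 : a (j + 1) - a j = (f ((j + 1 : ℕ) * τ) - f (j * τ))
      - ((f ((j + 1 : ℕ) * τ) - a (j + 1)) - (f (j * τ) - a j)) := by abel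
  rw [h5] at h2
  set g := f ((j + 1 : ℕ) * τ) - a (j + 1)
  set g' := f (j * τ) - a j
  set δ := f ((j + 1 : ℕ) * τ) - f (j * τ)
  have h6 : inner ℝ (a j) (u j) ≤ (F + ‖g'‖) * U :=
    (real_inner_le_norm _ _).trans (mul_le_mul h4 hU (norm_nonneg _) (by positivity))
  rw [real_inner_smul_right, inner_sub_left δ, inner_sub_left g, real_inner_self_eq_norm_sq] at h2
  have h7 := real_inner_le_norm δ g
  have h8 := real_inner_le_norm g' g
  have h9 : ‖δ‖ * ‖g‖ ≤ L * τ * ‖g‖ := mul_le_mul_of_nonneg_right h3 (norm_nonneg _)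
  have h10 : ‖g‖ ^ 2 ≤ ‖g'‖ * ‖g‖ + L * τ * ‖g‖ + K * τ * ((F + ‖g'‖) * U) := by
    have e : τ * (‖g‖ ^ 2) ≤ τ * (‖g'‖ * ‖g‖ + L * τ * ‖g‖ + K * τ * ((F + ‖g'‖) * U)) := by
      have e1 : K * τ ^ 2 * inner ℝ (a j) (u j) ≤ K * τ ^ 2 * ((F + ‖g'‖) * U) :=
        mul_le_mul_of_nonneg_left h6 (by positivity)
      have e2 : τ * (inner ℝ δ g - (‖g‖ ^ 2 - inner ℝ g' g)) ≤
          τ * (L * τ * ‖g‖ - (‖g‖ ^ 2 - ‖g'‖ * ‖g‖)) :=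
        mul_le_mul_of_nonneg_left (by linarith) hτ.le
      nlinarith
    exact le_of_mul_le_mul_left e hτ
  set X := max ‖g'‖ 1
  have hX1 : 1 ≤ X := le_max_right _ _
  have hXg : ‖g'‖ ≤ X := le_max_left _ _
  have hC : 0 ≤ (L + K * U * (F + 1)) * τ := by positivity
  refine max_le ?_ (by linarith)
  by_cases hg : ‖g‖ ≤ X
  · linarith
  push Not at hg
  have e1 : K * τ * ((F + ‖g'‖) * U) ≤ K * τ * (((F + 1) * ‖g‖) * U) := by
    gcongr
    nlinarith
  have e2 : ‖g‖ * ‖g‖ ≤ (X + (L + K * U * (F + 1)) * τ) * ‖g‖ := by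
    have : ‖g'‖ * ‖g‖ ≤ X * ‖g‖ := by gcongr
    nlinarith
  exact le_of_mul_le_mul_right e2 (by linarith)

theorem norm_residual_le (h : IsRothe G f τ u a) (hG : MonotoneFamily G K) (hτ : 0 < τ)
    {F L T : ℝ} (hT : 0 ≤ T) (hF : ∀ t, ‖f t‖ ≤ F) (hL : ∀ t r, ‖f t - f r‖ ≤ L * |t - r|)
    {j : ℕ} (hj : j * τ ≤ T) :
    ‖f (j * τ) - a j‖ ≤
      max ‖f 0 - a 0‖ 1 + (L + K * (‖u 0‖ + T * F) * (F + 1)) * T := by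
  have hF0 : 0 ≤ F := (norm_nonneg _).trans (hF 0)
  have hL0 : 0 ≤ L := by simpa using (norm_nonneg _).trans (hL 1 0)
  have hK := hG.K_nonneg
  have key : ∀ j : ℕ, j * τ ≤ T → max ‖f (j * τ) - a j‖ 1 ≤
      max ‖f 0 - a 0‖ 1 + (L + K * (‖u 0‖ + T * F) * (F + 1)) * (j * τ) := by
    intro j
    induction j with
    | zero => intro _; simp
    | succ j ih =>
      intro hj
      have hj' : (j : ℝ) * τ ≤ T := by push_cast at hj; nlinarith
      have hU : ‖u j‖ ≤ ‖u 0‖ + T * F := (h.norm_le hG hτ hF j).trans (by gcongr)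
      refine (h.norm_residual_step hG hτ hF hL hU).trans ?_
      have := ih hj'
      push_cast
      linarith
  refine (le_max_left _ _).trans ((key j hj).trans ?_)
  gcongr

end IsRothe

end Rothe

/-! ### Comparison of step sizes, and step functions in time. -/

section Rothe

variable {H : Type*} [NormedAddCommGroup H] [InnerProductSpace ℝ H]

namespace IsRothe

variable {G : ℝ → H → H → Prop} {K : ℝ} {f : ℝ → H} {τ : ℝ} {u a w b : ℕ → H}

/-- One coarse step is compared with the two fine steps that cover it. The coarse `a (j + 1)` is
paired with both fine values: with the second at equal times, hence without error, with the first at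
times `τ / 2` apart. In the first pairing `w (2 * j + 1)` must be traded for `w (2 * j + 2)`, which
costs one fine increment. Every error is `O(τ ^ 2)`. -/
theorem halving_step (h : IsRothe G f τ u a) (h' : IsRothe G f (τ / 2) w b)
    (hG : MonotoneFamily G K) (hτ : 0 < τ)
    {L M T : ℝ} (hL : ∀ t r, ‖f t - f r‖ ≤ L * |t - r|)
    (hu : ∀ j : ℕ, j * τ ≤ T → ‖u j‖ ≤ M) (ha : ∀ j : ℕ, j * τ ≤ T → ‖a j‖ ≤ M)
    (hw : ∀ j : ℕ, j * (τ / 2) ≤ T → ‖w j‖ ≤ M) (hb : ∀ j : ℕ, j * (τ / 2) ≤ T → ‖b j‖ ≤ M)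
    (hg : ∀ j : ℕ, j * (τ / 2) ≤ T → ‖f (j * (τ / 2)) - b j‖ ≤ M)
    {j : ℕ} (hj : (j + 1 : ℕ) * τ ≤ T) :
    ‖u (j + 1) - w (2 * (j + 1))‖ ^ 2 ≤
      ‖u j - w (2 * j)‖ ^ 2 + (2 * M * L + K * T * M ^ 2 + M ^ 2) * τ ^ 2 := by
  have hL0 : 0 ≤ L := by simpa using (norm_nonneg _).trans (hL 1 0)
  have hK := hG.K_nonneg
  have hτT : τ ≤ T := by push_cast at hj; nlinarith [(Nat.cast_nonneg j : (0 : ℝ) ≤ j)]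
  have i1 : ((2 * j + 1 : ℕ) : ℝ) * (τ / 2) ≤ T := by push_cast at hj ⊢; linarith
  have i2 : ((2 * j + 2 : ℕ) : ℝ) * (τ / 2) ≤ T := by push_cast at hj ⊢; linarith
  have s0 := h.step j
  have s1 := h'.step (2 * j)
  have s2 := h'.step (2 * j + 1)
  have t2 : ((2 * j + 1 + 1 : ℕ) : ℝ) * (τ / 2) = (j + 1 : ℕ) * τ := by push_cast; ring
  have m1 := hG.mono (h.mem (j + 1)) (h'.mem (2 * j + 1))
  have m2 := hG.mono (h.mem (j + 1)) (h'.mem (2 * j + 1 + 1))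
  have t1 : ((j + 1 : ℕ) : ℝ) * τ - (2 * j + 1 : ℕ) * (τ / 2) = τ / 2 := by push_cast; ring
  rw [t2, sub_self] at m2
  rw [t1] at m1
  have hf1 := hL ((j + 1 : ℕ) * τ) ((2 * j + 1 : ℕ) * (τ / 2))
  rw [t1, abs_of_pos (by positivity)] at hf1
  have hgs := hg _ i2
  have hM0 : 0 ≤ M := (norm_nonneg _).trans hgs
  rw [t2] at s2 hgs
  have hidx : 2 * (j + 1) = 2 * j + 1 + 1 := by ring
  rw [hidx]
  have bu := hu _ hj
  have ba := ha _ hj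
  have bw1 := hw _ i1
  have bw2 := hw _ i2
  have bb1 := hb _ i1
  set t := ((j + 1 : ℕ) : ℝ) * τ
  set t' := ((2 * j + 1 : ℕ) : ℝ) * (τ / 2)
  set e1 := u (j + 1) - w (2 * j + 1 + 1) with he1
  set e0 := u j - w (2 * j) with he0
  have hdiff : e1 - e0 = (τ / 2) • ((f t - f t') - (a (j + 1) - b (2 * j + 1))
      - (a (j + 1) - b (2 * j + 1 + 1))) := by
    have : e1 - e0 = (u (j + 1) - u j) - (w (2 * j + 1 + 1) - w (2 * j + 1))
      - (w (2 * j + 1) - w (2 * j)) := by rw [he1, he0]; abel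
    rw [this, s0, s1, s2]
    module
  -- Implicit Euler dissipates: the square of the increment has the favourable sign and is dropped.
  have hnorm : ‖e1‖ ^ 2 ≤ ‖e0‖ ^ 2 + 2 * inner ℝ (e1 - e0) e1 := by
    have := norm_sub_sq_real e1 (e1 - e0)
    rw [sub_sub_cancel, real_inner_comm] at this
    nlinarith [sq_nonneg ‖e1 - e0‖]
  rw [hdiff, real_inner_smul_left, inner_sub_left, inner_sub_left (f t - f t')] at hnorm
  have hsplit : inner ℝ (a (j + 1) - b (2 * j + 1)) e1 =
      inner ℝ (a (j + 1) - b (2 * j + 1)) (u (j + 1) - w (2 * j + 1))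
        - inner ℝ (a (j + 1) - b (2 * j + 1)) (w (2 * j + 1 + 1) - w (2 * j + 1)) := by
    rw [← inner_sub_right]; congr 1; rw [he1]; abel
  have c1 : inner ℝ (f t - f t') e1 ≤ (L * (τ / 2)) * (2 * M) := by
    refine (real_inner_le_norm _ _).trans (mul_le_mul hf1 ?_ (norm_nonneg _) (by positivity))
    exact (norm_sub_le _ _).trans (by linarith)
  have c2 : inner ℝ (a (j + 1) - b (2 * j + 1)) (w (2 * j + 1 + 1) - w (2 * j + 1)) ≤
      (2 * M) * (τ / 2 * M) := by
    refine (real_inner_le_norm _ _).trans (mul_le_mul ?_ ?_ (norm_nonneg _) (by positivity))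
    · exact (norm_sub_le _ _).trans (by linarith)
    · rw [s2, norm_smul, Real.norm_of_nonneg (by positivity)]
      gcongr
  have c3 : inner ℝ (b (2 * j + 1)) (w (2 * j + 1)) ≤ M * M :=
    (real_inner_le_norm _ _).trans (mul_le_mul bb1 bw1 (norm_nonneg _) hM0)
  -- One factor `τ` is given up for `T`; a single power suffices because the bracket in `c5` carries
  -- another.
  have c4 : K * (τ / 2) ^ 2 * inner ℝ (b (2 * j + 1)) (w (2 * j + 1)) ≤ K * T * M ^ 2 * τ := by
    calc _ ≤ K * (τ / 2) ^ 2 * (M * M) := by gcongr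
      _ = K * (τ * τ / 4) * M ^ 2 := by ring
      _ ≤ K * (T * τ) * M ^ 2 := by gcongr; nlinarith
      _ = _ := by ring
  have c5 : τ / 2 * (inner ℝ (f t - f t') e1 - inner ℝ (a (j + 1) - b (2 * j + 1)) e1
      - inner ℝ (a (j + 1) - b (2 * j + 1 + 1)) e1) ≤ τ / 2 *
      (L * (τ / 2) * (2 * M) + (2 * M) * (τ / 2 * M) + K * T * M ^ 2 * τ) := by
    refine mul_le_mul_of_nonneg_left ?_ (by positivity)
    have : 0 ≤ inner ℝ (a (j + 1) - b (2 * j + 1 + 1)) e1 := by simpa using m2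
    linarith
  nlinarith [mul_nonneg hM0 hL0, sq_nonneg τ, mul_nonneg (mul_nonneg hM0 hL0) (sq_nonneg τ)]

/-- At most `T / τ` steps each contribute `O(τ ^ 2)`, so the squared distance is `O(τ)`. -/
theorem norm_sub_halving_le (h : IsRothe G f τ u a) (h' : IsRothe G f (τ / 2) w b)
    (hG : MonotoneFamily G K) (hτ : 0 < τ)
    {L M T : ℝ} (hL : ∀ t r, ‖f t - f r‖ ≤ L * |t - r|)
    (hu : ∀ j : ℕ, j * τ ≤ T → ‖u j‖ ≤ M) (ha : ∀ j : ℕ, j * τ ≤ T → ‖a j‖ ≤ M)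
    (hw : ∀ j : ℕ, j * (τ / 2) ≤ T → ‖w j‖ ≤ M) (hb : ∀ j : ℕ, j * (τ / 2) ≤ T → ‖b j‖ ≤ M)
    (hg : ∀ j : ℕ, j * (τ / 2) ≤ T → ‖f (j * (τ / 2)) - b j‖ ≤ M) (h0 : u 0 = w 0)
    {j : ℕ} (hj : j * τ ≤ T) :
    ‖u j - w (2 * j)‖ ^ 2 ≤ (2 * M * L + K * T * M ^ 2 + M ^ 2) * T * τ := by
  have key : ∀ j : ℕ, j * τ ≤ T →
      ‖u j - w (2 * j)‖ ^ 2 ≤ (2 * M * L + K * T * M ^ 2 + M ^ 2) * (j * τ) * τ := by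
    intro j
    induction j with
    | zero => intro _; simp [h0]
    | succ j ih =>
      intro hj
      have h1 := h.halving_step h' hG hτ hL hu ha hw hb hg hj
      have h2 := ih (by push_cast at hj; linarith)
      push_cast
      linarith
  have hL0 : 0 ≤ L := by simpa using (norm_nonneg _).trans (hL 1 0)
  have hK := hG.K_nonneg
  have hT : 0 ≤ T := le_trans (by positivity) hj
  have hM0 : 0 ≤ M := (norm_nonneg _).trans (hu j hj)
  refine (key j hj).trans ?_
  gcongr

theorem norm_sub_le (h : IsRothe G f τ u a) (hτ : 0 < τ) {M T : ℝ}
    (hg : ∀ j : ℕ, j * τ ≤ T → ‖f (j * τ) - a j‖ ≤ M) (i n : ℕ) (hn : (i + n : ℕ) * τ ≤ T) :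
    ‖u (i + n) - u i‖ ≤ M * (n * τ) := by
  induction n with
  | zero => simp
  | succ n ih =>
    have h1 := ih (by push_cast at hn ⊢; linarith)
    have h2 := h.step (i + n)
    have h3 := hg _ hn
    have e1 : u (i + (n + 1)) - u i = (u (i + n + 1) - u (i + n)) + (u (i + n) - u i) := by
      rw [← add_assoc]; abel
    rw [e1, h2]
    refine (norm_add_le _ _).trans ?_
    rw [norm_smul, Real.norm_of_nonneg hτ.le]
    have h4 := mul_le_mul_of_nonneg_left h3 hτ.le
    rw [← add_assoc] at h4
    push_cast at h4 ⊢
    linarith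

end IsRothe

theorem ceil_div_eq {τ : ℝ} (hτ : 0 < τ) {j : ℕ} {r : ℝ} (hr : r ∈ Ioc (j * τ) ((j + 1 : ℕ) * τ)) :
    ⌈r / τ⌉₊ = j + 1 := by
  rw [Nat.ceil_eq_iff (by simp)]
  constructor
  · rw [Nat.add_sub_cancel, lt_div_iff₀ hτ]; exact hr.1
  · rw [div_le_iff₀ hτ]; exact hr.2

theorem measurable_comp_ceil_div {β : Type*} [MeasurableSpace β] (γ : ℕ → β) (τ : ℝ) :
    Measurable fun r : ℝ => γ ⌈r / τ⌉₊ :=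
  measurable_from_nat.comp (Nat.measurable_ceil.comp (measurable_id.div_const τ))

/-- The step function `r ↦ γ ⌈r / τ⌉₊` takes on each cell the value at its right endpoint, as the
implicit scheme does, so its integral telescopes. -/
theorem integral_comp_ceil_div {τ : ℝ} (hτ : 0 < τ) {S γ : ℕ → ℝ}
    (hS : ∀ j, S (j + 1) - S j = τ * γ (j + 1)) (j : ℕ) :
    IntervalIntegrable (fun r => γ ⌈r / τ⌉₊) volume 0 (j * τ) ∧
      ∫ r in (0 : ℝ)..(j * τ), γ ⌈r / τ⌉₊ = S j - S 0 := by
  induction j with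
  | zero => simp
  | succ j ih =>
    have hle : (j : ℝ) * τ ≤ (j + 1 : ℕ) * τ := by gcongr; simp
    have hc : ∀ r ∈ uIoc ((j : ℝ) * τ) ((j + 1 : ℕ) * τ), γ (j + 1) = γ ⌈r / τ⌉₊ := by
      intro r hr
      rw [uIoc_of_le hle] at hr
      rw [ceil_div_eq hτ hr]
    have hi : IntervalIntegrable (fun r => γ ⌈r / τ⌉₊) volume (j * τ) ((j + 1 : ℕ) * τ) :=
      (intervalIntegrable_const (c := γ (j + 1))).congr hc
    refine ⟨ih.1.trans hi, ?_⟩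
    rw [← intervalIntegral.integral_add_adjacent_intervals ih.1 hi, ih.2,
      ← intervalIntegral.integral_congr_ae (ae_of_all _ hc), intervalIntegral.integral_const]
    have := hS j
    push_cast
    simp only [smul_eq_mul]
    linarith

/-- The sum runs up to the node `⌈t / τ⌉₊ * τ`, which exceeds `t` by at most `τ`; the integrand is
constant on the excess. -/
theorem abs_sub_integral_comp_ceil_div_le {τ : ℝ} (hτ : 0 < τ) {S γ : ℕ → ℝ}
    (hS : ∀ j, S (j + 1) - S j = τ * γ (j + 1)) {t B : ℝ} (ht : 0 ≤ t)
    (hB : |γ ⌈t / τ⌉₊| ≤ B) :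
    |(S ⌈t / τ⌉₊ - S 0) - ∫ r in (0 : ℝ)..t, γ ⌈r / τ⌉₊| ≤ B * τ := by
  set n := ⌈t / τ⌉₊ with hn
  have h1 : t ≤ n * τ := by
    rw [← div_le_iff₀ hτ]; exact Nat.le_ceil _
  have h2 : n * τ - t ≤ τ := by
    have := (Nat.ceil_lt_add_one (div_nonneg ht hτ.le)).le
    rw [← hn] at this
    have h3 := mul_le_mul_of_nonneg_right this hτ.le
    rw [add_mul, div_mul_cancel₀ _ hτ.ne'] at h3
    linarith
  obtain ⟨hi, hI⟩ := integral_comp_ceil_div hτ hS n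
  have hi1 : IntervalIntegrable (fun r => γ ⌈r / τ⌉₊) volume 0 t :=
    hi.mono_set (by
      rw [uIcc_of_le ht, uIcc_of_le (ht.trans h1)]
      exact Icc_subset_Icc le_rfl h1)
  rw [← hI, intervalIntegral.integral_interval_sub_left hi hi1]
  have hB0 : 0 ≤ B := (abs_nonneg _).trans hB
  rw [← Real.norm_eq_abs]
  refine (intervalIntegral.norm_integral_le_of_norm_le_const (C := B) ?_).trans ?_
  · intro r hr
    rw [uIoc_of_le h1] at hr
    have e1 : n ≤ ⌈r / τ⌉₊ := Nat.ceil_le_ceil (by gcongr; exact hr.1.le)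
    have e2 : ⌈r / τ⌉₊ ≤ n := Nat.ceil_le.2 (by rw [div_le_iff₀ hτ]; exact hr.2)
    rw [le_antisymm e2 e1]
    exact hB
  · rw [abs_of_nonneg (by linarith)]
    gcongr

end Rothe

/-! ### Passage to the limit in the scheme. -/

section Rothe

variable {H : Type*} [NormedAddCommGroup H] [InnerProductSpace ℝ H]

/-- The coarse node assigned to `t` is the fine node assigned to `t` or the next one, so comparing
the two step functions costs at most one fine step beyond the comparison at common nodes. -/
theorem ceil_div_half {τ : ℝ} (t : ℝ) :
    2 * ⌈t / τ⌉₊ = ⌈t / (τ / 2)⌉₊ ∨ 2 * ⌈t / τ⌉₊ = ⌈t / (τ / 2)⌉₊ + 1 := by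
  have e : t / (τ / 2) = 2 * (t / τ) := by rw [div_div_eq_mul_div]; ring
  rw [e]
  set x := t / τ
  rcases le_or_gt x 0 with hx | hx
  · left
    rw [Nat.ceil_eq_zero.2 hx, Nat.ceil_eq_zero.2 (by linarith)]
  have h1 : ⌈2 * x⌉₊ ≤ 2 * ⌈x⌉₊ := Nat.ceil_le.2 (by push_cast; linarith [Nat.le_ceil x])
  have h2 : 2 * ⌈x⌉₊ < ⌈2 * x⌉₊ + 2 := by
    have a1 := Nat.ceil_lt_add_one hx.le
    have a2 := Nat.le_ceil (2 * x)
    have : ((2 * ⌈x⌉₊ : ℕ) : ℝ) < ((⌈2 * x⌉₊ + 2 : ℕ) : ℝ) := by push_cast; linarith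
    exact_mod_cast this
  omega

theorem ceil_div_mul_mem {τ : ℝ} (hτ : 0 < τ) {t : ℝ} (ht : 0 ≤ t) :
    t ≤ ⌈t / τ⌉₊ * τ ∧ ⌈t / τ⌉₊ * τ ≤ t + τ := by
  constructor
  · rw [← div_le_iff₀ hτ]; exact Nat.le_ceil _
  · have := (Nat.ceil_lt_add_one (div_nonneg ht hτ.le)).le
    have h3 := mul_le_mul_of_nonneg_right this hτ.le
    rw [add_mul, div_mul_cancel₀ _ hτ.ne'] at h3
    linarith

/-- The relations are closed under strong convergence in the first and boundedness in the
second variable, and then the second variable converges weakly. -/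
def IsDemiclosed (G : ℝ → H → H → Prop) : Prop :=
  ∀ (t : ℕ → ℝ) (u a : ℕ → H) (t₀ : ℝ) (u₀ : H) (M : ℝ), Tendsto t atTop (𝓝 t₀) →
    Tendsto u atTop (𝓝 u₀) → (∀ k, ‖a k‖ ≤ M) → (∀ k, G (t k) (u k) (a k)) →
    ∃ a₀, G t₀ u₀ a₀ ∧ ∀ w, Tendsto (fun k => inner ℝ (a k) w) atTop (𝓝 (inner ℝ a₀ w))

theorem norm_le_of_tendsto_inner {a : ℕ → H} {a₀ : H} {M : ℝ} (ha : ∀ k, ‖a k‖ ≤ M)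
    (h : ∀ w, Tendsto (fun k => inner ℝ (a k) w) atTop (𝓝 (inner ℝ a₀ w))) : ‖a₀‖ ≤ M := by
  have h1 : inner ℝ a₀ a₀ ≤ M * ‖a₀‖ := le_of_tendsto' (h a₀) fun k =>
    (real_inner_le_norm _ _).trans (mul_le_mul_of_nonneg_right (ha k) (norm_nonneg _))
  rw [real_inner_self_eq_norm_mul_norm] at h1
  by_cases h0 : ‖a₀‖ = 0
  · rw [h0]; exact (norm_nonneg _).trans (ha 0)
  · exact le_of_mul_le_mul_right h1 (lt_of_le_of_ne (norm_nonneg _) (Ne.symm h0))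

/-- Implicit Euler sequences with steps `T / 2 ^ k` and uniform bounds. -/
theorem MonotoneFamily.exists_rothe_sequences {G : ℝ → H → H → Prop} {K : ℝ}
    (hG : MonotoneFamily G K) {T : ℝ} (hT : 0 < T) {f : ℝ → H} {F L : ℝ}
    (hF : ∀ t, ‖f t‖ ≤ F) (hL : ∀ t r, ‖f t - f r‖ ≤ L * |t - r|) {u₀ a₀ : H} (h₀ : G 0 u₀ a₀) :
    ∃ (u a : ℕ → ℕ → H) (M : ℝ), (∀ k, IsRothe G f (T / 2 ^ k) (u k) (a k)) ∧
      (∀ k, u k 0 = u₀) ∧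
      ∀ k (j : ℕ), j * (T / 2 ^ k) ≤ T →
        ‖u k j‖ ≤ M ∧ ‖a k j‖ ≤ M ∧ ‖f (j * (T / 2 ^ k)) - a k j‖ ≤ M := by
  have hτ : ∀ k : ℕ, 0 < T / 2 ^ k := fun k => by positivity
  have hF0 : 0 ≤ F := (norm_nonneg _).trans (hF 0)
  choose u a hR hu ha using fun k => hG.exists_isRothe f (hτ k) h₀
  set R := max ‖f 0 - a₀‖ 1 + (L + K * (‖u₀‖ + T * F) * (F + 1)) * T
  have hg : ∀ k (j : ℕ), j * (T / 2 ^ k) ≤ T → ‖f (j * (T / 2 ^ k)) - a k j‖ ≤ R := by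
    intro k j hj
    have := (hR k).norm_residual_le hG (hτ k) hT.le hF hL hj
    rwa [hu, ha] at this
  refine ⟨u, a, (‖u₀‖ + T * F) + (F + R), hR, hu, fun k j hj => ?_⟩
  have hgj := hg k j hj
  have hR0 : 0 ≤ R := (norm_nonneg _).trans hgj
  have hTF : 0 ≤ ‖u₀‖ + T * F := by positivity
  refine ⟨?_, ?_, by linarith⟩
  · have := (hR k).norm_le hG (hτ k) hF j
    rw [hu] at this
    have h2 : (j : ℝ) * (T / 2 ^ k) * F ≤ T * F := by gcongr
    linarith
  · have e : a k j = f (j * (T / 2 ^ k)) - (f (j * (T / 2 ^ k)) - a k j) := by abel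
    have : ‖a k j‖ ≤ F + R := by
      rw [e]
      exact (norm_sub_le _ _).trans (add_le_add (hF _) hgj)
    linarith

/-- Solvability of `u' + G t u ∋ f t`, `u 0 = u₀`, for a demiclosed monotone family and an initial
value in the domain. -/
theorem MonotoneFamily.exists_solution [CompleteSpace H] {G : ℝ → H → H → Prop} {K : ℝ}
    (hG : MonotoneFamily G K) (hcl : IsDemiclosed G) {T : ℝ} (hT : 0 < T) {f : ℝ → H} {F L : ℝ}
    (hF : ∀ t, ‖f t‖ ≤ F) (hL : ∀ t r, ‖f t - f r‖ ≤ L * |t - r|) {u₀ a₀ : H} (h₀ : G 0 u₀ a₀) :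
    ∃ (u a : ℝ → H) (M : ℝ), u 0 = u₀ ∧ (∀ t ∈ Icc 0 T, G t (u t) (a t)) ∧
      (∀ t ∈ Icc 0 T, ‖a t‖ ≤ M) ∧
      (∀ r ∈ Icc 0 T, ∀ t ∈ Icc 0 T, r ≤ t → ‖u t - u r‖ ≤ M * (t - r)) ∧
      ∀ t ∈ Icc 0 T, ∀ w, inner ℝ (u t - u₀) w = ∫ r in (0 : ℝ)..t, inner ℝ (f r - a r) w := by
  obtain ⟨u, a, M, hR, hu0, hM⟩ := hG.exists_rothe_sequences hT hF hL h₀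
  have hτ : ∀ k : ℕ, 0 < T / 2 ^ k := fun k => by positivity
  have hL0 : 0 ≤ L := by simpa using (norm_nonneg _).trans (hL 1 0)
  have hK := hG.K_nonneg
  have hM0 : 0 ≤ M := (norm_nonneg _).trans (hM 0 0 (by simpa using hT.le)).1
  have hτ2 : ∀ k : ℕ, T / 2 ^ (k + 1) = T / 2 ^ k / 2 := fun k => by rw [pow_succ]; field_simp
  have hidx : ∀ k : ℕ, ∀ t ∈ Icc 0 T, (⌈t / (T / 2 ^ k)⌉₊ : ℝ) * (T / 2 ^ k) ≤ T := by
    intro k t ht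
    have : ⌈t / (T / 2 ^ k)⌉₊ ≤ 2 ^ k := by
      rw [Nat.ceil_le, div_le_iff₀ (hτ k)]
      push_cast
      rw [mul_div_cancel₀ _ (by positivity)]
      exact ht.2
    calc (⌈t / (T / 2 ^ k)⌉₊ : ℝ) * (T / 2 ^ k) ≤ ((2 ^ k : ℕ) : ℝ) * (T / 2 ^ k) := by
          gcongr
      _ = T := by push_cast; rw [mul_div_cancel₀ _ (by positivity)]
  set U : ℕ → ℝ → H := fun k t => u k ⌈t / (T / 2 ^ k)⌉₊ with hU
  set A : ℕ → ℝ → H := fun k t => a k ⌈t / (T / 2 ^ k)⌉₊ with hA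
  set θ : ℕ → ℝ → ℝ := fun k t => ⌈t / (T / 2 ^ k)⌉₊ * (T / 2 ^ k) with hθ
  set C := 2 * M * L + K * T * M ^ 2 + M ^ 2 with hC
  have hC0 : 0 ≤ C := by positivity
  -- The comparison estimate is of order `√(T / 2 ^ k)`, hence geometric with ratio `q`.
  set q := √(1 / 2 : ℝ) with hq
  have hq0 : 0 ≤ q := Real.sqrt_nonneg _
  have hq1 : q < 1 := by rw [hq, Real.sqrt_lt' one_pos]; norm_num
  have hq2 : ∀ k : ℕ, T / 2 ^ k = T * (q ^ k) ^ 2 := by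
    intro k
    rw [← pow_mul, mul_comm k 2, pow_mul, hq, Real.sq_sqrt (by norm_num)]
    simp [div_eq_mul_inv]
  have hqk : ∀ k : ℕ, T / 2 ^ k ≤ T * q ^ k := by
    intro k
    rw [hq2]
    have : q ^ k ≤ 1 := pow_le_one₀ hq0 hq1.le
    have h0 : 0 ≤ q ^ k := pow_nonneg hq0 k
    gcongr
    nlinarith
  have hτ0 : Tendsto (fun k : ℕ => T / 2 ^ k) atTop (𝓝 0) :=
    squeeze_zero (fun k => (hτ k).le) hqk
      (by simpa using (tendsto_pow_atTop_nhds_zero_of_lt_one hq0 hq1).const_mul T)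
  have hθt : ∀ t ∈ Icc 0 T, Tendsto (fun k => θ k t) atTop (𝓝 t) := by
    intro t ht
    refine tendsto_of_tendsto_of_tendsto_of_le_of_le tendsto_const_nhds
      (by simpa using hτ0.const_add t) (fun k => (ceil_div_mul_mem (hτ k) ht.1).1)
      (fun k => (ceil_div_mul_mem (hτ k) ht.1).2)
  have hcau : ∀ t ∈ Icc 0 T, CauchySeq fun k => U k t := by
    intro t ht
    refine cauchySeq_of_le_geometric q ((√C + M) * T) hq1 fun k => ?_
    rw [dist_eq_norm]
    have h1 := (hR k).norm_sub_halving_le (by rw [← hτ2]; exact hR (k + 1)) hG (hτ k) hL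
      (fun j hj => (hM k j hj).1) (fun j hj => (hM k j hj).2.1)
      (fun j hj => (hM (k + 1) j (by rwa [hτ2])).1) (fun j hj => (hM (k + 1) j (by rwa [hτ2])).2.1)
      (fun j hj => by rw [← hτ2]; exact (hM (k + 1) j (by rwa [hτ2])).2.2)
      (by rw [hu0, hu0]) (hidx k t ht)
    set j := ⌈t / (T / 2 ^ k)⌉₊ with hj
    have h2 : ‖u k j - u (k + 1) (2 * j)‖ ≤ √C * T * q ^ k := by
      have e : √C * T * q ^ k = √(C * T * (T / 2 ^ k)) := by
        rw [hq2, show C * T * (T * (q ^ k) ^ 2) = C * (T * q ^ k) ^ 2 by ring,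
          Real.sqrt_mul hC0, Real.sqrt_sq (by positivity)]
        ring
      rw [e]
      exact Real.le_sqrt_of_sq_le h1
    have h3 : ‖u (k + 1) (2 * j) - U (k + 1) t‖ ≤ M * T * q ^ k := by
      have hc := ceil_div_half (τ := T / 2 ^ k) t
      rw [← hτ2] at hc
      rcases hc with hc | hc
      · rw [← hj] at hc
        rw [hc, hU]
        simp only [sub_self, norm_zero]
        positivity
      · rw [← hj] at hc
        have hs := (hR (k + 1)).step ⌈t / (T / 2 ^ (k + 1))⌉₊
        have hb : ((2 * j : ℕ) : ℝ) * (T / 2 ^ (k + 1)) ≤ T := by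
          have := hidx k t ht
          rw [← hj] at this
          rw [hτ2]; push_cast; linarith
        have hb' := (hM (k + 1) _ hb).2.2
        rw [← hc] at hs
        simp only [hU]
        rw [hs, norm_smul, Real.norm_of_nonneg (hτ _).le]
        calc T / 2 ^ (k + 1) * _ ≤ (T * q ^ k) * M := by
              gcongr
              rw [hτ2]
              linarith [hqk k, hτ k]
          _ = _ := by ring
    calc ‖U k t - U (k + 1) t‖ = ‖(u k j - u (k + 1) (2 * j))
          + (u (k + 1) (2 * j) - U (k + 1) t)‖ := by congr 1; simp only [hU]; abel
      _ ≤ _ := (norm_add_le _ _).trans (add_le_add h2 h3)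
      _ = _ := by ring
  -- Demiclosedness, applied at each time separately, yields the strong limit of `U k t` and the
  -- weak limit of `A k t`. Outside `[0, T]` the pair is the default `0`.
  have hex : ∀ t, ∃ p : H × H, t ∈ Icc 0 T → Tendsto (fun k => U k t) atTop (𝓝 p.1) ∧ G t p.1 p.2 ∧
      ∀ w, Tendsto (fun k => inner ℝ (A k t) w) atTop (𝓝 (inner ℝ p.2 w)) := by
    intro t
    by_cases ht : t ∈ Icc 0 T
    · obtain ⟨x, hx⟩ := cauchySeq_tendsto_of_complete (hcau t ht)
      obtain ⟨b, hb, hb'⟩ := hcl (fun k => θ k t) (fun k => U k t) (fun k => A k t) t x M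
        (hθt t ht) hx (fun k => (hM k _ (hidx k t ht)).2.1) (fun k => (hR k).mem _)
      exact ⟨(x, b), fun _ => ⟨hx, hb, hb'⟩⟩
    · exact ⟨0, fun h => absurd h ht⟩
  choose p hp using hex
  have hp0 : (p 0).1 = u₀ := by
    refine tendsto_nhds_unique (hp 0 ⟨le_rfl, hT.le⟩).1 ?_
    simp [hU, hu0]
  refine ⟨fun t => (p t).1, fun t => (p t).2, M, hp0, fun t ht => (hp t ht).2.1,
    fun t ht => norm_le_of_tendsto_inner (fun k => (hM k _ (hidx k t ht)).2.1) (hp t ht).2.2,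
    ?_, ?_⟩
  · intro r hr t ht hrt
    have h1 : Tendsto (fun k : ℕ => M * (t - r + T / 2 ^ k)) atTop (𝓝 (M * (t - r))) := by
      simpa using (hτ0.const_add (t - r)).const_mul M
    -- The nodes of `r` and `t` are at most `t - r + τ` apart; the surplus `τ` vanishes in the
    -- limit.
    refine le_of_tendsto_of_tendsto' ((hp t ht).1.sub (hp r hr).1).norm h1 fun k => ?_
    obtain ⟨n, hn⟩ := Nat.exists_eq_add_of_le
      (Nat.ceil_le_ceil (div_le_div_of_nonneg_right hrt (hτ k).le))
    have h2 := (hR k).norm_sub_le (hτ k) (fun j hj => (hM k j hj).2.2) ⌈r / (T / 2 ^ k)⌉₊ n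
      (by rw [← hn]; exact hidx k t ht)
    rw [← hn] at h2
    refine h2.trans ?_
    gcongr
    have h3 := (ceil_div_mul_mem (hτ k) ht.1).2
    have h4 := (ceil_div_mul_mem (hτ k) hr.1).1
    rw [hn] at h3
    push_cast at h3
    linarith
  intro t ht w
  have hsub : ∀ r ∈ uIoc 0 t, r ∈ Icc 0 T := by
    intro r hr
    rw [uIoc_of_le ht.1] at hr
    exact ⟨hr.1.le, hr.2.trans ht.2⟩
  have hfc : Continuous f := by
    refine (LipschitzWith.of_dist_le_mul (K := ⟨L, hL0⟩) fun x y => ?_).continuous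
    rw [dist_eq_norm, Real.dist_eq]
    exact hL x y
  have hlim : Tendsto (fun k => ∫ r in (0 : ℝ)..t, inner ℝ (f (θ k r) - A k r) w) atTop
      (𝓝 (∫ r in (0 : ℝ)..t, inner ℝ (f r - (p r).2) w)) := by
    refine intervalIntegral.tendsto_integral_filter_of_dominated_convergence
      (fun _ => M * ‖w‖) (Eventually.of_forall fun k => ?_) (Eventually.of_forall fun k => ?_)
      intervalIntegrable_const (ae_of_all _ fun r hr => ?_)
    · exact (measurable_comp_ceil_div (fun j => inner ℝ (f (j * (T / 2 ^ k)) - a k j) w)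
        (T / 2 ^ k)).aestronglyMeasurable
    · refine ae_of_all _ fun r hr => (norm_inner_le_norm _ _).trans ?_
      gcongr
      exact (hM k _ (hidx k r (hsub r hr))).2.2
    · simp only [inner_sub_left]
      exact (((hfc.tendsto _).comp (hθt r (hsub r hr))).inner tendsto_const_nhds).sub
        ((hp r (hsub r hr)).2.2 w)
  -- The scheme satisfies the integrated equation at time `t` up to an error `M * ‖w‖ * τ`.
  have hlim2 : Tendsto (fun k => inner ℝ (U k t - u₀) w
      - ∫ r in (0 : ℝ)..t, inner ℝ (f (θ k r) - A k r) w) atTop (𝓝 0) := by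
    refine squeeze_zero_norm (a := fun k : ℕ => (M * ‖w‖) * (T / 2 ^ k)) (fun k => ?_)
      (by simpa using hτ0.const_mul (M * ‖w‖))
    have := abs_sub_integral_comp_ceil_div_le (hτ k) (S := fun j => inner ℝ (u k j) w)
      (γ := fun j => inner ℝ (f (j * (T / 2 ^ k)) - a k j) w) (B := M * ‖w‖) (t := t)
      (fun j => by rw [← inner_sub_left, (hR k).step, real_inner_smul_left]) ht.1
      ((abs_real_inner_le_norm _ _).trans (by gcongr; exact (hM k _ (hidx k t ht)).2.2))
    rw [hu0, ← inner_sub_left] at this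
    exact this
  have hlim3 := ((((hp t ht).1.sub_const u₀).inner (tendsto_const_nhds (x := w))).sub hlim)
  exact sub_eq_zero.1 (tendsto_nhds_unique hlim3 hlim2)

end Rothe

/-! ### Pointwise inequalities for powers of the norm. -/

section PowerInequalities

variable {E : Type*} [NormedAddCommGroup E] [InnerProductSpace ℝ E]

/-- The difference of the two sides is half of `(‖ξ‖ ^ β - ‖η‖ ^ β) * (‖ξ‖ ^ 2 - ‖η‖ ^ 2)`, whose
factors have equal sign. -/
theorem half_mul_norm_sub_sq_le_inner_rpow_smul_sub {β : ℝ} (hβ : 0 ≤ β) (ξ η : E) :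
    (‖ξ‖ ^ β + ‖η‖ ^ β) / 2 * ‖ξ - η‖ ^ 2 ≤
      inner ℝ (‖ξ‖ ^ β • ξ - ‖η‖ ^ β • η) (ξ - η) := by
  have h1 : 0 ≤ (‖ξ‖ ^ β - ‖η‖ ^ β) * (‖ξ‖ ^ 2 - ‖η‖ ^ 2) := by
    rcases le_total ‖ξ‖ ‖η‖ with h | h
    · exact mul_nonneg_of_nonpos_of_nonpos
        (sub_nonpos.2 (Real.rpow_le_rpow (norm_nonneg _) h hβ)) (sub_nonpos.2 (by gcongr))
    · exact mul_nonneg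
        (sub_nonneg.2 (Real.rpow_le_rpow (norm_nonneg _) h hβ)) (sub_nonneg.2 (by gcongr))
  rw [inner_sub_left, inner_sub_right, inner_sub_right, real_inner_smul_left, real_inner_smul_left,
    real_inner_smul_left, real_inner_smul_left, real_inner_self_eq_norm_sq,
    real_inner_self_eq_norm_sq, real_inner_comm ξ η, norm_sub_sq_real]
  nlinarith

/-- Bernoulli's inequality for `(y / x) ^ (β + 1)`. The extra factor `y` on the left keeps the bound
valid for `β < 1`, where `z ^ β` is not Lipschitz at zero. -/
theorem rpow_sub_rpow_mul_le {β x y : ℝ} (hβ : 0 ≤ β) (hy : 0 ≤ y) (hxy : y ≤ x) :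
    (x ^ β - y ^ β) * y ≤ (β + 1) * x ^ β * (x - y) := by
  rcases hy.eq_or_lt with rfl | hy
  · simp only [mul_zero, sub_zero]
    have := Real.rpow_nonneg hxy β
    positivity
  have hx : 0 < x := hy.trans_le hxy
  have hb := one_add_mul_self_le_rpow_one_add (s := y / x - 1) (by
    have : 0 ≤ y / x := by positivity
    linarith) (p := β + 1) (by linarith)
  have e1 : (1 + (y / x - 1)) = y / x := by ring
  rw [e1, Real.div_rpow hy.le hx.le, Real.rpow_add_one hx.ne', Real.rpow_add_one hy.ne'] at hb
  have hxb : 0 < x ^ β := Real.rpow_pos_of_pos hx β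
  have hb2 := mul_le_mul_of_nonneg_right hb (mul_pos hxb hx).le
  rw [div_mul_cancel₀ _ (mul_pos hxb hx).ne'] at hb2
  have e2 : (1 + (β + 1) * (y / x - 1)) * (x ^ β * x) =
      x ^ β * x + (β + 1) * (y - x) * x ^ β := by
    field_simp
  rw [e2] at hb2
  nlinarith

theorem norm_rpow_smul_sub_le_of_le {β : ℝ} (hβ : 0 ≤ β) {ξ η : E} (h : ‖η‖ ≤ ‖ξ‖) :
    ‖‖ξ‖ ^ β • ξ - ‖η‖ ^ β • η‖ ≤ (β + 2) * ‖ξ‖ ^ β * ‖ξ - η‖ := by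
  have e : ‖ξ‖ ^ β • ξ - ‖η‖ ^ β • η = ‖ξ‖ ^ β • (ξ - η) + (‖ξ‖ ^ β - ‖η‖ ^ β) • η := by
    module
  have hp := Real.rpow_nonneg (norm_nonneg ξ) β
  have h0 : 0 ≤ ‖ξ‖ ^ β - ‖η‖ ^ β := sub_nonneg.2 (Real.rpow_le_rpow (norm_nonneg _) h hβ)
  rw [e]
  refine (norm_add_le _ _).trans ?_
  rw [norm_smul, norm_smul, Real.norm_of_nonneg hp, Real.norm_of_nonneg h0]
  have h1 := rpow_sub_rpow_mul_le hβ (norm_nonneg η) h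
  have h2 : (β + 1) * ‖ξ‖ ^ β * (‖ξ‖ - ‖η‖) ≤ (β + 1) * ‖ξ‖ ^ β * ‖ξ - η‖ := by
    gcongr
    exact norm_sub_norm_le _ _
  linarith

theorem norm_rpow_smul_sub_le {β : ℝ} (hβ : 0 ≤ β) (ξ η : E) :
    ‖‖ξ‖ ^ β • ξ - ‖η‖ ^ β • η‖ ≤ (β + 2) * (‖ξ‖ ^ β + ‖η‖ ^ β) * ‖ξ - η‖ := by
  have hp := Real.rpow_nonneg (norm_nonneg ξ) β
  have hp' := Real.rpow_nonneg (norm_nonneg η) β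
  rcases le_total ‖η‖ ‖ξ‖ with h | h
  · refine (norm_rpow_smul_sub_le_of_le hβ h).trans ?_
    gcongr
    linarith
  · rw [norm_sub_rev, norm_sub_rev ξ]
    refine (norm_rpow_smul_sub_le_of_le hβ h).trans ?_
    gcongr
    linarith

/-- The subgradient inequality for the convex function `‖·‖ ^ (β + 2) / (β + 2)`; it is Young's
inequality with exponents `(β + 2) / (β + 1)` and `β + 2`. -/
theorem rpow_norm_add_inner_le {β : ℝ} (hβ : 0 ≤ β) (ξ η : E) :
    ‖ξ‖ ^ (β + 2) / (β + 2) + inner ℝ (‖ξ‖ ^ β • ξ) (η - ξ) ≤ ‖η‖ ^ (β + 2) / (β + 2) := by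
  have hp := Real.rpow_nonneg (norm_nonneg ξ) β
  have e1 : ‖ξ‖ ^ (β + 2) = ‖ξ‖ ^ β * ‖ξ‖ ^ 2 := by
    rw [Real.rpow_add_of_nonneg (norm_nonneg _) hβ (by norm_num)]; norm_num
  have hconj : Real.HolderConjugate ((β + 2) / (β + 1)) (β + 2) := by
    rw [Real.holderConjugate_iff]
    constructor
    · rw [one_lt_div (by linarith)]; linarith
    · field_simp
      ring
  have hy := Real.young_inequality_of_nonneg (a := ‖ξ‖ ^ (β + 1)) (b := ‖η‖)
    (Real.rpow_nonneg (norm_nonneg _) _) (norm_nonneg _) hconj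
  rw [← Real.rpow_mul (norm_nonneg _), mul_div_cancel₀ _ (by linarith : β + 1 ≠ 0)] at hy
  have e2 : ‖ξ‖ ^ (β + 1) = ‖ξ‖ ^ β * ‖ξ‖ := by
    rw [Real.rpow_add_of_nonneg (norm_nonneg _) hβ (by norm_num)]; norm_num
  have h1 : inner ℝ (‖ξ‖ ^ β • ξ) η ≤ ‖ξ‖ ^ (β + 1) * ‖η‖ := by
    rw [real_inner_smul_left, e2, mul_assoc]
    gcongr
    exact real_inner_le_norm _ _
  rw [inner_sub_right, real_inner_smul_left _ ξ, real_inner_self_eq_norm_sq, ← e1]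
  have e3 : ‖ξ‖ ^ (β + 2) / ((β + 2) / (β + 1)) = ‖ξ‖ ^ (β + 2) - ‖ξ‖ ^ (β + 2) / (β + 2) := by
    field_simp
    ring
  rw [e3] at hy
  linarith

/-- Clarkson's inequality for exponents `p ≥ 2`, pointwise. -/
theorem clarkson_norm_rpow {p : ℝ} (hp : 2 ≤ p) (ξ η : E) :
    ‖(1 / 2 : ℝ) • (ξ + η)‖ ^ p + ‖(1 / 2 : ℝ) • (ξ - η)‖ ^ p ≤ (‖ξ‖ ^ p + ‖η‖ ^ p) / 2 := by
  have hpow : ∀ x : ℝ, 0 ≤ x → (x ^ 2) ^ (p / 2) = x ^ p := by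
    intro x hx
    rw [← Real.rpow_natCast, ← Real.rpow_mul hx]
    congr 1
    push_cast; ring
  -- The parallelogram law settles `p = 2`. Superadditivity of `t ^ (p / 2)` on the left and its
  -- convexity on the right raise the exponent to `p`.
  have h1 : ‖(1 / 2 : ℝ) • (ξ + η)‖ ^ 2 + ‖(1 / 2 : ℝ) • (ξ - η)‖ ^ 2 =
      (1 / 2) * ‖ξ‖ ^ 2 + (1 / 2) * ‖η‖ ^ 2 := by
    have := parallelogram_law_with_norm ℝ ξ η
    rw [norm_smul, norm_smul, Real.norm_of_nonneg (by norm_num)]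
    nlinarith
  have hp2 : 1 ≤ p / 2 := by linarith
  have h2 := Real.add_rpow_le_rpow_add (sq_nonneg ‖(1 / 2 : ℝ) • (ξ + η)‖)
    (sq_nonneg ‖(1 / 2 : ℝ) • (ξ - η)‖) hp2
  have h3 := (convexOn_rpow hp2).2 (mem_Ici.2 (sq_nonneg ‖ξ‖)) (mem_Ici.2 (sq_nonneg ‖η‖))
    (by norm_num : (0 : ℝ) ≤ 1 / 2) (by norm_num : (0 : ℝ) ≤ 1 / 2) (by norm_num)
  simp only [smul_eq_mul] at h3
  rw [h1] at h2
  rw [hpow _ (norm_nonneg _), hpow _ (norm_nonneg _)] at h2 h3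
  linarith

/-- The larger of the two norms is at least half the distance. This converts a weight `‖ξ‖ ^ β + ‖η‖
^ β` into a power of `‖ξ - η‖`. -/
theorem norm_sub_half_rpow_le {V : Type*} [SeminormedAddCommGroup V] {β : ℝ} (hβ : 0 ≤ β)
    (ξ η : V) :
    (‖ξ - η‖ / 2) ^ β ≤ ‖ξ‖ ^ β + ‖η‖ ^ β := by
  have hp := Real.rpow_nonneg (norm_nonneg ξ) β
  have hp' := Real.rpow_nonneg (norm_nonneg η) β
  have h := norm_sub_le ξ η
  rcases le_total ‖η‖ ‖ξ‖ with h' | h'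
  · have := Real.rpow_le_rpow (by positivity) (by linarith : ‖ξ - η‖ / 2 ≤ ‖ξ‖) hβ
    linarith
  · have := Real.rpow_le_rpow (by positivity) (by linarith : ‖ξ - η‖ / 2 ≤ ‖η‖) hβ
    linarith

theorem rpow_le_one_add_rpow {x β γ : ℝ} (hx : 0 ≤ x) (hβ : 0 ≤ β) (h : β ≤ γ) :
    x ^ β ≤ 1 + x ^ γ := by
  rcases le_total x 1 with h1 | h1
  · have := Real.rpow_le_one hx h1 hβ
    have := Real.rpow_nonneg hx γ
    linarith
  · have := Real.rpow_le_rpow_of_exponent_le h1 h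
    linarith

end PowerInequalities

/-! ### Monotonicity, growth and potential of the flux. -/

namespace ForchheimerExponents

variable {N : ℕ} (e : ForchheimerExponents N) {E : Type*} [NormedAddCommGroup E]
  [InnerProductSpace ℝ E]

/-- The largest exponent `α_N`. -/
noncomputable def top : ℝ := e.α (Fin.last N)

theorem top_pos : 0 < e.top := by
  rw [top, ← e.zero]
  refine e.strictMono ?_
  rw [Fin.lt_def]
  exact e.one_le

theorem zero_ne_last (e : ForchheimerExponents N) : (0 : Fin (N + 1)) ≠ Fin.last N := by
  intro h
  have h2 := e.top_pos
  rw [top, ← h, e.zero] at h2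
  exact lt_irrefl _ h2

theorem α_nonneg (i : Fin (N + 1)) : 0 ≤ e.α i := by
  rw [← e.zero]; exact e.strictMono.monotone (Fin.zero_le i)

theorem α_le_top (i : Fin (N + 1)) : e.α i ≤ e.top := e.strictMono.monotone (Fin.le_last i)

/-- The flux `F(|ξ|) ξ`. -/
noncomputable def flux (c : Fin (N + 1) → ℝ) (ξ : E) : E := e.poly c ‖ξ‖ • ξ

/-- The potential of the flux. -/
noncomputable def potential {V : Type*} [NormedAddCommGroup V] (c : Fin (N + 1) → ℝ) (ξ : V) : ℝ :=
  ∑ i, c i * (‖ξ‖ ^ (e.α i + 2) / (e.α i + 2))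

theorem flux_eq_sum (c : Fin (N + 1) → ℝ) (ξ : E) :
    e.flux c ξ = ∑ i, c i • (‖ξ‖ ^ e.α i • ξ) := by
  simp only [flux, poly, Finset.sum_smul, smul_smul]

/-- Coefficients within the bounds of the problem. -/
structure Admissible (lo up : ℝ) (c : Fin (N + 1) → ℝ) : Prop where
  nonneg : ∀ i, 0 ≤ c i
  le : ∀ i, c i ≤ up
  zero : lo ≤ c 0
  last : lo ≤ c (Fin.last N)

variable {lo up : ℝ} {c c' : Fin (N + 1) → ℝ}

/-- Only the first and the last coefficient are bounded below. They are distinct because `N ≥ 1`, so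
both terms can be retained; the others are nonnegative. -/
theorem lo_mul_add_le_sum (e : ForchheimerExponents N) (hc : Admissible lo up c)
    {x : Fin (N + 1) → ℝ} (hx : ∀ i, 0 ≤ x i) :
    lo * x 0 + lo * x (Fin.last N) ≤ ∑ i, c i * x i := by
  calc lo * x 0 + lo * x (Fin.last N) ≤ c 0 * x 0 + c (Fin.last N) * x (Fin.last N) :=
        add_le_add (mul_le_mul_of_nonneg_right hc.zero (hx _))
          (mul_le_mul_of_nonneg_right hc.last (hx _))
    _ = ∑ i ∈ {0, Fin.last N}, c i * x i :=
      (Finset.sum_pair (f := fun i => c i * x i) e.zero_ne_last).symm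
    _ ≤ _ := Finset.sum_le_sum_of_subset_of_nonneg (Finset.subset_univ _)
      fun i _ _ => mul_nonneg (hc.nonneg i) (hx i)

theorem inner_flux_self (ξ : E) :
    inner ℝ (e.flux c ξ) ξ = ∑ i, c i * (‖ξ‖ ^ e.α i * ‖ξ‖ ^ 2) := by
  rw [flux_eq_sum, sum_inner]
  refine Finset.sum_congr rfl fun i _ => ?_
  rw [real_inner_smul_left, real_inner_smul_left, real_inner_self_eq_norm_sq]

theorem lo_mul_le_inner_flux_self (hc : Admissible lo up c) (ξ : E) :
    lo * ((1 + ‖ξ‖ ^ e.top) * ‖ξ‖ ^ 2) ≤ inner ℝ (e.flux c ξ) ξ := by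
  rw [inner_flux_self]
  have h := e.lo_mul_add_le_sum hc (x := fun i => ‖ξ‖ ^ e.α i * ‖ξ‖ ^ 2) fun i => by positivity
  simp only [e.zero, Real.rpow_zero] at h
  rw [top]
  linarith

theorem inner_flux_self_nonneg (hlo : 0 < lo) (hc : Admissible lo up c) (ξ : E) :
    0 ≤ inner ℝ (e.flux c ξ) ξ :=
  le_trans (by positivity) (e.lo_mul_le_inner_flux_self hc ξ)

theorem norm_flux_sub_coeff_le {δ : ℝ} (hδ : ∀ i, |c i - c' i| ≤ δ) (η : E) :
    ‖e.flux c η - e.flux c' η‖ ≤ δ * (N + 1) * ((1 + ‖η‖ ^ e.top) * ‖η‖) := by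
  have h1 : e.flux c η - e.flux c' η = ∑ i, (c i - c' i) • (‖η‖ ^ e.α i • η) := by
    simp only [flux_eq_sum, ← Finset.sum_sub_distrib, sub_smul]
  rw [h1]
  refine (norm_sum_le_of_le (f := fun i => (c i - c' i) • (‖η‖ ^ e.α i • η)) Finset.univ
    (n := fun _ => δ * ((1 + ‖η‖ ^ e.top) * ‖η‖)) fun i _ => ?_).trans ?_
  · have h0 : 0 ≤ ‖η‖ ^ e.α i := Real.rpow_nonneg (norm_nonneg _) _
    have hδ0 : 0 ≤ δ := (abs_nonneg _).trans (hδ i)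
    rw [norm_smul, norm_smul, Real.norm_of_nonneg h0, Real.norm_eq_abs]
    gcongr
    · exact hδ i
    · exact rpow_le_one_add_rpow (norm_nonneg _) (e.α_nonneg i) (e.α_le_top i)
  · simp only [Finset.sum_const, Finset.card_univ, Fintype.card_fin, nsmul_eq_mul]
    push_cast
    apply le_of_eq
    ring

theorem norm_flux_le (hc : Admissible lo up c) (ξ : E) :
    ‖e.flux c ξ‖ ≤ up * (N + 1) * ((1 + ‖ξ‖ ^ e.top) * ‖ξ‖) := by
  have h := e.norm_flux_sub_coeff_le (c := c) (c' := 0) (δ := up) (fun i => by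
    simpa [abs_of_nonneg (hc.nonneg i)] using hc.le i) ξ
  have h0 : e.flux 0 ξ = 0 := by simp [flux, poly]
  rwa [h0, sub_zero] at h

theorem norm_flux_sub_le (hc : Admissible lo up c) (ξ η : E) :
    ‖e.flux c ξ - e.flux c η‖ ≤
      up * (N + 1) * (e.top + 2) * 2 * ((1 + ‖ξ‖ ^ e.top + ‖η‖ ^ e.top) * ‖ξ - η‖) := by
  have h1 : e.flux c ξ - e.flux c η = ∑ i, c i • (‖ξ‖ ^ e.α i • ξ - ‖η‖ ^ e.α i • η) := by
    simp only [flux_eq_sum, ← Finset.sum_sub_distrib, smul_sub]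
  rw [h1]
  refine (norm_sum_le_of_le Finset.univ
    (n := fun _ => up * ((e.top + 2) * (2 * (1 + ‖ξ‖ ^ e.top + ‖η‖ ^ e.top)) * ‖ξ - η‖))
    fun i _ => ?_).trans ?_
  · rw [norm_smul, Real.norm_of_nonneg (hc.nonneg i)]
    have hup : 0 ≤ up := (hc.nonneg i).trans (hc.le i)
    have ht := e.top_pos
    refine mul_le_mul (hc.le i) ((norm_rpow_smul_sub_le (e.α_nonneg i) ξ η).trans ?_)
      (norm_nonneg _) hup
    have b1 := rpow_le_one_add_rpow (norm_nonneg ξ) (e.α_nonneg i) (e.α_le_top i)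
    have b2 := rpow_le_one_add_rpow (norm_nonneg η) (e.α_nonneg i) (e.α_le_top i)
    have p1 := Real.rpow_nonneg (norm_nonneg ξ) e.top
    have p2 := Real.rpow_nonneg (norm_nonneg η) e.top
    gcongr
    · exact e.α_le_top i
    · linarith
  · simp only [Finset.sum_const, Finset.card_univ, Fintype.card_fin, nsmul_eq_mul]
    push_cast
    apply le_of_eq
    ring

theorem strong_mono_flux_same (hc : Admissible lo up c) (ξ η : E) :
    lo * ((1 + (‖ξ‖ ^ e.top + ‖η‖ ^ e.top) / 2) * ‖ξ - η‖ ^ 2) ≤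
      inner ℝ (e.flux c ξ - e.flux c η) (ξ - η) := by
  have h1 : e.flux c ξ - e.flux c η = ∑ i, c i • (‖ξ‖ ^ e.α i • ξ - ‖η‖ ^ e.α i • η) := by
    simp only [flux_eq_sum, ← Finset.sum_sub_distrib, smul_sub]
  rw [h1, sum_inner]
  simp only [real_inner_smul_left]
  have h2 := fun i => half_mul_norm_sub_sq_le_inner_rpow_smul_sub (e.α_nonneg i) ξ η
  have h3 := e.lo_mul_add_le_sum hc
    (x := fun i => (‖ξ‖ ^ e.α i + ‖η‖ ^ e.α i) / 2 * ‖ξ - η‖ ^ 2) fun i => by positivity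
  have h4 : ∑ i, c i * ((‖ξ‖ ^ e.α i + ‖η‖ ^ e.α i) / 2 * ‖ξ - η‖ ^ 2) ≤
      ∑ i, c i * inner ℝ (‖ξ‖ ^ e.α i • ξ - ‖η‖ ^ e.α i • η) (ξ - η) :=
    Finset.sum_le_sum fun i _ => mul_le_mul_of_nonneg_left (h2 i) (hc.nonneg i)
  simp only [e.zero, Real.rpow_zero] at h3
  rw [top]
  linarith

/-- Strong monotonicity of the flux, with a quadratic error for a change of coefficients. -/
theorem strong_mono_flux (hlo : 0 < lo) (hc : Admissible lo up c) (hc' : Admissible lo up c')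
    {δ : ℝ} (hδ : ∀ i, |c i - c' i| ≤ δ) (ξ η : E) :
    lo / 4 * (1 / 2) ^ e.top * ‖ξ - η‖ ^ (e.top + 2)
        - ((N + 1) / lo) ^ 2 * δ ^ 2 * inner ℝ (e.flux c' η) η ≤
      inner ℝ (e.flux c ξ - e.flux c' η) (ξ - η) := by
  have h1 := e.strong_mono_flux_same hc ξ η
  have h2 := e.norm_flux_sub_coeff_le hδ η
  have h3 := e.lo_mul_le_inner_flux_self hc' η
  have h4 := abs_le.1 (abs_real_inner_le_norm (e.flux c η - e.flux c' η) (ξ - η))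
  have h5 : inner ℝ (e.flux c ξ - e.flux c' η) (ξ - η) =
      inner ℝ (e.flux c ξ - e.flux c η) (ξ - η) + inner ℝ (e.flux c η - e.flux c' η) (ξ - η) := by
    rw [← inner_add_left, sub_add_sub_cancel]
  have h6 := norm_sub_half_rpow_le e.top_pos.le ξ η
  rw [div_eq_mul_one_div, Real.mul_rpow (norm_nonneg _) (by norm_num)] at h6
  have h7 : ‖ξ - η‖ ^ (e.top + 2) = ‖ξ - η‖ ^ e.top * ‖ξ - η‖ ^ 2 := by
    rw [Real.rpow_add_of_nonneg (norm_nonneg _) e.top_pos.le (by norm_num)]; norm_num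
  rw [h5, h7]
  set X := ‖ξ‖ ^ e.top
  set Y := ‖η‖ ^ e.top
  have hX : 0 ≤ X := Real.rpow_nonneg (norm_nonneg _) _
  have hY : 0 ≤ Y := Real.rpow_nonneg (norm_nonneg _) _
  set z := ‖ξ - η‖
  set y := ‖η‖
  set I := inner ℝ (e.flux c' η) η
  have hz : 0 ≤ z := norm_nonneg _
  have hy : 0 ≤ y := norm_nonneg _
  have a1 : ‖e.flux c η - e.flux c' η‖ * z ≤ δ * (N + 1) * ((1 + Y) * y) * z := by gcongr
  -- Young's inequality with weight `1 + Y`, as a completed square. The part in `z ^ 2` is absorbed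
  -- by strong monotonicity; the other part is quadratic in `δ`, and coercivity bounds it by `inner
  -- (flux c' η) η` in `a3`.
  have a2 : δ * (N + 1) * ((1 + Y) * y) * z ≤
      lo / 4 * (1 + Y) * z ^ 2 + (N + 1) ^ 2 / lo * δ ^ 2 * ((1 + Y) * y ^ 2) := by
    have : 0 ≤ (1 + Y) * (lo * (z / 2 - (N + 1) * δ / lo * y) ^ 2) := by positivity
    have e1 : (1 + Y) * (lo * (z / 2 - (N + 1) * δ / lo * y) ^ 2) =
        lo / 4 * (1 + Y) * z ^ 2 + (N + 1) ^ 2 / lo * δ ^ 2 * ((1 + Y) * y ^ 2)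
          - δ * (N + 1) * ((1 + Y) * y) * z := by
      field_simp
      ring
    linarith
  have a3 : (N + 1) ^ 2 / lo * δ ^ 2 * ((1 + Y) * y ^ 2) ≤ ((N + 1) / lo) ^ 2 * δ ^ 2 * I := by
    have : (1 + Y) * y ^ 2 ≤ I / lo := by rw [le_div_iff₀ hlo]; linarith
    calc _ ≤ (N + 1) ^ 2 / lo * δ ^ 2 * (I / lo) := by gcongr
      _ = _ := by field_simp
  have a4 : lo / 4 * (z ^ e.top * (1 / 2) ^ e.top) * z ^ 2 ≤ lo / 4 * (X + Y) * z ^ 2 := by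
    gcongr
  have a5 : 0 ≤ lo * z ^ 2 * (3 / 4 + X / 4) := by positivity
  nlinarith

theorem potential_add_inner_le (hc : Admissible lo up c) (ξ η : E) :
    e.potential c ξ + inner ℝ (e.flux c ξ) (η - ξ) ≤ e.potential c η := by
  rw [flux_eq_sum, sum_inner, potential, potential, ← Finset.sum_add_distrib]
  refine Finset.sum_le_sum fun i _ => ?_
  rw [real_inner_smul_left, ← mul_add]
  exact mul_le_mul_of_nonneg_left (rpow_norm_add_inner_le (e.α_nonneg i) ξ η) (hc.nonneg i)

theorem potential_nonneg {V : Type*} [NormedAddCommGroup V] (hc : Admissible lo up c) (ξ : V) :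
    0 ≤ e.potential c ξ :=
  Finset.sum_nonneg fun i _ => by
    have := e.α_nonneg i
    have := hc.nonneg i
    positivity

theorem potential_le_inner_flux (hc : Admissible lo up c) (ξ : E) :
    e.potential c ξ ≤ inner ℝ (e.flux c ξ) ξ := by
  have h := e.potential_add_inner_le hc ξ 0
  have h0 : e.potential c (0 : E) = 0 := by
    refine Finset.sum_eq_zero fun i _ => ?_
    rw [norm_zero, Real.zero_rpow (by linarith [e.α_nonneg i])]
    simp
  rw [h0, zero_sub, inner_neg_right] at h
  linarith

/-- Clarkson's inequality term by term; of the gains, the one with the largest exponent is kept and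
yields uniform convexity in `L^s`. -/
theorem potential_midpoint_le (hlo : 0 < lo) (hc : Admissible lo up c) (ξ η : E) :
    e.potential c ((1 / 2 : ℝ) • (ξ + η))
        + lo / (e.top + 2) * ‖(1 / 2 : ℝ) • (ξ - η)‖ ^ (e.top + 2) ≤
      (e.potential c ξ + e.potential c η) / 2 := by
  have h1 := fun i => clarkson_norm_rpow (p := e.α i + 2) (by linarith [e.α_nonneg i]) ξ η
  have h2 := e.lo_mul_add_le_sum hc
    (x := fun i => ‖(1 / 2 : ℝ) • (ξ - η)‖ ^ (e.α i + 2) / (e.α i + 2)) fun i => by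
      have := e.α_nonneg i
      positivity
  have h3 : e.potential c ((1 / 2 : ℝ) • (ξ + η))
      + ∑ i, c i * (‖(1 / 2 : ℝ) • (ξ - η)‖ ^ (e.α i + 2) / (e.α i + 2)) ≤
      (e.potential c ξ + e.potential c η) / 2 := by
    rw [potential, potential, potential, ← Finset.sum_add_distrib, ← Finset.sum_add_distrib,
      Finset.sum_div]
    refine Finset.sum_le_sum fun i _ => ?_
    have hα := e.α_nonneg i
    rw [← mul_add, ← mul_add, mul_div_assoc, ← add_div, ← add_div, div_right_comm]
    refine mul_le_mul_of_nonneg_left ?_ (hc.nonneg i)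
    gcongr
    exact h1 i
  have h4 : 0 ≤ lo * (‖(1 / 2 : ℝ) • (ξ - η)‖ ^ (e.α 0 + 2) / (e.α 0 + 2)) := by
    have := e.α_nonneg 0
    positivity
  have h5 : lo / (e.top + 2) * ‖(1 / 2 : ℝ) • (ξ - η)‖ ^ (e.top + 2) =
      lo * (‖(1 / 2 : ℝ) • (ξ - η)‖ ^ (e.α (Fin.last N) + 2) / (e.α (Fin.last N) + 2)) := by
    rw [top]; ring
  linarith

end ForchheimerExponents

/-! ### Duality of Lebesgue spaces over a finite measure. -/

section Duality

variable {X E : Type*} [MeasurableSpace X] {μ : Measure X} [NormedAddCommGroup E]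
  [InnerProductSpace ℝ E]

/-- The inclusion of `L^q` into `L^p` for `p ≤ q` over a finite measure. -/
noncomputable def Lp.inclusionOfLE [IsFiniteMeasure μ] (p q : ℝ≥0∞) [Fact (1 ≤ p)] [Fact (1 ≤ q)]
    (hpq : p ≤ q) : Lp E q μ →L[ℝ] Lp E p μ :=
  LinearMap.mkContinuous
    { toFun := fun u => ((Lp.memLp u).mono_exponent hpq).toLp u
      map_add' := fun u v => by
        rw [← MemLp.toLp_add, MemLp.toLp_eq_toLp_iff]
        exact Lp.coeFn_add u v
      map_smul' := fun c u => by
        rw [RingHom.id_apply, ← MemLp.toLp_const_smul, MemLp.toLp_eq_toLp_iff]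
        exact Lp.coeFn_smul c u }
    (μ univ ^ (1 / p.toReal - 1 / q.toReal)).toReal fun u => by
      have hp : 1 ≤ p := Fact.out
      have hexp : 0 ≤ 1 / p.toReal - 1 / q.toReal := by
        rcases eq_or_ne q ∞ with rfl | hq
        · simp
        · have hp0 : 0 < p.toReal :=
            ENNReal.toReal_pos (by positivity) (ne_top_of_le_ne_top hq hpq)
          have := one_div_le_one_div_of_le hp0 (ENNReal.toReal_mono hq hpq)
          linarith
      change ‖((Lp.memLp u).mono_exponent hpq).toLp u‖ ≤ _
      rw [Lp.norm_toLp, Lp.norm_def, mul_comm, ← ENNReal.toReal_mul]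
      exact ENNReal.toReal_mono (ENNReal.mul_ne_top (Lp.eLpNorm_ne_top u)
        (ENNReal.rpow_ne_top_of_nonneg hexp (measure_ne_top _ _)))
        (eLpNorm_le_eLpNorm_mul_rpow_measure_univ hpq (Lp.aestronglyMeasurable u))

theorem Lp.coeFn_inclusionOfLE [IsFiniteMeasure μ] {p q : ℝ≥0∞} [Fact (1 ≤ p)] [Fact (1 ≤ q)]
    (hpq : p ≤ q) (u : Lp E q μ) : Lp.inclusionOfLE p q hpq u =ᵐ[μ] u :=
  MemLp.coeFn_toLp ((Lp.memLp u).mono_exponent hpq)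

/-- The pairing of `L^p` and `L^q` given by the integral of the inner product. -/
noncomputable def innerPairing (μ : Measure X) (E : Type*) [NormedAddCommGroup E]
    [InnerProductSpace ℝ E] (p q : ℝ≥0∞) [Fact (1 ≤ p)] [Fact (1 ≤ q)]
    [ENNReal.HolderConjugate p q] : Lp E p μ →L[ℝ] Lp E q μ →L[ℝ] ℝ :=
  (innerSL ℝ).lpPairing μ p q

theorem innerPairing_eq {p q : ℝ≥0∞} [Fact (1 ≤ p)] [Fact (1 ≤ q)]
    [ENNReal.HolderConjugate p q] (u : Lp E p μ) (v : Lp E q μ) :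
    innerPairing μ E p q u v = ∫ x, inner ℝ (u x) (v x) ∂μ := by
  rw [innerPairing, ContinuousLinearMap.lpPairing_eq_integral]
  rfl

theorem Lp.integrable_inner' {p q : ℝ≥0∞} [ENNReal.HolderConjugate p q] (u : Lp E p μ)
    (v : Lp E q μ) : Integrable (fun x => inner ℝ (u x) (v x)) μ :=
  memLp_one_iff_integrable.1 ((innerSL ℝ).memLp_of_bilin 1 (Lp.memLp u) (Lp.memLp v))

/-- The dual element `‖w‖ ^ (q - 2) • w` has `L^p` norm `‖w‖_q ^ (q - 1)`, so the hypothesis reads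
`‖w‖_q ^ q ≤ C * ‖w‖_q ^ (q - 1)`. Dividing requires `‖w‖_q` to be finite beforehand. -/
theorem eLpNorm_le_of_dual_bound {p q : ℝ≥0∞} [Fact (1 ≤ p)] [hq1 : Fact (1 ≤ q)]
    [ENNReal.HolderConjugate p q] (hp_top : p ≠ ∞) (hq : q ≠ ∞) {w : X → E}
    (hw : MemLp w q μ) {C : ℝ} (hC0 : 0 ≤ C)
    (hC : ∫ x, ‖w x‖ ^ q.toReal ∂μ ≤
      C * (eLpNorm (fun x => ‖w x‖ ^ (q.toReal - 2) • w x) p μ).toReal) :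
    eLpNorm w q μ ≤ ENNReal.ofReal C := by
  have hconj := ENNReal.HolderConjugate.toReal_of_ne_top (p := p) (q := q) hp_top hq
  have hq0 : q ≠ 0 := (zero_lt_one.trans_le hq1.out).ne'
  set r := q.toReal with hr
  have hr1 : 1 < r := hconj.symm.lt
  have e1 : eLpNorm (fun x => ‖w x‖ ^ (r - 2) • w x) p μ = eLpNorm w q μ ^ (r - 1) := by
    have h1 : eLpNorm (fun x => ‖w x‖ ^ (r - 2) • w x) p μ =
        eLpNorm (fun x => ‖w x‖ ^ (r - 1)) p μ := by
      refine eLpNorm_congr_norm_ae (ae_of_all _ fun x => ?_)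
      rw [norm_smul, Real.norm_of_nonneg (Real.rpow_nonneg (norm_nonneg _) _),
        Real.norm_of_nonneg (Real.rpow_nonneg (norm_nonneg _) _)]
      by_cases h0 : ‖w x‖ = 0
      · rw [h0, mul_zero, Real.zero_rpow (by linarith)]
      · rw [← Real.rpow_add_one h0]
        congr 1; ring
    rw [h1, eLpNorm_norm_rpow _ (by linarith)]
    congr 2
    rw [← ENNReal.ofReal_toReal hp_top, ← ENNReal.ofReal_mul ENNReal.toReal_nonneg,
      mul_comm, hconj.symm.sub_one_mul_conj, hr, ENNReal.ofReal_toReal hq]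
  have e2 : ∫ x, ‖w x‖ ^ r ∂μ = (eLpNorm w q μ).toReal ^ r := by
    rw [hw.eLpNorm_eq_integral_rpow_norm hq0 hq, ENNReal.toReal_ofReal (by positivity), ← hr,
      ← Real.rpow_mul (by positivity), inv_mul_cancel₀ (by linarith), Real.rpow_one]
  rw [e1, e2, ← ENNReal.toReal_rpow] at hC
  set J := (eLpNorm w q μ).toReal with hJ
  rw [ENNReal.le_ofReal_iff_toReal_le hw.2.ne hC0, ← hJ]
  by_cases h0 : J = 0
  · rwa [h0]
  · have hJp : 0 < J := lt_of_le_of_ne ENNReal.toReal_nonneg (Ne.symm h0)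
    have e3 : J ^ r = J * J ^ (r - 1) := by
      rw [mul_comm, ← Real.rpow_add_one h0]; congr 1; ring
    rw [e3] at hC
    exact le_of_mul_le_mul_right hC (Real.rpow_pos_of_pos hJp _)

/-- Bounded functionals on `L^p`, `1 < p ≤ 2`, over a finite measure are represented by `L^q`. -/
theorem Lp.exists_innerPairing_eq [CompleteSpace E] [IsFiniteMeasure μ] {p q : ℝ≥0∞}
    [Fact (1 ≤ p)] [Fact (1 ≤ q)] [ENNReal.HolderConjugate p q] (hp2 : p ≤ 2) (hq : q ≠ ∞)
    (ℓ : Lp E p μ →L[ℝ] ℝ) : ∃ v : Lp E q μ, ∀ u, ℓ u = innerPairing μ E q p v u := by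
  have hp_top : p ≠ ∞ := ne_top_of_le_ne_top (by simp) hp2
  have hconj := ENNReal.HolderConjugate.toReal_of_ne_top (p := p) (q := q) hp_top hq
  have hr1 : 1 < q.toReal := hconj.symm.lt
  have hz : (0 : ℝ) ^ q.toReal = 0 := Real.zero_rpow (by linarith)
  -- Since `L²` embeds in `L^p`, Riesz represents the restriction of `ℓ` by some `v₂` in `L²`. It
  -- remains to show `v₂ ∈ L^q`.
  set v₂ := (InnerProductSpace.toDual ℝ (Lp E 2 μ)).symm (ℓ ∘L Lp.inclusionOfLE p 2 hp2) with hv₂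
  have hrep : ∀ u : Lp E 2 μ, ℓ (Lp.inclusionOfLE p 2 hp2 u) = ∫ x, inner ℝ (v₂ x) (u x) ∂μ := by
    intro u
    rw [← L2.inner_def, hv₂, InnerProductSpace.toDual_symm_apply]
    rfl
  -- Truncation to the sets where `‖v₂‖ ≤ n` makes the dual test element bounded, hence admissible.
  -- The resulting bound `‖ℓ‖` is uniform in `n` and passes to `v₂` by Fatou's lemma.
  set S : ℕ → Set X := fun n => {x | ‖v₂ x‖ ≤ n} with hS
  have hSm : ∀ n, MeasurableSet (S n) := fun n =>
    (Lp.stronglyMeasurable v₂).norm.measurable measurableSet_Iic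
  set w : ℕ → X → E := fun n => (S n).indicator v₂ with hw
  have hwm : ∀ n, StronglyMeasurable (w n) := fun n => (Lp.stronglyMeasurable v₂).indicator (hSm n)
  have hwb : ∀ n x, ‖w n x‖ ≤ n := by
    intro n x
    by_cases hx : x ∈ S n
    · rw [hw]; simp only [indicator_of_mem hx]; exact hx
    · rw [hw]; simp only [indicator_of_notMem hx, norm_zero]; positivity
  have hwL : ∀ n (P : ℝ≥0∞), MemLp (w n) P μ := fun n P =>
    MemLp.of_bound (hwm n).aestronglyMeasurable n (ae_of_all _ (hwb n))
  have hzb : ∀ n (P : ℝ≥0∞), MemLp (fun x => ‖w n x‖ ^ (q.toReal - 2) • w n x) P μ := by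
    intro n P
    refine MemLp.of_bound (C := (n : ℝ) ^ (q.toReal - 1)) ?_ (ae_of_all _ fun x => ?_)
    · exact (((hwm n).norm.measurable.pow_const _).stronglyMeasurable.smul
        (hwm n)).aestronglyMeasurable
    · rw [norm_smul, Real.norm_of_nonneg (Real.rpow_nonneg (norm_nonneg _) _)]
      by_cases h0 : ‖w n x‖ = 0
      · rw [h0, mul_zero]; positivity
      · rw [← Real.rpow_add_one h0, show q.toReal - 2 + 1 = q.toReal - 1 by ring]
        exact Real.rpow_le_rpow (norm_nonneg _) (hwb n x) (by linarith)
  have hbound : ∀ n, eLpNorm (w n) q μ ≤ ENNReal.ofReal ‖ℓ‖ := by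
    intro n
    refine eLpNorm_le_of_dual_bound (p := p) hp_top hq (hwL n q) (norm_nonneg ℓ) ?_
    have h1 := hrep ((hzb n 2).toLp _)
    have h2 : ∫ x, inner ℝ (v₂ x) ((hzb n 2).toLp _ x) ∂μ = ∫ x, ‖w n x‖ ^ q.toReal ∂μ := by
      refine integral_congr_ae ?_
      filter_upwards [(hzb n 2).coeFn_toLp] with x hx
      rw [hx]
      by_cases hxS : x ∈ S n
      · have : w n x = v₂ x := indicator_of_mem hxS _
        rw [this, real_inner_smul_right, real_inner_self_eq_norm_sq]
        by_cases h0 : ‖v₂ x‖ = 0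
        · rw [h0, hz]; simp
        · rw [← Real.rpow_natCast, ← Real.rpow_add (lt_of_le_of_ne (norm_nonneg _) (Ne.symm h0))]
          congr 1; push_cast; ring
      · have : w n x = 0 := indicator_of_notMem hxS _
        rw [this, norm_zero, hz]; simp
    rw [← h2, ← h1]
    refine (le_abs_self _).trans ((ℓ.le_opNorm _).trans (le_of_eq ?_))
    congr 1
    rw [Lp.norm_def]
    congr 1
    refine eLpNorm_congr_ae ((Lp.coeFn_inclusionOfLE hp2 _).trans (hzb n 2).coeFn_toLp)
  have hv : MemLp v₂ q μ := by
    refine ⟨Lp.aestronglyMeasurable v₂, ?_⟩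
    refine lt_of_le_of_lt (Lp.eLpNorm_lim_le_liminf_eLpNorm
      (fun n => (hwm n).aestronglyMeasurable) v₂ (ae_of_all _ fun x => ?_))
      (lt_of_le_of_lt ?_ (ENNReal.ofReal_lt_top (r := ‖ℓ‖)))
    · obtain ⟨n, hn⟩ := exists_nat_ge ‖v₂ x‖
      refine tendsto_const_nhds.congr' ?_
      filter_upwards [eventually_ge_atTop n] with k hk
      exact (indicator_of_mem (s := S k) (show ‖v₂ x‖ ≤ k from hn.trans (by exact_mod_cast hk))
        _).symm
    · exact liminf_le_of_le (by isBoundedDefault) fun b hb =>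
        (hb.exists.choose_spec).trans (hbound _)
  refine ⟨hv.toLp v₂, fun u => ?_⟩
  induction u using Lp.induction hp_top with
  | indicatorConst c hs hμs =>
    rw [innerPairing_eq]
    set i2 : Lp E 2 μ := indicatorConstLp 2 hs hμs.ne c
    have h1 := hrep i2
    have h2 : Lp.inclusionOfLE p 2 hp2 i2 =
        (Lp.simpleFunc.indicatorConst p hs hμs.ne c : Lp E p μ) := by
      rw [Lp.simpleFunc.coe_indicatorConst]
      refine Lp.ext ?_
      exact (Lp.coeFn_inclusionOfLE hp2 _).trans
        (indicatorConstLp_coeFn.trans indicatorConstLp_coeFn.symm)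
    rw [← h2, h1]
    refine integral_congr_ae ?_
    filter_upwards [hv.coeFn_toLp, Lp.coeFn_inclusionOfLE hp2 i2] with x hx hx'
    rw [hx, hx']
  | add hf hg _ h1 h2 => rw [map_add, map_add, h1, h2]
  | isClosed => exact isClosed_eq ℓ.continuous (ContinuousLinearMap.continuous _)

end Duality

/-! ### Weak limits in a Hilbert space. -/

section WeakLimits

variable {H : Type*} [NormedAddCommGroup H] [InnerProductSpace ℝ H]

/-- A subspace with trivial orthogonal complement is dense, so boundedness spreads the Cauchy
property to all `h`. The limits form a bounded functional, represented by Riesz. In the application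
`D` consists of the classes of test functions. -/
theorem exists_weak_limit_of_dense [CompleteSpace H] {a : ℕ → H} {M : ℝ} (ha : ∀ k, ‖a k‖ ≤ M)
    (D : Submodule ℝ H) (hD : Dᗮ = ⊥)
    (hc : ∀ h ∈ D, CauchySeq fun k => (inner ℝ (a k) h : ℝ)) :
    ∃ a₀ : H, ∀ h, Tendsto (fun k => inner ℝ (a k) h) atTop (𝓝 (inner ℝ a₀ h)) := by
  have hM0 : 0 ≤ M := (norm_nonneg _).trans (ha 0)
  have hall : ∀ h, CauchySeq fun k => (inner ℝ (a k) h : ℝ) := by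
    intro h
    have hcl : h ∈ closure (D : Set H) := by
      have := (Submodule.topologicalClosure_eq_top_iff (K := D)).2 hD
      rw [← Submodule.topologicalClosure_coe, this]
      trivial
    rw [Metric.cauchySeq_iff]
    intro ε hε
    obtain ⟨d, hd, hdist⟩ := Metric.mem_closure_iff.1 hcl (ε / (4 * (M + 1))) (by positivity)
    obtain ⟨n, hn⟩ := Metric.cauchySeq_iff.1 (hc d hd) (ε / 2) (by positivity)
    refine ⟨n, fun i hi j hj => ?_⟩
    have h1 := hn i hi j hj
    rw [Real.dist_eq, ← inner_sub_left] at h1 ⊢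
    have h2 : inner ℝ (a i - a j) h = inner ℝ (a i - a j) d + inner ℝ (a i - a j) (h - d) := by
      rw [← inner_add_right]; congr 1; abel
    have h3 : |inner ℝ (a i - a j) (h - d)| ≤ (2 * M) * (ε / (4 * (M + 1))) := by
      refine (abs_real_inner_le_norm _ _).trans ?_
      rw [dist_eq_norm] at hdist
      gcongr
      exact (norm_sub_le _ _).trans (by linarith [ha i, ha j])
    have h4 : (2 * M) * (ε / (4 * (M + 1))) < ε / 2 := by
      have e1 : (2 * M) * (ε / (4 * (M + 1))) = ε / 2 * (M / (M + 1)) := by field_simp; ring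
      rw [e1]
      have : M / (M + 1) < 1 := by rw [div_lt_one (by linarith)]; linarith
      nlinarith
    rw [h2]
    exact (abs_add_le _ _).trans_lt (by linarith)
  choose l hl using fun h => cauchySeq_tendsto_of_complete (hall h)
  let ℓ : H →L[ℝ] ℝ := LinearMap.mkContinuous
    { toFun := l
      map_add' := fun x y => tendsto_nhds_unique (hl (x + y))
        (((hl x).add (hl y)).congr fun k => (inner_add_right _ _ _).symm)
      map_smul' := fun c x => tendsto_nhds_unique (hl (c • x))
        (((hl x).const_mul c).congr fun k => (real_inner_smul_right _ _ _).symm) } M fun x =>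
      le_of_tendsto' (hl x).norm fun k => (norm_inner_le_norm _ _).trans (by gcongr; exact ha k)
  refine ⟨(InnerProductSpace.toDual ℝ H).symm ℓ, fun h => ?_⟩
  rw [InnerProductSpace.toDual_symm_apply]
  exact hl h

end WeakLimits

/-! ### Test pairs `(ψ, ∇ψ)` and the space `W(div; Ω)`. -/

section TestPairs

variable {d : ℕ} {Ω : Opens (Euc d)}

theorem memLp_testFunction (ψ : 𝓓(Ω, ℝ)) (p : ℝ≥0∞) : MemLp ψ p (volOn Ω) :=
  ψ.continuous.memLp_of_hasCompactSupport ψ.hasCompactSupport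

theorem memLp_gradient_testFunction (ψ : 𝓓(Ω, ℝ)) (p : ℝ≥0∞) :
    MemLp (∇ (ψ : Euc d → ℝ)) p (volOn Ω) :=
  (testFunction_continuous_gradient ψ).memLp_of_hasCompactSupport
    (testFunction_hasCompactSupport_gradient ψ)

variable (Ω) in
/-- The map that sends a test function to the pair of its class in `L²` and the class of its
gradient in `L^p`. -/
noncomputable def testPair (p : ℝ≥0∞) :
    𝓓(Ω, ℝ) →ₗ[ℝ] Lp ℝ 2 (volOn Ω) × Lp (Euc d) p (volOn Ω) where
  toFun ψ := ((memLp_testFunction ψ 2).toLp ψ, (memLp_gradient_testFunction ψ p).toLp (∇ ψ))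
  map_add' ψ η := by
    refine Prod.ext ?_ ?_
    · exact MemLp.toLp_add (memLp_testFunction ψ 2) (memLp_testFunction η 2)
    · change _ = (memLp_gradient_testFunction ψ p).toLp _ + (memLp_gradient_testFunction η p).toLp _
      rw [← MemLp.toLp_add, MemLp.toLp_eq_toLp_iff]
      exact ae_of_all _ fun x => gradient_testFunction_add ψ η x
  map_smul' c ψ := by
    refine Prod.ext ?_ ?_
    · exact MemLp.toLp_const_smul c (memLp_testFunction ψ 2)
    · change _ = c • (memLp_gradient_testFunction ψ p).toLp _
      rw [← MemLp.toLp_const_smul, MemLp.toLp_eq_toLp_iff]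
      exact ae_of_all _ fun x => gradient_testFunction_smul c ψ x

theorem coeFn_testPair_fst (p : ℝ≥0∞) (ψ : 𝓓(Ω, ℝ)) : (testPair Ω p ψ).1 =ᵐ[volOn Ω] ψ :=
  (memLp_testFunction ψ 2).coeFn_toLp

theorem coeFn_testPair_snd (p : ℝ≥0∞) (ψ : 𝓓(Ω, ℝ)) :
    (testPair Ω p ψ).2 =ᵐ[volOn Ω] ∇ (ψ : Euc d → ℝ) :=
  (memLp_gradient_testFunction ψ p).coeFn_toLp

theorem orthogonal_range_testPair_fst (p : ℝ≥0∞) :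
    ((LinearMap.fst ℝ _ _ ∘ₗ testPair Ω p).range)ᗮ = ⊥ := by
  rw [Submodule.eq_bot_iff]
  intro g hg
  have hloc : LocallyIntegrableOn g (Ω : Set (Euc d)) volume := by
    exact locallyIntegrableOn_of_locallyIntegrable_restrict
      ((Lp.memLp g).locallyIntegrable one_le_two)
  have h0 := Ω.isOpen.ae_eq_zero_of_integral_contDiff_smul_eq_zero hloc fun η h1 h2 h3 => ?_
  · have h5 : g =ᵐ[volOn Ω] 0 := (ae_restrict_iff' Ω.isOpen.measurableSet).2 h0
    exact Lp.ext (h5.trans (Lp.coeFn_zero _ _ _).symm)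
  · let ψ : 𝓓(Ω, ℝ) := ⟨η, by exact_mod_cast h1, h2, h3⟩
    have h4 := (Submodule.mem_orthogonal _ g).1 hg (testPair Ω p ψ).1 ⟨ψ, rfl⟩
    rw [L2.inner_def] at h4
    rw [← setIntegral_eq_integral_of_forall_compl_eq_zero (s := (Ω : Set (Euc d))), ← h4]
    · refine integral_congr_ae ?_
      filter_upwards [coeFn_testPair_fst p ψ] with x hx
      rw [hx]
      change η x • g x = inner ℝ (η x) (g x)
      simp [mul_comm]
    · intro x hx
      have : η x = 0 := by
        by_contra hne
        exact hx (h3 (subset_tsupport _ hne))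
      rw [this, zero_smul]

/-- This writes membership through continuous functionals of `w`, one for each test pair; closedness
and stability under limits follow. -/
theorem mem_Wdiv_iff {p q : ℝ≥0∞} [Fact (1 ≤ p)] [Fact (1 ≤ q)] [ENNReal.HolderConjugate p q]
    {w : Lp (Euc d) q (volOn Ω) × Lp ℝ 2 (volOn Ω)} :
    w ∈ Wdiv Ω q ↔ ∀ ψ, inner ℝ w.2 (testPair Ω p ψ).1 =
      - innerPairing (volOn Ω) (Euc d) q p w.1 (testPair Ω p ψ).2 := by
  refine forall_congr' fun ψ => ?_
  rw [L2.inner_def, innerPairing_eq]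
  have h1 : ∫ x in Ω, inner ℝ (w.2 x) ((testPair Ω p ψ).1 x) = ∫ x in Ω, ψ x * w.2 x := by
    refine integral_congr_ae ?_
    filter_upwards [coeFn_testPair_fst p ψ] with x hx
    rw [hx]
    simp
  have h2 : ∫ x in Ω, inner ℝ (w.1 x) ((testPair Ω p ψ).2 x) =
      ∫ x in Ω, inner ℝ (w.1 x) (∇ ψ x) := by
    refine integral_congr_ae ?_
    filter_upwards [coeFn_testPair_snd p ψ] with x hx
    rw [hx]
  rw [h1, h2]

theorem isClosed_Wdiv (p : ℝ≥0∞) {q : ℝ≥0∞} [Fact (1 ≤ p)] [Fact (1 ≤ q)]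
    [ENNReal.HolderConjugate p q] :
    IsClosed (Wdiv Ω q : Set (Lp (Euc d) q (volOn Ω) × Lp ℝ 2 (volOn Ω))) := by
  have : (Wdiv Ω q : Set (Lp (Euc d) q (volOn Ω) × Lp ℝ 2 (volOn Ω))) =
      ⋂ ψ, {w | inner ℝ w.2 (testPair Ω p ψ).1 =
        - innerPairing (volOn Ω) (Euc d) q p w.1 (testPair Ω p ψ).2} := by
    ext w
    rw [SetLike.mem_coe, mem_Wdiv_iff (p := p)]
    simp
  rw [this]
  refine isClosed_iInter fun ψ => isClosed_eq (continuous_snd.inner continuous_const) ?_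
  exact (((innerPairing (volOn Ω) (Euc d) q p).flip (testPair Ω p ψ).2).continuous.comp
    continuous_fst).neg

/-- Convergence of the fields fixes the limits of the divergences against test functions. These are
dense in `L²`, and the divergences are bounded. -/
theorem exists_weak_limit_div (p : ℝ≥0∞) {q : ℝ≥0∞} [Fact (1 ≤ p)] [Fact (1 ≤ q)]
    [ENNReal.HolderConjugate p q] {w : ℕ → Wdiv Ω q} {v : Lp (Euc d) q (volOn Ω)} {M : ℝ}
    (hv : Tendsto (fun k => (w k).1.1) atTop (𝓝 v)) (hM : ∀ k, ‖(w k).1.2‖ ≤ M) :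
    ∃ m : Wdiv Ω q, m.1.1 = v ∧
      ∀ h, Tendsto (fun k => inner ℝ (w k).1.2 h) atTop (𝓝 (inner ℝ m.1.2 h)) := by
  have hlim : ∀ ψ, Tendsto (fun k => inner ℝ (w k).1.2 (testPair Ω p ψ).1) atTop
      (𝓝 (- innerPairing (volOn Ω) (Euc d) q p v (testPair Ω p ψ).2)) := by
    intro ψ
    have := (((innerPairing (volOn Ω) (Euc d) q p).flip (testPair Ω p ψ).2).continuous.tendsto
      v).comp hv
    refine this.neg.congr fun k => ?_
    exact ((mem_Wdiv_iff (p := p)).1 (w k).2 ψ).symm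
  obtain ⟨a, ha⟩ := exists_weak_limit_of_dense hM _ (orthogonal_range_testPair_fst (Ω := Ω) p) (by
    rintro _ ⟨ψ, rfl⟩
    exact (hlim ψ).cauchySeq)
  refine ⟨⟨(v, a), (mem_Wdiv_iff (p := p)).2 fun ψ => ?_⟩, rfl, ha⟩
  exact tendsto_nhds_unique (ha _) (hlim ψ)

theorem Wdiv.ext_field (p : ℝ≥0∞) {q : ℝ≥0∞} [Fact (1 ≤ p)] [Fact (1 ≤ q)]
    [ENNReal.HolderConjugate p q]
    {m n : Wdiv Ω q} (h : m.1.1 = n.1.1) : m = n := by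
  have h2 : m.1.2 - n.1.2 ∈ ((LinearMap.fst ℝ _ _ ∘ₗ testPair Ω p).range)ᗮ := by
    rw [Submodule.mem_orthogonal]
    rintro _ ⟨ψ, rfl⟩
    rw [real_inner_comm, inner_sub_left, sub_eq_zero]
    exact ((mem_Wdiv_iff (p := p)).1 m.2 ψ).trans (h ▸ ((mem_Wdiv_iff (p := p)).1 n.2 ψ).symm)
  rw [orthogonal_range_testPair_fst, Submodule.mem_bot, sub_eq_zero] at h2
  exact Subtype.ext (Prod.ext h h2)

end TestPairs

/-! ### Zero traces: annihilators of `W(div; Ω)` and integration by parts. -/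

section Traces

variable {d : ℕ} {Ω : Opens (Euc d)}

/-- `IsW0` asks for convergence of the functions in `L^p`; over a finite measure, with `p ≤ 2`, it
follows from convergence in `L²`. -/
theorem mem_L2W0_of_mem_closure [IsFiniteMeasure (volOn Ω)] {p : ℝ≥0∞} [Fact (1 ≤ p)] (hp2 : p ≤ 2)
    {r : Lp ℝ 2 (volOn Ω) × Lp (Euc d) p (volOn Ω)}
    (hr : r ∈ closure (Set.range (testPair Ω p))) : r ∈ L2W0 Ω p := by
  obtain ⟨x, hx, hlim⟩ := mem_closure_iff_seq_limit.1 hr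
  choose ψ hψ using hx
  obtain rfl : (fun n => testPair Ω p (ψ n)) = x := funext hψ
  rw [Prod.tendsto_iff] at hlim
  have h1 := ((Lp.inclusionOfLE p 2 hp2).continuous.tendsto _).comp hlim.1
  have h2 := hlim.2
  rw [Lp.tendsto_Lp_iff_tendsto_eLpNorm'] at h1 h2
  refine ⟨ψ, h1.congr fun n => eLpNorm_congr_ae ?_, h2.congr fun n => eLpNorm_congr_ae ?_⟩
  · filter_upwards [coeFn_testPair_fst p (ψ n), Lp.coeFn_inclusionOfLE hp2 (testPair Ω p (ψ n)).1,
      Lp.coeFn_inclusionOfLE hp2 r.1] with x hx1 hx2 hx3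
    simp only [Function.comp, Pi.sub_apply]
    rw [hx2, hx3, hx1]
  · filter_upwards [coeFn_testPair_snd p (ψ n)] with x hx1
    rw [Pi.sub_apply, hx1]

/-- A pair that annihilates `W(div; Ω)` belongs to `L²(Ω) ∩ W₀^{1,p}(Ω)`. -/
theorem mem_L2W0_of_forall_Wdiv [IsFiniteMeasure (volOn Ω)] {p q : ℝ≥0∞} [Fact (1 ≤ p)]
    [Fact (1 ≤ q)] [ENNReal.HolderConjugate p q] (hp2 : p ≤ 2) (hq : q ≠ ∞)
    {r : Lp ℝ 2 (volOn Ω) × Lp (Euc d) p (volOn Ω)}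
    (hr : ∀ w : Wdiv Ω q, inner ℝ w.1.2 r.1 +
      innerPairing (volOn Ω) (Euc d) q p w.1.1 r.2 = 0) : r ∈ L2W0 Ω p := by
  refine mem_L2W0_of_mem_closure hp2 ?_
  by_contra hnot
  have hcoe : Set.range (testPair Ω p) = ((testPair Ω p).range : Set _) := rfl
  rw [hcoe] at hnot
  obtain ⟨f, u, hfu, hur⟩ := geometric_hahn_banach_closed_point
    ((Submodule.convex _).closure) isClosed_closure hnot
  -- A functional bounded above on a subspace vanishes there: otherwise a multiple of `ψ` attains
  -- the bound `u`.
  have hf0 : ∀ ψ, f (testPair Ω p ψ) = 0 := by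
    intro ψ
    by_contra hne
    have h1 := hfu (testPair Ω p ((u / f (testPair Ω p ψ)) • ψ)) (subset_closure ⟨_, rfl⟩)
    rw [map_smul, map_smul, smul_eq_mul, div_mul_cancel₀ _ hne] at h1
    exact lt_irrefl _ h1
  have hu : 0 < u := by
    have := hfu (testPair Ω p 0) (subset_closure ⟨_, rfl⟩)
    rwa [hf0] at this
  obtain ⟨v, hv⟩ := Lp.exists_innerPairing_eq hp2 hq
    (f ∘L ContinuousLinearMap.inr ℝ (Lp ℝ 2 (volOn Ω)) (Lp (Euc d) p (volOn Ω)))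
  set g := (InnerProductSpace.toDual ℝ (Lp ℝ 2 (volOn Ω))).symm
    (f ∘L ContinuousLinearMap.inl ℝ (Lp ℝ 2 (volOn Ω)) (Lp (Euc d) p (volOn Ω)))
  have hg : ∀ x, f (x, 0) = inner ℝ g x := fun x => by
    rw [InnerProductSpace.toDual_symm_apply]; rfl
  have hfr : ∀ x y, f (x, y) = inner ℝ g x + innerPairing (volOn Ω) (Euc d) q p v y := by
    intro x y
    rw [← hv, ← hg, ContinuousLinearMap.comp_apply, ContinuousLinearMap.inr_apply, ← map_add]
    simp
  -- A separating functional that vanishes on test pairs is itself an element of `W(div; Ω)`, with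
  -- field `v` and divergence `g`. The hypothesis then makes it vanish at `r`, a contradiction.
  have hmem : ((v, g) : Lp (Euc d) q (volOn Ω) × Lp ℝ 2 (volOn Ω)) ∈ Wdiv Ω q := by
    refine (mem_Wdiv_iff (p := p)).2 fun ψ => ?_
    have := hf0 ψ
    rw [← Prod.mk.eta (p := testPair Ω p ψ), hfr] at this
    exact eq_neg_of_add_eq_zero_left this
  have h1 := hr ⟨(v, g), hmem⟩
  rw [← Prod.mk.eta (p := r), hfr, h1] at hur
  exact lt_asymm hu hur

/-- A test function stays one after composition with `k sin (· / k)`. -/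
noncomputable def sinTrunc (k : ℝ) (ψ : 𝓓(Ω, ℝ)) : 𝓓(Ω, ℝ) where
  toFun x := k * Real.sin (ψ x / k)
  contDiff' := contDiff_const.mul (Real.contDiff_sin.comp (ψ.contDiff.div_const k))
  hasCompactSupport' := ψ.hasCompactSupport.comp_left (g := fun y => k * Real.sin (y / k)) (by simp)
  tsupport_subset' := (tsupport_comp_subset (g := fun y => k * Real.sin (y / k)) (by simp) ψ).trans
    ψ.tsupport_subset

theorem gradient_sinTrunc {k : ℝ} (hk : k ≠ 0) (ψ : 𝓓(Ω, ℝ)) (x : Euc d) :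
    ∇ (sinTrunc k ψ) x = Real.cos (ψ x / k) • ∇ ψ x := by
  have h1 : HasGradientAt ψ (∇ ψ x) x :=
    ((ψ.contDiff.differentiable (by simp)) x).hasGradientAt
  have h2 : HasDerivAt (fun y => k * Real.sin (y / k)) (Real.cos (ψ x / k)) (ψ x) := by
    have := (((hasDerivAt_id (ψ x)).div_const k).sin).const_mul k
    have e1 : k * (Real.cos (id (ψ x) / k) * (1 / k)) = Real.cos (ψ x / k) := by
      simp only [id]
      field_simp
    rw [e1] at this
    exact this
  have h3 : HasGradientAt (sinTrunc k ψ) (Real.cos (ψ x / k) • ∇ ψ x) x := by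
    rw [hasGradientAt_iff_hasFDerivAt] at h1 ⊢
    rw [map_smul]
    exact h2.comp_hasFDerivAt x h1
  exact h3.gradient

theorem tendsto_mul_sin_div (y : ℝ) :
    Tendsto (fun n : ℕ => ((n : ℝ) + 1) * Real.sin (y / (n + 1))) atTop (𝓝 y) := by
  have h0 : Tendsto (fun n : ℕ => y / ((n : ℝ) + 1)) atTop (𝓝 0) :=
    tendsto_const_nhds.div_atTop (tendsto_natCast_atTop_atTop.atTop_add tendsto_const_nhds)
  have h1 := ((Real.continuous_sinc.tendsto 0).comp h0).const_mul y
  rw [Real.sinc_zero, mul_one] at h1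
  refine h1.congr fun n => ?_
  by_cases hy : y = 0
  · simp [hy]
  · have hn : (n : ℝ) + 1 ≠ 0 := by positivity
    rw [Function.comp, Real.sinc_of_ne_zero (div_ne_zero hy hn)]
    field_simp

/-- The test functions approximating `r` converge in `W^{1,p}` but need not converge in `L²`,
whereas `div w` is only in `L²`. After the bounded smooth truncation `k sin (· / k)`, dominated
convergence handles the divergence term. -/
theorem integral_sin_trunc_mul_div [IsFiniteMeasure (volOn Ω)] {p q : ℝ≥0∞} [Fact (1 ≤ p)]
    [Fact (1 ≤ q)] [ENNReal.HolderConjugate p q] (r : L2W0 Ω p) (w : Wdiv Ω q) {k : ℝ}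
    (hk : k ≠ 0) :
    ∫ x in Ω, k * Real.sin (r.1.1 x / k) * w.1.2 x =
      - ∫ x in Ω, Real.cos (r.1.1 x / k) * inner ℝ (w.1.1 x) (r.1.2 x) := by
  obtain ⟨ψ₀, hψ1, hψ2⟩ := r.2
  have hp0 : p ≠ 0 := (zero_lt_one.trans_le (Fact.out (p := 1 ≤ p))).ne'
  obtain ⟨ns, hns, hae⟩ := (tendstoInMeasure_of_tendsto_eLpNorm hp0
    (fun n => (ψ₀ n).continuous.aestronglyMeasurable) (Lp.aestronglyMeasurable r.1.1)
    hψ1).exists_seq_tendsto_ae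
  set ψ : ℕ → 𝓓(Ω, ℝ) := fun n => ψ₀ (ns n) with hψ
  have hgrad : Tendsto (fun n => (testPair Ω p (ψ n)).2 - r.1.2) atTop (𝓝 0) := by
    rw [← sub_self r.1.2]
    refine Tendsto.sub_const ?_ _
    rw [Lp.tendsto_Lp_iff_tendsto_eLpNorm']
    refine (hψ2.comp hns.tendsto_atTop).congr fun n => eLpNorm_congr_ae ?_
    filter_upwards [coeFn_testPair_snd p (ψ n)] with x hx
    rw [Pi.sub_apply, hx]
  have hL : Tendsto (fun n => ∫ x in Ω, sinTrunc k (ψ n) x * w.1.2 x) atTop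
      (𝓝 (∫ x in Ω, k * Real.sin (r.1.1 x / k) * w.1.2 x)) := by
    refine tendsto_integral_of_dominated_convergence (fun x => |k| * ‖w.1.2 x‖)
      (fun n => (sinTrunc k (ψ n)).continuous.aestronglyMeasurable.mul
        (Lp.aestronglyMeasurable _))
      (((Lp.memLp w.1.2).integrable one_le_two).norm.const_mul _) (fun n => ?_) ?_
    · refine ae_of_all _ fun x => ?_
      change ‖k * Real.sin (ψ n x / k) * w.1.2 x‖ ≤ _
      rw [norm_mul, norm_mul, Real.norm_eq_abs k]
      gcongr
      exact mul_le_of_le_one_right (abs_nonneg _) (Real.abs_sin_le_one _)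
    · filter_upwards [hae] with x hx
      exact ((((Real.continuous_sin.tendsto _).comp (hx.div_const k)).const_mul k).mul_const _)
  have hcos : ∀ n, AEStronglyMeasurable (fun x => Real.cos (ψ n x / k)) (volOn Ω) := fun n =>
    (Real.continuous_cos.comp ((ψ n).continuous.div_const k)).aestronglyMeasurable
  have hR1 : Tendsto (fun n => ∫ x in Ω, Real.cos (ψ n x / k) * inner ℝ (w.1.1 x) (r.1.2 x)) atTop
      (𝓝 (∫ x in Ω, Real.cos (r.1.1 x / k) * inner ℝ (w.1.1 x) (r.1.2 x))) := by
    have hi := Lp.integrable_inner' (p := q) (q := p) w.1.1 r.1.2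
    refine tendsto_integral_of_dominated_convergence
      (fun x => ‖(inner ℝ (w.1.1 x) (r.1.2 x) : ℝ)‖) (fun n => (hcos n).mul hi.1) hi.norm
      (fun n => ae_of_all _ fun x => ?_) ?_
    · rw [norm_mul]
      exact mul_le_of_le_one_left (norm_nonneg _) (Real.abs_cos_le_one _)
    · filter_upwards [hae] with x hx
      exact ((Real.continuous_cos.tendsto _).comp (hx.div_const k)).mul_const _
  -- The gradient of the truncated approximation is `cos (ψ n / k) • (∇ r + b n)`. The cosine is
  -- bounded by one, so the part with `b n` tends to zero in `L^p`.
  set b : ℕ → Lp (Euc d) p (volOn Ω) := fun n => (testPair Ω p (ψ n)).2 - r.1.2 with hb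
  have hzle : ∀ n, ∀ᵐ x ∂volOn Ω, ‖Real.cos (ψ n x / k) • b n x‖ ≤ ‖b n x‖ := fun n =>
    ae_of_all _ fun x => by
      rw [norm_smul]
      exact mul_le_of_le_one_left (norm_nonneg _) (Real.abs_cos_le_one _)
  have hzm : ∀ n, MemLp (fun x => Real.cos (ψ n x / k) • b n x) p (volOn Ω) := fun n =>
    (Lp.memLp (b n)).of_le ((hcos n).smul (Lp.aestronglyMeasurable _)) (hzle n)
  have hz : Tendsto (fun n => (hzm n).toLp _) atTop (𝓝 0) := by
    refine squeeze_zero_norm (a := fun n => ‖b n‖) (fun n => Lp.norm_le_norm_of_ae_le ?_)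
      (by simpa using hgrad.norm)
    filter_upwards [(hzm n).coeFn_toLp, hzle n] with x hx hx'
    rw [hx]; exact hx'
  have hR2 := ((innerPairing (volOn Ω) (Euc d) q p w.1.1).continuous.tendsto 0).comp hz
  rw [map_zero] at hR2
  have hR := (hR1.add hR2).neg
  rw [add_zero] at hR
  refine tendsto_nhds_unique hL (hR.congr fun n => ?_)
  rw [w.2 (sinTrunc k (ψ n)), Function.comp, innerPairing_eq, ← integral_add]
  · congr 1
    refine integral_congr_ae ?_
    filter_upwards [(hzm n).coeFn_toLp, coeFn_testPair_snd p (ψ n),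
      Lp.coeFn_sub (testPair Ω p (ψ n)).2 r.1.2] with x h1 h2 h3
    rw [h1, gradient_sinTrunc hk, hb]
    simp only
    rw [h3, Pi.sub_apply, h2, real_inner_smul_right, real_inner_smul_right, inner_sub_right]
    ring
  · exact (Lp.integrable_inner' (p := q) (q := p) w.1.1 r.1.2).bdd_mul (hcos n)
      (ae_of_all _ fun x => Real.abs_cos_le_one _)
  · exact Lp.integrable_inner' (p := q) (q := p) w.1.1 _

/-- Integration by parts between `L²(Ω) ∩ W₀^{1,p}(Ω)` and `W(div; Ω)`. -/
theorem inner_div_add_innerPairing_grad [IsFiniteMeasure (volOn Ω)] {p q : ℝ≥0∞} [Fact (1 ≤ p)]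
    [Fact (1 ≤ q)] [ENNReal.HolderConjugate p q] (r : L2W0 Ω p) (w : Wdiv Ω q) :
    inner ℝ w.1.2 r.1.1 + innerPairing (volOn Ω) (Euc d) q p w.1.1 r.1.2 = 0 := by
  rw [L2.inner_def, innerPairing_eq, add_eq_zero_iff_eq_neg]
  have hi1 : Integrable (fun x => inner ℝ (w.1.2 x) (r.1.1 x)) (volOn Ω) := L2.integrable_inner _ _
  have hi2 := Lp.integrable_inner' (p := q) (q := p) w.1.1 r.1.2
  -- Removal of the truncation: `k sin (y / k)` tends to `y` and is dominated by `|y|`, with `r` and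
  -- `div w` both in `L²`. On the gradient side the cosine tends to one.
  have hL : Tendsto (fun n : ℕ => ∫ x in Ω, ((n : ℝ) + 1) * Real.sin (r.1.1 x / (n + 1)) * w.1.2 x)
      atTop (𝓝 (∫ x in Ω, inner ℝ (w.1.2 x) (r.1.1 x))) := by
    refine tendsto_integral_of_dominated_convergence _ (fun n => ?_) hi1.norm
      (fun n => ae_of_all _ fun x => ?_) (ae_of_all _ fun x => ?_)
    · exact ((Real.continuous_sin.comp_aestronglyMeasurable
        ((Lp.aestronglyMeasurable r.1.1).mul_const ((n : ℝ) + 1)⁻¹)).const_mul _).mul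
        (Lp.aestronglyMeasurable _)
    · have hn : (0 : ℝ) < n + 1 := by positivity
      have h1 : |((n : ℝ) + 1) * Real.sin (r.1.1 x / (n + 1))| ≤ |r.1.1 x| := by
        rw [abs_mul, abs_of_pos hn]
        have := mul_le_mul_of_nonneg_left (Real.abs_sin_le_abs (x := r.1.1 x / (n + 1))) hn.le
        rwa [abs_div, abs_of_pos hn, mul_div_cancel₀ _ hn.ne'] at this
      rw [norm_mul]
      simp only [RCLike.inner_apply, conj_trivial, norm_mul]
      rw [← norm_mul]
      gcongr
      exact h1
    · have := (tendsto_mul_sin_div (r.1.1 x)).mul_const (w.1.2 x)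
      simpa using this
  have hR : Tendsto (fun n : ℕ => ∫ x in Ω, Real.cos (r.1.1 x / ((n : ℝ) + 1)) *
      inner ℝ (w.1.1 x) (r.1.2 x)) atTop (𝓝 (∫ x in Ω, inner ℝ (w.1.1 x) (r.1.2 x))) := by
    refine tendsto_integral_of_dominated_convergence _ (fun n => ?_) hi2.norm
      (fun n => ae_of_all _ fun x => ?_) (ae_of_all _ fun x => ?_)
    · exact (Real.continuous_cos.comp_aestronglyMeasurable
        ((Lp.aestronglyMeasurable r.1.1).mul_const ((n : ℝ) + 1)⁻¹)).mul hi2.1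
    · rw [norm_mul]
      exact mul_le_of_le_one_left (norm_nonneg _) (Real.abs_cos_le_one _)
    · have h0 : Tendsto (fun n : ℕ => r.1.1 x / ((n : ℝ) + 1)) atTop (𝓝 0) :=
        tendsto_const_nhds.div_atTop (tendsto_natCast_atTop_atTop.atTop_add tendsto_const_nhds)
      have := ((Real.continuous_cos.tendsto 0).comp h0).mul_const (inner ℝ (w.1.1 x) (r.1.2 x))
      rwa [Real.cos_zero, one_mul] at this
  refine tendsto_nhds_unique hL (hR.neg.congr fun n => ?_)
  exact (integral_sin_trunc_mul_div r w (by positivity)).symm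

end Traces

/-! ### The superposition operator from `L^s` to `L^{s*}` and its energy. -/

namespace ForchheimerExponents

section Exponents

variable {N : ℕ} (e : ForchheimerExponents N)

theorem s_eq : e.s = ENNReal.ofReal (e.top + 2) := rfl

theorem sStar_eq : e.sStar = ENNReal.ofReal ((e.top + 2) / (e.top + 1)) := rfl

theorem s_ne_top : e.s ≠ ∞ := ENNReal.ofReal_ne_top

theorem s_ne_zero : e.s ≠ 0 := (zero_lt_one.trans_le (Fact.out (p := 1 ≤ e.s))).ne'

theorem toReal_s : e.s.toReal = e.top + 2 :=
  ENNReal.toReal_ofReal (by linarith [e.α_last_nonneg])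

theorem sStar_le_two : e.sStar ≤ 2 := by
  have h := e.top_pos
  rw [sStar_eq, show (2 : ℝ≥0∞) = ENNReal.ofReal 2 by simp]
  refine ENNReal.ofReal_le_ofReal ?_
  rw [div_le_iff₀ (by linarith)]
  linarith

instance holderConjugate_sStar_s : ENNReal.HolderConjugate e.sStar e.s := by
  have h := e.top_pos
  refine Real.HolderConjugate.ennrealOfReal ?_
  rw [Real.holderConjugate_iff]
  change 1 < (e.top + 2) / (e.top + 1) ∧ ((e.top + 2) / (e.top + 1))⁻¹ + (e.top + 2)⁻¹ = 1
  constructor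
  · rw [one_lt_div (by linarith)]; linarith
  · field_simp
    ring

/-- The exponent `s / α_N` of the weight `|m| ^ α_N`. -/
noncomputable def sWeight : ℝ≥0∞ := ENNReal.ofReal ((e.top + 2) / e.top)

theorem one_le_sWeight : 1 ≤ e.sWeight := by
  have h := e.top_pos
  rw [sWeight, ENNReal.one_le_ofReal, one_le_div h]
  linarith

theorem sWeight_mul_top : e.sWeight * ENNReal.ofReal e.top = e.s := by
  have h := e.top_pos
  rw [sWeight, ← ENNReal.ofReal_mul (by positivity), div_mul_cancel₀ _ h.ne', s_eq]

instance holderTriple_sWeight : ENNReal.HolderTriple e.sWeight e.s e.sStar := by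
  have h := e.top_pos
  refine ⟨?_⟩
  rw [sWeight, s_eq, sStar_eq, ← ENNReal.ofReal_inv_of_pos (by positivity),
    ← ENNReal.ofReal_inv_of_pos (by positivity), ← ENNReal.ofReal_inv_of_pos (by positivity),
    ← ENNReal.ofReal_add (by positivity) (by positivity)]
  congr 1
  field_simp

end Exponents

section Nemytskii

variable {N : ℕ} (e : ForchheimerExponents N) {X E : Type*} [MeasurableSpace X] {μ : Measure X}
  [NormedAddCommGroup E] [InnerProductSpace ℝ E]

/-- Measurable coefficient fields within the bounds of the problem. -/
structure AdmissibleField (lo up : ℝ) (μ : Measure X) (A : Fin (N + 1) → X → ℝ) : Prop where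
  lo_pos : 0 < lo
  up_nonneg : 0 ≤ up
  aesm : ∀ i, AEStronglyMeasurable (A i) μ
  adm : ∀ᵐ x ∂μ, Admissible lo up (fun i => A i x)

variable {lo up : ℝ} {A B : Fin (N + 1) → X → ℝ}

theorem memLp_norm_rpow_top {V : Type*} [NormedAddCommGroup V] {m : X → V} (hm : MemLp m e.s μ) :
    MemLp (fun x => ‖m x‖ ^ e.top) e.sWeight μ := by
  refine ⟨(hm.1.norm.aemeasurable.pow_const _).aestronglyMeasurable, ?_⟩
  rw [eLpNorm_norm_rpow _ e.top_pos, sWeight_mul_top]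
  exact ENNReal.rpow_lt_top_of_nonneg e.top_pos.le hm.2.ne

variable (μ) in
/-- The norm of the constant function `1` in the space of weights. -/
noncomputable def weightOne : ℝ := (eLpNorm (fun _ : X => (1 : ℝ)) e.sWeight μ).toReal

/-- Hölder's inequality with `α_N / s + 1 / s = 1 / s*`. All flux estimates in `L^{s*}` reduce to
weights of this form. -/
theorem memLp_weight_smul [IsFiniteMeasure μ] {m n z : X → E} (hm : MemLp m e.s μ)
    (hn : MemLp n e.s μ) (hz : MemLp z e.s μ) :
    MemLp (fun x => (1 + ‖m x‖ ^ e.top + ‖n x‖ ^ e.top) • z x) e.sStar μ :=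
  hz.smul (r := e.sStar)
    (((memLp_const (1 : ℝ)).add (e.memLp_norm_rpow_top hm)).add (e.memLp_norm_rpow_top hn))

theorem eLpNorm_weight_smul_le [IsFiniteMeasure μ] {m n z : X → E} (hm : MemLp m e.s μ)
    (hn : MemLp n e.s μ) (hz : MemLp z e.s μ) :
    (eLpNorm (fun x => (1 + ‖m x‖ ^ e.top + ‖n x‖ ^ e.top) • z x) e.sStar μ).toReal ≤
      (e.weightOne μ + (eLpNorm m e.s μ).toReal ^ e.top + (eLpNorm n e.s μ).toReal ^ e.top) *
        (eLpNorm z e.s μ).toReal := by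
  have h1 : MemLp (fun _ : X => (1 : ℝ)) e.sWeight μ := memLp_const 1
  have hm' := e.memLp_norm_rpow_top hm
  have hn' := e.memLp_norm_rpow_top hn
  have hW := (h1.add hm').add hn'
  have hle := eLpNorm_smul_le_mul_eLpNorm (p := e.sWeight) (q := e.s) (r := e.sStar) hz.1 hW.1
  refine (ENNReal.toReal_mono (ENNReal.mul_ne_top hW.2.ne hz.2.ne) hle).trans ?_
  rw [ENNReal.toReal_mul]
  refine mul_le_mul_of_nonneg_right ?_ ENNReal.toReal_nonneg
  have em : (eLpNorm m e.s μ).toReal ^ e.top =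
      (eLpNorm (fun x => ‖m x‖ ^ e.top) e.sWeight μ).toReal := by
    rw [eLpNorm_norm_rpow _ e.top_pos, sWeight_mul_top, ENNReal.toReal_rpow]
  have en : (eLpNorm n e.s μ).toReal ^ e.top =
      (eLpNorm (fun x => ‖n x‖ ^ e.top) e.sWeight μ).toReal := by
    rw [eLpNorm_norm_rpow _ e.top_pos, sWeight_mul_top, ENNReal.toReal_rpow]
  rw [em, en, weightOne, ← ENNReal.toReal_add h1.2.ne hm'.2.ne,
    ← ENNReal.toReal_add (ENNReal.add_ne_top.2 ⟨h1.2.ne, hm'.2.ne⟩) hn'.2.ne]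
  refine ENNReal.toReal_mono
    (ENNReal.add_ne_top.2 ⟨ENNReal.add_ne_top.2 ⟨h1.2.ne, hm'.2.ne⟩, hn'.2.ne⟩) ?_
  refine (eLpNorm_add_le (h1.add hm').1 hn'.1 e.one_le_sWeight).trans ?_
  gcongr
  exact eLpNorm_add_le h1.1 hm'.1 e.one_le_sWeight

theorem AdmissibleField.aestronglyMeasurable_flux (hA : AdmissibleField lo up μ A) {m : X → E}
    (hm : AEStronglyMeasurable m μ) :
    AEStronglyMeasurable (fun x => e.flux (fun i => A i x) (m x)) μ := by
  unfold flux poly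
  refine AEStronglyMeasurable.smul ?_ hm
  refine Finset.aestronglyMeasurable_fun_sum _ fun i _ => (hA.aesm i).mul ?_
  exact (hm.norm.aemeasurable.pow_const _).aestronglyMeasurable

theorem AdmissibleField.memLp_flux [IsFiniteMeasure μ] (hA : AdmissibleField lo up μ A)
    {m : X → E} (hm : MemLp m e.s μ) :
    MemLp (fun x => e.flux (fun i => A i x) (m x)) e.sStar μ := by
  refine (e.memLp_weight_smul hm (MemLp.zero (ε := E)) hm).of_le_mul
    (hA.aestronglyMeasurable_flux e hm.1) (c := up * (N + 1)) ?_
  filter_upwards [hA.adm] with x hx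
  refine (e.norm_flux_le hx (m x)).trans (le_of_eq ?_)
  rw [norm_smul, Pi.zero_apply, norm_zero, Real.zero_rpow e.top_pos.ne', add_zero,
    Real.norm_of_nonneg (by positivity)]

/-- The superposition operator `m ↦ F(x, |m|) m` from `L^s` to `L^{s*}`. -/
noncomputable def fluxLp [IsFiniteMeasure μ] (hA : AdmissibleField lo up μ A) (m : Lp E e.s μ) :
    Lp E e.sStar μ :=
  (hA.memLp_flux e (Lp.memLp m)).toLp _

theorem coeFn_fluxLp [IsFiniteMeasure μ] (hA : AdmissibleField lo up μ A) (m : Lp E e.s μ) :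
    e.fluxLp hA m =ᵐ[μ] fun x => e.flux (fun i => A i x) (m x) :=
  MemLp.coeFn_toLp _

theorem norm_fluxLp_sub_le [IsFiniteMeasure μ] (hA : AdmissibleField lo up μ A)
    (m n : Lp E e.s μ) :
    ‖e.fluxLp hA m - e.fluxLp hA n‖ ≤ up * (N + 1) * (e.top + 2) * 2 *
      ((e.weightOne μ + ‖m‖ ^ e.top + ‖n‖ ^ e.top) * ‖m - n‖) := by
  have hW := e.memLp_weight_smul (Lp.memLp m) (Lp.memLp n) (Lp.memLp (m - n))
  refine (Lp.norm_le_mul_norm_of_ae_le_mul (g := hW.toLp _)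
    (c := up * (N + 1) * (e.top + 2) * 2) ?_).trans ?_
  · filter_upwards [hA.adm, e.coeFn_fluxLp hA m, e.coeFn_fluxLp hA n, hW.coeFn_toLp,
      Lp.coeFn_sub m n, Lp.coeFn_sub (e.fluxLp hA m) (e.fluxLp hA n)] with x hx h1 h2 h3 h4 h5
    rw [h5, Pi.sub_apply, h1, h2, h3, h4, Pi.sub_apply, norm_smul,
      Real.norm_of_nonneg (by positivity)]
    exact e.norm_flux_sub_le hx _ _
  · have h1 := hA.up_nonneg
    have h2 := e.top_pos
    refine mul_le_mul_of_nonneg_left ?_ (by positivity)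
    rw [Lp.norm_toLp]
    exact e.eLpNorm_weight_smul_le (Lp.memLp m) (Lp.memLp n) (Lp.memLp (m - n))

theorem norm_fluxLp_sub_coeff_le [IsFiniteMeasure μ] (hA : AdmissibleField lo up μ A)
    (hB : AdmissibleField lo up μ B) {δ : ℝ} (hδ0 : 0 ≤ δ)
    (hδ : ∀ᵐ x ∂μ, ∀ i, |A i x - B i x| ≤ δ) (n : Lp E e.s μ) :
    ‖e.fluxLp hA n - e.fluxLp hB n‖ ≤ δ * (N + 1) *
      ((e.weightOne μ + ‖n‖ ^ e.top) * ‖n‖) := by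
  have hW := e.memLp_weight_smul (Lp.memLp n) (MemLp.zero (ε := E)) (Lp.memLp n)
  refine (Lp.norm_le_mul_norm_of_ae_le_mul (g := hW.toLp _) (c := δ * (N + 1)) ?_).trans ?_
  · filter_upwards [hδ, e.coeFn_fluxLp hA n, e.coeFn_fluxLp hB n, hW.coeFn_toLp,
      Lp.coeFn_sub (e.fluxLp hA n) (e.fluxLp hB n)] with x hx h1 h2 h3 h5
    rw [h5, Pi.sub_apply, h1, h2, h3, norm_smul, Pi.zero_apply, norm_zero,
      Real.zero_rpow e.top_pos.ne', add_zero, Real.norm_of_nonneg (by positivity)]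
    exact e.norm_flux_sub_coeff_le hx _
  · refine mul_le_mul_of_nonneg_left ?_ (by positivity)
    rw [Lp.norm_toLp]
    have := e.eLpNorm_weight_smul_le (Lp.memLp n) (MemLp.zero (ε := E)) (Lp.memLp n)
    rwa [eLpNorm_zero, ENNReal.toReal_zero, Real.zero_rpow e.top_pos.ne', add_zero] at this

/-- Joint continuity of the superposition operator in the argument and the coefficients. -/
theorem tendsto_fluxLp [IsFiniteMeasure μ] {ι : Type*} {l : Filter ι}
    {C : ι → Fin (N + 1) → X → ℝ} (hC : ∀ k, AdmissibleField lo up μ (C k))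
    (hA : AdmissibleField lo up μ A) {δ : ι → ℝ} (hδ0 : ∀ k, 0 ≤ δ k)
    (hδ : ∀ k, ∀ᵐ x ∂μ, ∀ i, |C k i x - A i x| ≤ δ k) (hδlim : Tendsto δ l (𝓝 0))
    {m : ι → Lp E e.s μ} {m₀ : Lp E e.s μ} (hm : Tendsto m l (𝓝 m₀)) :
    Tendsto (fun k => e.fluxLp (hC k) (m k)) l (𝓝 (e.fluxLp hA m₀)) := by
  rw [tendsto_iff_norm_sub_tendsto_zero]
  have hpow : Tendsto (fun k => ‖m k‖ ^ e.top) l (𝓝 (‖m₀‖ ^ e.top)) :=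
    hm.norm.rpow_const (Or.inr e.top_pos.le)
  have h1 := (hm.sub_const m₀).norm
  rw [sub_self, norm_zero] at h1
  have hb := ((((hpow.const_add (e.weightOne μ)).add_const (‖m₀‖ ^ e.top)).mul h1).const_mul
    (up * (N + 1) * (e.top + 2) * 2)).add ((hδlim.mul_const (N + 1 : ℝ)).mul_const
      ((e.weightOne μ + ‖m₀‖ ^ e.top) * ‖m₀‖))
  simp only [mul_zero, zero_mul, add_zero] at hb
  refine squeeze_zero (fun k => norm_nonneg _) (fun k => ?_) hb
  have e1 : e.fluxLp (hC k) (m k) - e.fluxLp hA m₀ =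
      (e.fluxLp (hC k) (m k) - e.fluxLp (hC k) m₀) + (e.fluxLp (hC k) m₀ - e.fluxLp hA m₀) := by
    abel
  rw [e1]
  exact (norm_add_le _ _).trans (add_le_add (e.norm_fluxLp_sub_le (hC k) _ _)
    (e.norm_fluxLp_sub_coeff_le (hC k) hA (hδ0 k) (hδ k) _))

theorem integral_norm_rpow_eq {V : Type*} [NormedAddCommGroup V] (u : Lp V e.s μ) :
    ∫ x, ‖u x‖ ^ (e.top + 2) ∂μ = ‖u‖ ^ (e.top + 2) := by
  have h := e.top_pos
  rw [Lp.norm_def, (Lp.memLp u).eLpNorm_eq_integral_rpow_norm e.s_ne_zero e.s_ne_top, toReal_s,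
    ENNReal.toReal_ofReal (by positivity), ← Real.rpow_mul (by positivity),
    inv_mul_cancel₀ (by linarith), Real.rpow_one]

theorem integrable_norm_rpow {V : Type*} [NormedAddCommGroup V] (u : Lp V e.s μ) :
    Integrable (fun x => ‖u x‖ ^ (e.top + 2)) μ := by
  have := (Lp.memLp u).integrable_norm_rpow e.s_ne_zero e.s_ne_top
  rwa [toReal_s] at this

theorem strong_mono_fluxLp [IsFiniteMeasure μ] (hA : AdmissibleField lo up μ A)
    (hB : AdmissibleField lo up μ B) {δ : ℝ}
    (hδ : ∀ᵐ x ∂μ, ∀ i, |A i x - B i x| ≤ δ) (m n : Lp E e.s μ) :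
    lo / 4 * (1 / 2) ^ e.top * ‖m - n‖ ^ (e.top + 2)
        - ((N + 1) / lo) ^ 2 * δ ^ 2 * innerPairing μ E e.sStar e.s (e.fluxLp hB n) n ≤
      innerPairing μ E e.sStar e.s (e.fluxLp hA m - e.fluxLp hB n) (m - n) := by
  have i1 := e.integrable_norm_rpow (m - n)
  have i2 := Lp.integrable_inner' (e.fluxLp hB n) n
  have i3 := Lp.integrable_inner' (e.fluxLp hA m - e.fluxLp hB n) (m - n)
  rw [← integral_norm_rpow_eq, innerPairing_eq, innerPairing_eq, ← integral_const_mul,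
    ← integral_const_mul, ← integral_sub (i1.const_mul _) (i2.const_mul _)]
  refine integral_mono_ae ((i1.const_mul _).sub (i2.const_mul _)) i3 ?_
  filter_upwards [hδ, hA.adm, hB.adm, e.coeFn_fluxLp hA m, e.coeFn_fluxLp hB n, Lp.coeFn_sub m n,
    Lp.coeFn_sub (e.fluxLp hA m) (e.fluxLp hB n)] with x hx ha hb h1 h2 h3 h4
  rw [h4, h3, Pi.sub_apply, Pi.sub_apply, h1, h2]
  exact e.strong_mono_flux hA.lo_pos ha hb hx _ _

theorem innerPairing_fluxLp_self_nonneg [IsFiniteMeasure μ] (hA : AdmissibleField lo up μ A)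
    (m : Lp E e.s μ) : 0 ≤ innerPairing μ E e.sStar e.s (e.fluxLp hA m) m := by
  rw [innerPairing_eq]
  refine integral_nonneg_of_ae ?_
  filter_upwards [hA.adm, e.coeFn_fluxLp hA m] with x hx h1
  rw [h1]
  exact e.inner_flux_self_nonneg hA.lo_pos hx _

variable (μ) in
/-- The integral of the potential. -/
noncomputable def energy {V : Type*} [NormedAddCommGroup V] (A : Fin (N + 1) → X → ℝ)
    (m : X → V) : ℝ :=
  ∫ x, e.potential (fun i => A i x) (m x) ∂μ

theorem AdmissibleField.integrable_potential [IsFiniteMeasure μ] (hA : AdmissibleField lo up μ A)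
    (m : Lp E e.s μ) : Integrable (fun x => e.potential (fun i => A i x) (m x)) μ := by
  refine (Lp.integrable_inner' (e.fluxLp hA m) m).mono ?_ ?_
  · unfold potential
    refine Finset.aestronglyMeasurable_fun_sum _ fun i _ => (hA.aesm i).mul ?_
    exact (((Lp.aestronglyMeasurable m).norm.aemeasurable.pow_const _).div_const
      _).aestronglyMeasurable
  · filter_upwards [hA.adm, e.coeFn_fluxLp hA m] with x hx h1
    rw [h1, Real.norm_of_nonneg (e.potential_nonneg hx _)]
    exact (e.potential_le_inner_flux hx _).trans (le_abs_self _)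

theorem energy_nonneg {V : Type*} [NormedAddCommGroup V] (hA : AdmissibleField lo up μ A) (m : X → V) :
    0 ≤ e.energy μ A m :=
  integral_nonneg_of_ae (by filter_upwards [hA.adm] with x hx using e.potential_nonneg hx _)

theorem energy_add_innerPairing_le [IsFiniteMeasure μ] (hA : AdmissibleField lo up μ A)
    (m n : Lp E e.s μ) :
    e.energy μ A m + innerPairing μ E e.sStar e.s (e.fluxLp hA m) (n - m) ≤ e.energy μ A n := by
  have i1 := Lp.integrable_inner' (e.fluxLp hA m) (n - m)
  rw [innerPairing_eq, energy, ← integral_add (hA.integrable_potential e m) i1]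
  refine integral_mono_ae ((hA.integrable_potential e m).add i1) (hA.integrable_potential e n) ?_
  filter_upwards [hA.adm, e.coeFn_fluxLp hA m, Lp.coeFn_sub n m] with x hx h1 h2
  rw [h1, h2]
  exact e.potential_add_inner_le hx _ _

theorem energy_midpoint_le [IsFiniteMeasure μ] (hA : AdmissibleField lo up μ A)
    (m n : Lp E e.s μ) :
    e.energy μ A (((1 / 2 : ℝ) • (m + n) : Lp E e.s μ) : X → E)
        + lo / (e.top + 2) * ‖(1 / 2 : ℝ) • (m - n)‖ ^ (e.top + 2) ≤
      (e.energy μ A m + e.energy μ A n) / 2 := by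
  have i0 := hA.integrable_potential e ((1 / 2 : ℝ) • (m + n))
  have i1 := e.integrable_norm_rpow ((1 / 2 : ℝ) • (m - n))
  have im := hA.integrable_potential e m
  have i_n := hA.integrable_potential e n
  rw [energy, energy, energy, ← integral_norm_rpow_eq, ← integral_const_mul,
    ← integral_add i0 (i1.const_mul _), ← integral_add im i_n, ← integral_div]
  refine integral_mono_ae (i0.add (i1.const_mul _)) ((im.add i_n).div_const 2) ?_
  filter_upwards [hA.adm, Lp.coeFn_smul (1 / 2 : ℝ) (m + n), Lp.coeFn_add m n,
    Lp.coeFn_smul (1 / 2 : ℝ) (m - n), Lp.coeFn_sub m n] with x hx h1 h2 h3 h4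
  rw [h1, h3, Pi.smul_apply, Pi.smul_apply, h2, h4]
  exact e.potential_midpoint_le hA.lo_pos hx _ _

end Nemytskii

end ForchheimerExponents

/-- Uniform convexity and strong monotonicity control only a power of the distance; taking the root
gives the Cauchy property. -/
theorem cauchySeq_of_mul_rpow_le {V : Type*} [SeminormedAddCommGroup V] {x : ℕ → V} {c r : ℝ}
    (hc : 0 < c) (hr : 0 < r) {b : ℕ × ℕ → ℝ} (hb : Tendsto b atTop (𝓝 0))
    (h : ∀ k l, c * ‖x k - x l‖ ^ r ≤ b (k, l)) : CauchySeq x := by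
  rw [cauchySeq_iff_tendsto_dist_atTop_0]
  have h1 : Tendsto (fun n => (b n / c) ^ r⁻¹) atTop (𝓝 0) := by
    have := (hb.div_const c).rpow_const (p := r⁻¹) (Or.inr (inv_pos.2 hr).le)
    rwa [zero_div, Real.zero_rpow (inv_pos.2 hr).ne'] at this
  refine squeeze_zero (fun _ => dist_nonneg) (fun n => ?_) h1
  rw [dist_eq_norm]
  have h2 : ‖x n.1 - x n.2‖ ^ r ≤ b n / c := by
    rw [le_div_iff₀ hc, mul_comm]
    exact h n.1 n.2
  calc ‖x n.1 - x n.2‖ = (‖x n.1 - x n.2‖ ^ r) ^ r⁻¹ := by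
        rw [← Real.rpow_mul (norm_nonneg _), mul_inv_cancel₀ hr.ne', Real.rpow_one]
    _ ≤ _ := Real.rpow_le_rpow (Real.rpow_nonneg (norm_nonneg _) _) h2 (inv_pos.2 hr).le

theorem half_norm_sq_add_inner_le {H : Type*} [NormedAddCommGroup H] [InnerProductSpace ℝ H]
    (x y : H) : ‖x‖ ^ 2 / 2 + inner ℝ x (y - x) ≤ ‖y‖ ^ 2 / 2 := by
  have h := norm_sub_sq_real y x
  rw [inner_sub_right, real_inner_self_eq_norm_sq, real_inner_comm]
  nlinarith [sq_nonneg ‖y - x‖]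

/-! ### The resolvent equation by convex minimization. -/

section Resolvent

variable {d N : ℕ} {Ω : Opens (Euc d)} [IsFiniteMeasure (volOn Ω)] (e : ForchheimerExponents N)
  {lo up : ℝ} {A : Fin (N + 1) → Euc d → ℝ}

/-- The functional whose minimizer solves the resolvent equation. -/
noncomputable def resolventEnergy (A : Fin (N + 1) → Euc d → ℝ)
    (Q : Lp ℝ 2 (volOn Ω) →L[ℝ] Lp ℝ 2 (volOn Ω)) (τ : ℝ) (h : Lp ℝ 2 (volOn Ω))
    (w : Wdiv Ω e.s) : ℝ :=
  e.energy (volOn Ω) A w.1.1 + τ * (‖Q w.1.2 - τ⁻¹ • h‖ ^ 2 / 2)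

variable {Q : Lp ℝ 2 (volOn Ω) →L[ℝ] Lp ℝ 2 (volOn Ω)} {τ : ℝ}

/-- The subgradient inequality. It replaces differentiation of the functional in the Euler equation
and provides lower semicontinuity along minimizing sequences. -/
theorem resolventEnergy_add_le
    (hA : ForchheimerExponents.AdmissibleField lo up (volOn Ω) A) (hτ : 0 < τ)
    (h : Lp ℝ 2 (volOn Ω)) (w z : Wdiv Ω e.s) :
    resolventEnergy e A Q τ h w
      + (innerPairing (volOn Ω) (Euc d) e.sStar e.s (e.fluxLp hA w.1.1) (z.1.1 - w.1.1)
        + τ * inner ℝ (Q w.1.2 - τ⁻¹ • h) (Q (z.1.2 - w.1.2))) ≤ resolventEnergy e A Q τ h z := by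
  have h1 := e.energy_add_innerPairing_le hA w.1.1 z.1.1
  have h2 := mul_le_mul_of_nonneg_left
    (half_norm_sq_add_inner_le (Q w.1.2 - τ⁻¹ • h) (Q z.1.2 - τ⁻¹ • h)) hτ.le
  rw [sub_sub_sub_cancel_right, ← map_sub] at h2
  unfold resolventEnergy
  linarith

theorem resolventEnergy_midpoint_le
    (hA : ForchheimerExponents.AdmissibleField lo up (volOn Ω) A) (hτ : 0 < τ)
    (h : Lp ℝ 2 (volOn Ω)) (w z : Wdiv Ω e.s) :
    resolventEnergy e A Q τ h ((1 / 2 : ℝ) • (w + z))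
      + (lo / (e.top + 2) * (1 / 2) ^ (e.top + 2) * ‖w.1.1 - z.1.1‖ ^ (e.top + 2)
        + τ / 8 * ‖Q (w.1.2 - z.1.2)‖ ^ 2) ≤
      (resolventEnergy e A Q τ h w + resolventEnergy e A Q τ h z) / 2 := by
  have h1 := e.energy_midpoint_le hA w.1.1 z.1.1
  rw [norm_smul, Real.mul_rpow (norm_nonneg _) (norm_nonneg _),
    Real.norm_of_nonneg (by norm_num : (0 : ℝ) ≤ 1 / 2)] at h1
  have hpar := parallelogram_law_with_norm ℝ (Q w.1.2 - τ⁻¹ • h) (Q z.1.2 - τ⁻¹ • h)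
  rw [sub_sub_sub_cancel_right, ← map_sub] at hpar
  have hmid : Q ((1 / 2 : ℝ) • (w + z)).1.2 - τ⁻¹ • h =
      (1 / 2 : ℝ) • ((Q w.1.2 - τ⁻¹ • h) + (Q z.1.2 - τ⁻¹ • h)) := by
    change Q ((1 / 2 : ℝ) • (w.1.2 + z.1.2)) - τ⁻¹ • h = _
    rw [map_smul, map_add]
    module
  have hnorm : ‖Q ((1 / 2 : ℝ) • (w + z)).1.2 - τ⁻¹ • h‖ ^ 2 =
      ‖(Q w.1.2 - τ⁻¹ • h) + (Q z.1.2 - τ⁻¹ • h)‖ ^ 2 / 4 := by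
    rw [hmid, norm_smul, mul_pow, Real.norm_of_nonneg (by norm_num)]
    ring
  unfold resolventEnergy
  rw [hnorm]
  change e.energy (volOn Ω) A (((1 / 2 : ℝ) • (w.1.1 + z.1.1) : Lp (Euc d) e.s (volOn Ω)) :
    Euc d → Euc d) + _ + _ ≤ _
  nlinarith

/-- The midpoint of two almost minimizers cannot fall below the infimum, so the convexity gain
forces a minimizing sequence to be Cauchy. The field is controlled by the energy, and the divergence
by the quadratic term because `Q` is bounded below. -/
theorem exists_minimizer_resolventEnergy
    (hA : ForchheimerExponents.AdmissibleField lo up (volOn Ω) A) (hτ : 0 < τ)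
    {c : ℝ} (hc : 0 < c) (hQ : ∀ x, c * ‖x‖ ≤ ‖Q x‖) (h : Lp ℝ 2 (volOn Ω)) :
    ∃ m : Wdiv Ω e.s, ∀ w, resolventEnergy e A Q τ h m ≤ resolventEnergy e A Q τ h w := by
  set J := resolventEnergy e A Q τ h with hJ
  have hlo := hA.lo_pos
  have htop := e.top_pos
  have hJ0 : ∀ w, 0 ≤ J w := fun w =>
    add_nonneg (e.energy_nonneg hA _) (by positivity)
  have hbdd : BddBelow (range J) := ⟨0, by rintro _ ⟨w, rfl⟩; exact hJ0 w⟩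
  set I := ⨅ w, J w with hI
  have hIle : ∀ w, I ≤ J w := fun w => ciInf_le hbdd w
  choose m hm using fun k : ℕ => exists_lt_of_ciInf_lt (f := J)
    (show ⨅ w, J w < I + 1 / ((k : ℝ) + 1) by
      rw [← hI]; linarith [show 0 < 1 / ((k : ℝ) + 1) by positivity])
  have hdiff : ∀ k l, lo / (e.top + 2) * (1 / 2) ^ (e.top + 2) *
      ‖(m k).1.1 - (m l).1.1‖ ^ (e.top + 2) + τ / 8 * ‖Q ((m k).1.2 - (m l).1.2)‖ ^ 2 ≤
      1 / ((k : ℝ) + 1) + 1 / ((l : ℝ) + 1) := by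
    intro k l
    have h1 := resolventEnergy_midpoint_le (Q := Q) e hA hτ h (m k) (m l)
    have h2 := hIle ((1 / 2 : ℝ) • (m k + m l))
    have h3 := hm k
    have h4 := hm l
    have h5 : 0 < 1 / ((k : ℝ) + 1) := by positivity
    have h6 : 0 < 1 / ((l : ℝ) + 1) := by positivity
    simp only [hJ] at h2 h3 h4
    linarith
  have hb : Tendsto (fun n : ℕ × ℕ => 1 / ((n.1 : ℝ) + 1) + 1 / ((n.2 : ℝ) + 1)) atTop (𝓝 0) := by
    rw [← prod_atTop_atTop_eq, ← add_zero (0 : ℝ)]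
    exact (tendsto_one_div_add_atTop_nhds_zero_nat.comp tendsto_fst).add
      (tendsto_one_div_add_atTop_nhds_zero_nat.comp tendsto_snd)
  have hc1 : CauchySeq fun k => (m k).1.1 := by
    refine cauchySeq_of_mul_rpow_le (c := lo / (e.top + 2) * (1 / 2) ^ (e.top + 2)) (by positivity)
      (by linarith : 0 < e.top + 2) hb fun k l => ?_
    have := hdiff k l
    have h1 : 0 ≤ τ / 8 * ‖Q ((m k).1.2 - (m l).1.2)‖ ^ 2 := by positivity
    linarith
  have hc2 : CauchySeq fun k => (m k).1.2 := by
    refine cauchySeq_of_mul_rpow_le (c := τ / 8 * c ^ 2) (by positivity)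
      (by norm_num : (0 : ℝ) < 2) hb fun k l => ?_
    have h0 := hdiff k l
    have h1 : 0 ≤ lo / (e.top + 2) * (1 / 2) ^ (e.top + 2) *
      ‖(m k).1.1 - (m l).1.1‖ ^ (e.top + 2) := by positivity
    have h2 := pow_le_pow_left₀ (by positivity) (hQ ((m k).1.2 - (m l).1.2)) 2
    rw [Real.rpow_two]
    have h3 := mul_le_mul_of_nonneg_left h2 (by positivity : 0 ≤ τ / 8)
    rw [mul_pow] at h3
    linarith
  obtain ⟨v, hv⟩ := cauchySeq_tendsto_of_complete hc1
  obtain ⟨g, hg⟩ := cauchySeq_tendsto_of_complete hc2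
  have hmem : (v, g) ∈ Wdiv Ω e.s :=
    (isClosed_Wdiv e.sStar).mem_of_tendsto (hv.prodMk_nhds hg)
      (Eventually.of_forall fun k => (m k).2)
  refine ⟨⟨(v, g), hmem⟩, fun w => le_trans ?_ (hIle w)⟩
  set mm : Wdiv Ω e.s := ⟨(v, g), hmem⟩
  have hlim1 : Tendsto (fun k => J mm + (innerPairing (volOn Ω) (Euc d) e.sStar e.s
      (e.fluxLp hA mm.1.1) ((m k).1.1 - mm.1.1)
        + τ * inner ℝ (Q mm.1.2 - τ⁻¹ • h) (Q ((m k).1.2 - mm.1.2)))) atTop (𝓝 (J mm)) := by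
    have t1 := ((innerPairing (volOn Ω) (Euc d) e.sStar e.s
      (e.fluxLp hA mm.1.1)).continuous.tendsto _).comp (hv.sub_const v)
    have t2 := (Q.continuous.tendsto _).comp (hg.sub_const g)
    rw [sub_self, map_zero] at t1 t2
    have t3 := ((tendsto_const_nhds (x := Q mm.1.2 - τ⁻¹ • h)).inner t2).const_mul τ
    rw [inner_zero_right, mul_zero] at t3
    have := (t1.add t3).const_add (J mm)
    rwa [add_zero, add_zero] at this
  have hlim2 : Tendsto (fun k : ℕ => I + 1 / ((k : ℝ) + 1)) atTop (𝓝 I) := by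
    simpa using tendsto_one_div_add_atTop_nhds_zero_nat.const_add I
  exact le_of_tendsto_of_tendsto' hlim1 hlim2 fun k =>
    (resolventEnergy_add_le e hA hτ h mm (m k)).trans (hm k).le

/-- Solvability of the resolvent equation in mixed form. -/
theorem exists_resolvent (hA : ForchheimerExponents.AdmissibleField lo up (volOn Ω) A) (hτ : 0 < τ)
    {c : ℝ} (hc : 0 < c) (hQ : ∀ x, c * ‖x‖ ≤ ‖Q x‖)
    (hQs : ∀ x y, inner ℝ (Q x) y = inner ℝ x (Q y)) (h : Lp ℝ 2 (volOn Ω)) :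
    ∃ m : Wdiv Ω e.s, ∀ v : Wdiv Ω e.s,
      innerPairing (volOn Ω) (Euc d) e.sStar e.s (e.fluxLp hA m.1.1) v.1.1 =
        inner ℝ (Q (h - τ • Q m.1.2)) v.1.2 := by
  obtain ⟨m, hm⟩ := exists_minimizer_resolventEnergy e hA hτ hc hQ h
  set x := Q m.1.2 - τ⁻¹ • h with hx
  -- A minimizer gives one inequality for each direction; using `v` and `-v` yields the equation.
  have key : ∀ v : Wdiv Ω e.s,
      0 ≤ innerPairing (volOn Ω) (Euc d) e.sStar e.s (e.fluxLp hA m.1.1) v.1.1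
        + τ * inner ℝ x (Q v.1.2) := by
    intro v
    set t : ℕ → ℝ := fun k => 1 / ((k : ℝ) + 1) with ht
    have htp : ∀ k, 0 < t k := fun k => by positivity
    have ht0 : Tendsto t atTop (𝓝 0) := tendsto_one_div_add_atTop_nhds_zero_nat
    -- The subgradient is taken at the perturbed point `m + t k • v` and evaluated at the minimizer,
    -- which fixes the sign of its action on `v`. Continuity of the flux then permits `t k → 0`.
    have h1 : ∀ k, 0 ≤ innerPairing (volOn Ω) (Euc d) e.sStar e.s
        (e.fluxLp hA (m.1.1 + t k • v.1.1)) v.1.1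
          + τ * inner ℝ (Q (m.1.2 + t k • v.1.2) - τ⁻¹ • h) (Q v.1.2) := by
      intro k
      have a1 := resolventEnergy_add_le (Q := Q) e hA hτ h (m + t k • v) m
      have a2 := hm (m + t k • v)
      have b1 : m.1.1 - (m + t k • v).1.1 = -(t k • v.1.1) := by
        change m.1.1 - (m.1.1 + t k • v.1.1) = _; abel
      have b2 : m.1.2 - (m + t k • v).1.2 = -(t k • v.1.2) := by
        change m.1.2 - (m.1.2 + t k • v.1.2) = _; abel
      rw [b1, b2, map_neg, map_neg, inner_neg_right, map_smul, map_smul, inner_smul_right,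
        smul_eq_mul] at a1
      change _ + (-(t k * innerPairing (volOn Ω) (Euc d) e.sStar e.s
        (e.fluxLp hA (m.1.1 + t k • v.1.1)) v.1.1) + τ * -(t k *
          inner ℝ (Q (m.1.2 + t k • v.1.2) - τ⁻¹ • h) (Q v.1.2))) ≤ _ at a1
      by_contra hneg
      push Not at hneg
      have := mul_neg_of_pos_of_neg (htp k) hneg
      rw [mul_add] at this
      nlinarith
    have t1 : Tendsto (fun k => m.1.1 + t k • v.1.1) atTop (𝓝 m.1.1) := by
      simpa using (ht0.smul_const v.1.1).const_add m.1.1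
    have t2 : Tendsto (fun k => m.1.2 + t k • v.1.2) atTop (𝓝 m.1.2) := by
      simpa using (ht0.smul_const v.1.2).const_add m.1.2
    have t3 := e.tendsto_fluxLp (fun _ : ℕ => hA) hA (δ := fun _ => 0) (fun _ => le_rfl)
      (fun _ => ae_of_all _ fun x i => by simp) tendsto_const_nhds t1
    have t4 := (((innerPairing (volOn Ω) (Euc d) e.sStar e.s).flip v.1.1).continuous.tendsto
      _).comp t3
    have t5 := (((((Q.continuous.tendsto _).comp t2).sub_const (τ⁻¹ • h)).inner
      (tendsto_const_nhds (x := Q v.1.2))).const_mul τ)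
    exact ge_of_tendsto' (t4.add t5) h1
  refine ⟨m, fun v => ?_⟩
  have k1 := key v
  have k2 := key (-v)
  have n1 : (-v).1.1 = -v.1.1 := rfl
  have n2 : (-v).1.2 = -v.1.2 := rfl
  rw [n1, n2, map_neg, map_neg, inner_neg_right] at k2
  have e1 : inner ℝ (Q (h - τ • Q m.1.2)) v.1.2 = -(τ * inner ℝ x (Q v.1.2)) := by
    rw [hQs, hx, inner_sub_left, inner_sub_left, real_inner_smul_left, real_inner_smul_left]
    field_simp
    ring
  rw [e1]
  linarith

end Resolvent

/-! ### The momentum equation and the associated monotone relation. -/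

section Flow

variable {d N : ℕ} {Ω : Opens (Euc d)} [IsFiniteMeasure (volOn Ω)] (e : ForchheimerExponents N)
  {lo up : ℝ} {A : ℝ → Fin (N + 1) → Euc d → ℝ}

/-- The vector field `m` and the density `ρ` satisfy the momentum equation at time `t`. -/
def IsMomentum (hA : ∀ t, ForchheimerExponents.AdmissibleField lo up (volOn Ω) (A t)) (t : ℝ)
    (ρ : Lp ℝ 2 (volOn Ω)) (m : Wdiv Ω e.s) : Prop :=
  ∀ v : Wdiv Ω e.s, innerPairing (volOn Ω) (Euc d) e.sStar e.s (e.fluxLp (hA t) m.1.1) v.1.1 =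
    inner ℝ ρ v.1.2

/-- The relation between `u` and `a` given by `ρ = Q u`, `a = Q (div m)` and the momentum
equation. -/
def FlowRel (hA : ∀ t, ForchheimerExponents.AdmissibleField lo up (volOn Ω) (A t))
    (Q : Lp ℝ 2 (volOn Ω) →L[ℝ] Lp ℝ 2 (volOn Ω)) (t : ℝ) (u a : Lp ℝ 2 (volOn Ω)) : Prop :=
  ∃ m : Wdiv Ω e.s, a = Q m.1.2 ∧ IsMomentum e hA t (Q u) m

variable {e} {hA : ∀ t, ForchheimerExponents.AdmissibleField lo up (volOn Ω) (A t)} {L : ℝ}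

/-- Testing both momentum equations with `m - n` turns the difference of the fluxes into `inner (ρ -
σ) (div (m - n))`; testing the second with `n` evaluates the error term. -/
theorem IsMomentum.strong_mono (hL : ∀ t r, ∀ᵐ x ∂volOn Ω, ∀ i, |A t i x - A r i x| ≤ L * |t - r|)
    {t r : ℝ} {ρ σ : Lp ℝ 2 (volOn Ω)} {m n : Wdiv Ω e.s} (hm : IsMomentum e hA t ρ m)
    (hn : IsMomentum e hA r σ n) :
    lo / 4 * (1 / 2) ^ e.top * ‖m.1.1 - n.1.1‖ ^ (e.top + 2)
        - ((N + 1) / lo * L) ^ 2 * (t - r) ^ 2 * inner ℝ n.1.2 σ ≤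
      inner ℝ (m.1.2 - n.1.2) (ρ - σ) := by
  have h1 := e.strong_mono_fluxLp (hA t) (hA r) (hL t r) m.1.1 n.1.1
  have h2 := hm (m - n)
  have h3 := hn (m - n)
  have h4 := hn n
  rw [map_sub (innerPairing (volOn Ω) (Euc d) e.sStar e.s), sub_apply] at h1
  change innerPairing (volOn Ω) (Euc d) e.sStar e.s _ (m.1.1 - n.1.1) =
    inner ℝ ρ (m.1.2 - n.1.2) at h2
  change innerPairing (volOn Ω) (Euc d) e.sStar e.s _ (m.1.1 - n.1.1) =
    inner ℝ σ (m.1.2 - n.1.2) at h3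
  rw [h2, h3, h4, mul_pow L, sq_abs, real_inner_comm n.1.2 σ, ← inner_sub_left,
    real_inner_comm (m.1.2 - n.1.2)] at h1
  rw [mul_pow]
  linarith

theorem IsMomentum.inner_div_nonneg {t : ℝ} {ρ : Lp ℝ 2 (volOn Ω)} {m : Wdiv Ω e.s}
    (hm : IsMomentum e hA t ρ m) : 0 ≤ inner ℝ m.1.2 ρ := by
  rw [real_inner_comm, ← hm m]
  exact e.innerPairing_fluxLp_self_nonneg (hA t) m.1.1

/-- The density belongs to `L²(Ω) ∩ W₀^{1,s*}(Ω)`, and its gradient is minus the flux. -/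
theorem IsMomentum.mem_L2W0 {t : ℝ} {ρ : Lp ℝ 2 (volOn Ω)} {m : Wdiv Ω e.s}
    (hm : IsMomentum e hA t ρ m) : (ρ, -e.fluxLp (hA t) m.1.1) ∈ L2W0 Ω e.sStar := by
  refine mem_L2W0_of_forall_Wdiv (q := e.s) e.sStar_le_two e.s_ne_top fun w => ?_
  have h := hm w
  rw [innerPairing_eq] at h ⊢
  rw [real_inner_comm, ← h, ← integral_add]
  · rw [← integral_zero (Euc d) ℝ (μ := volOn Ω)]
    refine integral_congr_ae ?_
    filter_upwards [Lp.coeFn_neg (e.fluxLp (hA t) m.1.1)] with x hx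
    rw [hx, Pi.neg_apply, inner_neg_right, real_inner_comm, add_neg_cancel]
  · exact Lp.integrable_inner' _ _
  · exact Lp.integrable_inner' (p := e.s) (q := e.sStar) _ _

variable (hA) in
theorem isMomentum_of_gradient {t : ℝ} (ρ : L2W0 Ω e.sStar) (m : Wdiv Ω e.s)
    (h : ∀ᵐ x ∂volOn Ω, e.flux (fun i => A t i x) (m.1.1 x) = -ρ.1.2 x) :
    IsMomentum e hA t ρ.1.1 m := by
  intro v
  have h1 := inner_div_add_innerPairing_grad ρ v
  rw [real_inner_comm, add_eq_zero_iff_eq_neg, innerPairing_eq, ← integral_neg] at h1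
  rw [h1, innerPairing_eq]
  refine integral_congr_ae ?_
  filter_upwards [h, e.coeFn_fluxLp (hA t) m.1.1] with x hx hx'
  rw [hx', hx, inner_neg_left, real_inner_comm]

/-- Convergence of the vector fields when the densities converge and the divergences stay
bounded. -/
theorem IsMomentum.tendsto (hL : ∀ t r, ∀ᵐ x ∂volOn Ω, ∀ i, |A t i x - A r i x| ≤ L * |t - r|)
    (hL0 : 0 ≤ L) {t : ℕ → ℝ} {t₀ : ℝ} {ρ : ℕ → Lp ℝ 2 (volOn Ω)} {ρ₀ : Lp ℝ 2 (volOn Ω)}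
    {m : ℕ → Wdiv Ω e.s} {M : ℝ} (ht : Tendsto t atTop (𝓝 t₀)) (hρ : Tendsto ρ atTop (𝓝 ρ₀))
    (hM : ∀ k, ‖(m k).1.2‖ ≤ M) (hm : ∀ k, IsMomentum e hA (t k) (ρ k) (m k)) :
    ∃ m₀ : Wdiv Ω e.s, IsMomentum e hA t₀ ρ₀ m₀ ∧
      Tendsto (fun k => (m k).1.1) atTop (𝓝 m₀.1.1) ∧
      Tendsto (fun k => e.fluxLp (hA (t k)) (m k).1.1) atTop (𝓝 (e.fluxLp (hA t₀) m₀.1.1)) ∧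
      ∀ h, Tendsto (fun k => inner ℝ (m k).1.2 h) atTop (𝓝 (inner ℝ m₀.1.2 h)) := by
  have hlo := (hA 0).lo_pos
  have htop := e.top_pos
  have hM0 : 0 ≤ M := (norm_nonneg _).trans (hM 0)
  -- Strong monotonicity bounds the distance of the fields by `2 * M * ‖ρ k - ρ l‖` plus a term in
  -- `(t k - t l) ^ 2`. Bounded divergences suffice because the densities converge strongly.
  have hcau : CauchySeq fun k => (m k).1.1 := by
    have hb : Tendsto (fun n : ℕ × ℕ => 2 * M * ‖ρ n.1 - ρ n.2‖
        + ((N + 1) / lo * L) ^ 2 * (t n.1 - t n.2) ^ 2 * (M * ‖ρ n.2‖)) atTop (𝓝 0) := by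
      rw [← prod_atTop_atTop_eq]
      have r1 := hρ.comp (tendsto_fst (f := (atTop : Filter ℕ)) (g := (atTop : Filter ℕ)))
      have r2 := hρ.comp (tendsto_snd (f := (atTop : Filter ℕ)) (g := (atTop : Filter ℕ)))
      have t1 := ht.comp (tendsto_fst (f := (atTop : Filter ℕ)) (g := (atTop : Filter ℕ)))
      have t2 := ht.comp (tendsto_snd (f := (atTop : Filter ℕ)) (g := (atTop : Filter ℕ)))
      have := (((r1.sub r2).norm.const_mul (2 * M))).add
        ((((t1.sub t2).pow 2).const_mul (((N + 1) / lo * L) ^ 2)).mul (r2.norm.const_mul M))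
      simpa using this
    refine cauchySeq_of_mul_rpow_le (c := lo / 4 * (1 / 2) ^ e.top) (by positivity)
      (by linarith : 0 < e.top + 2) hb fun k l => ?_
    have h1 := (hm k).strong_mono hL (hm l)
    have h2 : inner ℝ ((m k).1.2 - (m l).1.2) (ρ k - ρ l) ≤ 2 * M * ‖ρ k - ρ l‖ := by
      refine (real_inner_le_norm _ _).trans ?_
      gcongr
      exact (norm_sub_le _ _).trans (by linarith [hM k, hM l])
    have h3 : ((N + 1) / lo * L) ^ 2 * (t k - t l) ^ 2 * inner ℝ (m l).1.2 (ρ l) ≤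
        ((N + 1) / lo * L) ^ 2 * (t k - t l) ^ 2 * (M * ‖ρ l‖) := by
      gcongr
      refine (real_inner_le_norm _ _).trans ?_
      gcongr
      exact hM l
    linarith
  obtain ⟨v, hv⟩ := cauchySeq_tendsto_of_complete hcau
  obtain ⟨m₀, rfl, hweak⟩ := exists_weak_limit_div e.sStar hv hM
  have hδ : Tendsto (fun k => L * |t k - t₀|) atTop (𝓝 0) := by
    have := ((ht.sub_const t₀).abs).const_mul L
    simpa using this
  have hflux := e.tendsto_fluxLp (fun k => hA (t k)) (hA t₀) (fun k => by positivity)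
    (fun k => hL (t k) t₀) hδ hv
  refine ⟨m₀, fun w => ?_, hv, hflux, hweak⟩
  have l1 := (((innerPairing (volOn Ω) (Euc d) e.sStar e.s).flip w.1.1).continuous.tendsto
      _).comp hflux
  have l2 := hρ.inner (𝕜 := ℝ) (tendsto_const_nhds (x := w.1.2))
  exact tendsto_nhds_unique l1 (l2.congr fun k => (hm k w).symm)

theorem IsMomentum.unique
    (hL : ∀ t r, ∀ᵐ x ∂volOn Ω, ∀ i, |A t i x - A r i x| ≤ L * |t - r|) {t : ℝ}
    {ρ : Lp ℝ 2 (volOn Ω)} {m n : Wdiv Ω e.s} (hm : IsMomentum e hA t ρ m)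
    (hn : IsMomentum e hA t ρ n) : m = n := by
  refine Wdiv.ext_field e.sStar ?_
  have h := hm.strong_mono hL hn
  have hlo := (hA 0).lo_pos
  have htop := e.top_pos
  rw [sub_self t, sub_self ρ, inner_zero_right] at h
  by_contra hne
  have hpos : 0 < ‖m.1.1 - n.1.1‖ := norm_pos_iff.2 (sub_ne_zero.2 hne)
  have : 0 < lo / 4 * (1 / 2) ^ e.top * ‖m.1.1 - n.1.1‖ ^ (e.top + 2) := by positivity
  simp at h
  linarith

variable {Q : Lp ℝ 2 (volOn Ω) →L[ℝ] Lp ℝ 2 (volOn Ω)}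

theorem monotoneFamily_flowRel
    (hL : ∀ t r, ∀ᵐ x ∂volOn Ω, ∀ i, |A t i x - A r i x| ≤ L * |t - r|)
    {c : ℝ} (hc : 0 < c) (hQ : ∀ x, c * ‖x‖ ≤ ‖Q x‖)
    (hQs : ∀ x y, inner ℝ (Q x) y = inner ℝ x (Q y)) :
    MonotoneFamily (FlowRel e hA Q) (((N + 1) / lo * L) ^ 2) where
  K_nonneg := sq_nonneg _
  nonneg := by
    rintro t u a ⟨m, rfl, hm⟩
    rw [hQs]
    exact hm.inner_div_nonneg
  mono := by
    rintro t r u a w b ⟨m, rfl, hm⟩ ⟨n, rfl, hn⟩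
    have h := hm.strong_mono hL hn
    have hlo := (hA 0).lo_pos
    have : 0 ≤ lo / 4 * (1 / 2) ^ e.top * ‖m.1.1 - n.1.1‖ ^ (e.top + 2) := by positivity
    rw [← map_sub, hQs, hQs, map_sub]
    linarith
  range := by
    intro t τ h hτ
    obtain ⟨m, hm⟩ := exists_resolvent e (hA t) hτ hc hQ hQs h
    exact ⟨h - τ • Q m.1.2, Q m.1.2, ⟨m, rfl, hm⟩, sub_add_cancel _ _⟩

/-- The lower bound on `Q` turns bounds on `a = Q (div m)` into bounds on `div m`; symmetry of `Q`
transfers the weak limit back. -/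
theorem isDemiclosed_flowRel
    (hL : ∀ t r, ∀ᵐ x ∂volOn Ω, ∀ i, |A t i x - A r i x| ≤ L * |t - r|) (hL0 : 0 ≤ L)
    {c : ℝ} (hc : 0 < c) (hQ : ∀ x, c * ‖x‖ ≤ ‖Q x‖)
    (hQs : ∀ x y, inner ℝ (Q x) y = inner ℝ x (Q y)) :
    IsDemiclosed (FlowRel e hA Q) := by
  intro t u a t₀ u₀ M ht hu hM hG
  choose m hm hmom using hG
  have hb : ∀ k, ‖(m k).1.2‖ ≤ M / c := fun k => by
    rw [le_div_iff₀ hc, mul_comm]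
    exact (hQ _).trans (hm k ▸ hM k)
  obtain ⟨m₀, h1, -, -, h2⟩ := IsMomentum.tendsto hL hL0 ht ((Q.continuous.tendsto _).comp hu) hb
    hmom
  refine ⟨Q m₀.1.2, ⟨m₀, rfl, h1⟩, fun w => ?_⟩
  rw [hQs]
  refine (h2 (Q w)).congr fun k => ?_
  rw [hm k, hQs]

end Flow

/-! ### Weak measurability and weak time derivatives. -/

section WeakMeasurability

variable {X H : Type*} [MeasurableSpace X] {μ : Measure X} [NormedAddCommGroup H]
  [InnerProductSpace ℝ H]

/-- Pettis' theorem in a separable Hilbert space. -/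
theorem aestronglyMeasurable_of_inner [SeparableSpace H] [CompleteSpace H] {a : X → H}
    (ha : ∀ w, AEStronglyMeasurable (fun x => (inner ℝ w (a x) : ℝ)) μ) :
    AEStronglyMeasurable a μ := by
  -- The projections onto the spans of the first `n + 1` members of a dense sequence are finite sums
  -- of scalar measurable functions and converge pointwise to the identity.
  set U : ℕ → Submodule ℝ H := fun n => Submodule.span ℝ (denseSeq H '' Iic n) with hU
  have hfin : ∀ n, FiniteDimensional ℝ (U n) := fun n =>
    FiniteDimensional.span_of_finite ℝ ((finite_Iic n).image _)
  have hmono : Monotone U := fun i j hij =>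
    Submodule.span_mono (image_mono (Iic_subset_Iic.2 hij))
  have htop : ⊤ ≤ (⨆ n, U n).topologicalClosure := by
    intro x _
    rw [← SetLike.mem_coe, Submodule.topologicalClosure_coe]
    refine closure_mono ?_ ((denseRange_denseSeq H) x)
    rintro _ ⟨n, rfl⟩
    exact (le_iSup U n) (Submodule.subset_span ⟨n, mem_Iic.2 le_rfl, rfl⟩)
  refine aestronglyMeasurable_of_tendsto_ae atTop (f := fun n x => (U n).starProjection (a x))
    (fun n => ?_) (ae_of_all _ fun x => Submodule.starProjection_tendsto_self U hmono (a x) htop)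
  have h1 : (fun x => (U n).starProjection (a x)) =
      fun x => ∑ i, (inner ℝ ((stdOrthonormalBasis ℝ (U n) i : U n) : H) (a x) : ℝ) •
        ((stdOrthonormalBasis ℝ (U n) i : U n) : H) := by
    funext x
    rw [(stdOrthonormalBasis ℝ (U n)).starProjection_eq_sum_rankOne]
    simp
  rw [h1]
  exact Finset.aestronglyMeasurable_fun_sum _ fun i _ => (ha _).smul_const _

/-- A function given by integrating a weakly continuous function has it as its derivative in the
sense of distributions. -/
theorem hasWeakTimeDeriv_of_inner [CompleteSpace H] {T : ℝ} (hT : 0 < T) {u g : ℝ → H}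
    (hu : ContinuousOn u (Icc 0 T)) (hg : MemLp g ∞ (timeMeas T))
    (hgc : ∀ w, ContinuousOn (fun t => (inner ℝ (g t) w : ℝ)) (Icc 0 T))
    (hug : ∀ t ∈ Icc 0 T, ∀ w, inner ℝ (u t - u 0) w = ∫ r in (0 : ℝ)..t, inner ℝ (g r) w) :
    HasWeakTimeDeriv T u g := by
  intro θ
  have hθd : Continuous (deriv θ) := θ.contDiff.continuous_deriv (by simp)
  have hθ1 : MemLp θ ∞ (timeMeas T) := θ.continuous.memLp_of_hasCompactSupport θ.hasCompactSupport
  have hθ2 : MemLp (deriv θ) ∞ (timeMeas T) :=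
    hθd.memLp_of_hasCompactSupport θ.hasCompactSupport.deriv
  have hum : MemLp u ∞ (timeMeas T) := by
    obtain ⟨C, hC⟩ := isCompact_Icc.exists_bound_of_continuousOn hu
    refine memLp_top_of_bound ((hu.aestronglyMeasurable measurableSet_Icc).mono_measure
      (Measure.restrict_mono Ioo_subset_Icc_self le_rfl)) C ?_
    filter_upwards [ae_restrict_mem measurableSet_Ioo] with t ht
    exact hC t (Ioo_subset_Icc_self ht)
  have i1 : Integrable (fun t => θ t • g t) (timeMeas T) :=
    (hg.smul (r := ∞) hθ1).integrable (by simp)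
  have i2 : Integrable (fun t => deriv θ t • u t) (timeMeas T) :=
    (hum.smul (r := ∞) hθ2).integrable (by simp)
  -- Pairing with `w` makes the claim scalar. There `θ * inner w (u t)` is differentiable by the
  -- fundamental theorem of calculus and vanishes at both ends.
  refine ext_inner_left ℝ fun w => ?_
  rw [inner_neg_right, ← integral_inner i1, ← integral_inner i2, ← add_eq_zero_iff_eq_neg,
    ← integral_add (i1.const_inner w) (i2.const_inner w)]
  have hθ0 : ∀ t, t ∉ Ioo 0 T → θ t = 0 := fun t ht => by
    by_contra hne
    exact ht (θ.tsupport_subset (subset_tsupport _ hne))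
  have hderiv : ∀ t ∈ Ioo 0 T, HasDerivAt (fun t => θ t * inner ℝ w (u t))
      (inner ℝ w (θ t • g t) + inner ℝ w (deriv θ t • u t)) t := by
    intro t ht
    have h1 : HasDerivAt (fun t => ∫ r in (0 : ℝ)..t, (inner ℝ (g r) w : ℝ))
        (inner ℝ (g t) w) t := by
      have hct := (hgc w).mono Ioo_subset_Icc_self
      refine intervalIntegral.integral_hasDerivAt_right ?_
        (hct.stronglyMeasurableAtFilter isOpen_Ioo t ht) (hct.continuousAt (isOpen_Ioo.mem_nhds ht))
      refine ContinuousOn.intervalIntegrable ((hgc w).mono ?_)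
      rw [uIcc_of_le ht.1.le]
      exact Icc_subset_Icc le_rfl ht.2.le
    have h2 : HasDerivAt (fun t => (inner ℝ w (u t) : ℝ)) (inner ℝ (g t) w) t := by
      refine (h1.const_add (inner ℝ (u 0) w)).congr_of_eventuallyEq ?_
      filter_upwards [isOpen_Ioo.mem_nhds ht] with r hr
      rw [← hug r (Ioo_subset_Icc_self hr), ← inner_add_left, add_sub_cancel, real_inner_comm]
    have h3 := ((θ.contDiff.differentiable (by simp)) t).hasDerivAt.mul h2
    have e1 : (inner ℝ w (θ t • g t) : ℝ) + inner ℝ w (deriv θ t • u t) =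
        deriv θ t * inner ℝ w (u t) + θ t * inner ℝ (g t) w := by
      rw [real_inner_smul_right, real_inner_smul_right, real_inner_comm w (g t)]
      ring
    rw [e1]
    exact h3
  have hcont : ContinuousOn (fun t => θ t * inner ℝ w (u t)) (Icc 0 T) :=
    θ.continuous.continuousOn.mul (continuousOn_const.inner hu)
  have hint := intervalIntegral.integral_eq_sub_of_hasDerivAt_of_le hT.le hcont hderiv (by
    rw [intervalIntegrable_iff_integrableOn_Ioo_of_le hT.le]
    exact (i1.const_inner w).add (i2.const_inner w))
  rw [intervalIntegral.integral_of_le hT.le, integral_Ioc_eq_integral_Ioo] at hint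
  rw [hint, hθ0 T (by simp), hθ0 0 (by simp)]
  simp

end WeakMeasurability

/-! ### Multiplication operators and auxiliary measurability facts. -/

section MulOp

variable {X : Type*} [MeasurableSpace X] {μ : Measure X}

/-- Multiplication by a bounded function on `L²`. -/
noncomputable def mulOp {g : X → ℝ} (hg : MemLp g ∞ μ) : Lp ℝ 2 μ →L[ℝ] Lp ℝ 2 μ :=
  (ContinuousLinearMap.mul ℝ ℝ).holderL μ ∞ 2 2 (hg.toLp g)

theorem coeFn_mulOp {g : X → ℝ} (hg : MemLp g ∞ μ) (u : Lp ℝ 2 μ) :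
    mulOp hg u =ᵐ[μ] fun x => g x * u x := by
  have h := (ContinuousLinearMap.mul ℝ ℝ).coeFn_holder (r := 2) (hg.toLp g) u
  filter_upwards [h, hg.coeFn_toLp] with x h1 h2
  exact h1.trans (by rw [h2]; rfl)

theorem inner_mulOp {g : X → ℝ} (hg : MemLp g ∞ μ) (u v : Lp ℝ 2 μ) :
    inner ℝ (mulOp hg u) v = inner ℝ u (mulOp hg v) := by
  rw [L2.inner_def, L2.inner_def]
  refine integral_congr_ae ?_
  filter_upwards [coeFn_mulOp hg u, coeFn_mulOp hg v] with x h1 h2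
  rw [h1, h2]
  simp only [RCLike.inner_apply, conj_trivial]
  ring

theorem mul_norm_le_norm_mulOp {g : X → ℝ} (hg : MemLp g ∞ μ) {c : ℝ} (hc : 0 < c)
    (hgc : ∀ᵐ x ∂μ, c ≤ g x) (u : Lp ℝ 2 μ) : c * ‖u‖ ≤ ‖mulOp hg u‖ := by
  have h : ‖u‖ ≤ c⁻¹ * ‖mulOp hg u‖ := by
    refine Lp.norm_le_mul_norm_of_ae_le_mul ?_
    filter_upwards [coeFn_mulOp hg u, hgc] with x h1 h2
    rw [h1, norm_mul, Real.norm_of_nonneg (hc.le.trans h2), ← mul_assoc]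
    refine le_mul_of_one_le_left (norm_nonneg _) ?_
    rw [inv_mul_eq_div, one_le_div hc]
    exact h2
  rw [inv_mul_eq_div, le_div_iff₀ hc] at h
  linarith

end MulOp

theorem continuousOn_of_seq {Y Z : Type*} [TopologicalSpace Y] [FirstCountableTopology Y]
    [TopologicalSpace Z] {g : Y → Z} {S : Set Y}
    (h : ∀ (t : ℕ → Y) (t₀ : Y), (∀ k, t k ∈ S) → t₀ ∈ S → Tendsto t atTop (𝓝 t₀) →
      Tendsto (fun k => g (t k)) atTop (𝓝 (g t₀))) : ContinuousOn g S := by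
  rw [continuousOn_iff_continuous_domRestrict, continuous_iff_seqContinuous]
  intro t t₀ ht
  exact h (fun k => t k) t₀ (fun k => (t k).2) t₀.2
    ((continuous_subtype_val.tendsto t₀).comp ht)

theorem ContinuousOn.memLp_top_timeMeas {V : Type*} [NormedAddCommGroup V] {T : ℝ} {g : ℝ → V}
    (hg : ContinuousOn g (Icc 0 T)) : MemLp g ∞ (timeMeas T) := by
  obtain ⟨C, hC⟩ := isCompact_Icc.exists_bound_of_continuousOn hg
  refine memLp_top_of_bound ((hg.aestronglyMeasurable_of_isCompact isCompact_Icc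
    measurableSet_Icc).mono_measure (Measure.restrict_mono Ioo_subset_Icc_self le_rfl)) C ?_
  filter_upwards [ae_restrict_mem measurableSet_Ioo] with t ht
  exact hC t (Ioo_subset_Icc_self ht)

theorem memLp_top_subtype_prod {X V W : Type*} [MeasurableSpace X] {μ : Measure X}
    [NormedAddCommGroup V] [NormedAddCommGroup W] [NormedSpace ℝ V] [NormedSpace ℝ W]
    {S : Submodule ℝ (V × W)} {g : X → S} (h1 : MemLp (fun t => (g t).1.1) ∞ μ)
    (h2 : MemLp (fun t => (g t).1.2) ∞ μ) : MemLp g ∞ μ := by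
  have h : MemLp (fun t => ((g t : S) : V × W)) ∞ μ := by
    refine (h1.norm.add h2.norm).mono (h1.1.prodMk h2.1) (ae_of_all _ fun t => ?_)
    rw [Pi.add_apply, Real.norm_of_nonneg (by positivity), Prod.norm_def]
    exact max_le (le_add_of_nonneg_right (norm_nonneg _)) (le_add_of_nonneg_left (norm_nonneg _))
  exact h.mono (Topology.IsEmbedding.subtypeVal.aestronglyMeasurable_comp_iff.1 h.1)
    (ae_of_all _ fun t => le_rfl)

/-! ### Existence for data defined at all times. -/

section Existence

variable {d N : ℕ} {Ω : Opens (Euc d)} [IsFiniteMeasure (volOn Ω)] {e : ForchheimerExponents N}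
  {lo up : ℝ} {A : ℝ → Fin (N + 1) → Euc d → ℝ}
  {hA : ∀ t, ForchheimerExponents.AdmissibleField lo up (volOn Ω) (A t)} {L : ℝ}

/-- Solvability of the flow problem for data defined at all times, where `Q` plays the role of
multiplication by `φ ^ (-1/2)`. -/
theorem exists_flow (hL : ∀ t r, ∀ᵐ x ∂volOn Ω, ∀ i, |A t i x - A r i x| ≤ L * |t - r|)
    (hL0 : 0 ≤ L) {Q : Lp ℝ 2 (volOn Ω) →L[ℝ] Lp ℝ 2 (volOn Ω)} {c : ℝ} (hc : 0 < c)
    (hQ : ∀ x, c * ‖x‖ ≤ ‖Q x‖) (hQs : ∀ x y, inner ℝ (Q x) y = inner ℝ x (Q y))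
    {T : ℝ} (hT : 0 < T) {f : ℝ → Lp ℝ 2 (volOn Ω)} {F L' : ℝ} (hF : ∀ t, ‖f t‖ ≤ F)
    (hf : ∀ t r, ‖f t - f r‖ ≤ L' * |t - r|) {u₀ : Lp ℝ 2 (volOn Ω)} {m₀ : Wdiv Ω e.s}
    (hm₀ : IsMomentum e hA 0 (Q u₀) m₀) :
    ∃ (m : ℝ → Wdiv Ω e.s) (ρ : ℝ → L2W0 Ω e.sStar),
      MemLp m ∞ (timeMeas T) ∧ MemLp ρ ∞ (timeMeas T) ∧
      MemLp (fun t => Q (Q (f t - (m t).1.2))) ∞ (timeMeas T) ∧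
      HasWeakTimeDeriv T (fun t => L2W0.toL2 (ρ t)) (fun t => Q (Q (f t - (m t).1.2))) ∧
      (∀ t ∈ Icc 0 T, IsMomentum e hA t (L2W0.toL2 (ρ t)) (m t)) ∧
      ContinuousOn (fun t => L2W0.toL2 (ρ t)) (Icc 0 T) ∧ L2W0.toL2 (ρ 0) = Q u₀ := by
  have h0 : (0 : ℝ) ∈ Icc 0 T := ⟨le_rfl, hT.le⟩
  obtain ⟨u, a, M, hu0, hG, haM, huL, hint⟩ :=
    (monotoneFamily_flowRel (e := e) (hA := hA) hL hc hQ hQs).exists_solution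
      (isDemiclosed_flowRel hL hL0 hc hQ hQs) hT (f := fun t => Q (f t)) (F := ‖Q‖ * F)
      (L := ‖Q‖ * L')
      (fun t => (Q.le_opNorm _).trans (mul_le_mul_of_nonneg_left (hF t) (norm_nonneg _)))
      (fun t r => by
        rw [← map_sub, mul_assoc]
        exact (Q.le_opNorm _).trans (mul_le_mul_of_nonneg_left (hf t r) (norm_nonneg _)))
      (u₀ := u₀) (a₀ := Q m₀.1.2) ⟨m₀, rfl, hm₀⟩
  have hchoice : ∀ t, ∃ m : Wdiv Ω e.s, t ∈ Icc 0 T → a t = Q m.1.2 ∧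
      IsMomentum e hA t (Q (u t)) m := fun t => by
    by_cases ht : t ∈ Icc 0 T
    · obtain ⟨m, hm⟩ := hG t ht
      exact ⟨m, fun _ => hm⟩
    · exact ⟨0, fun h => absurd h ht⟩
  choose m hm using hchoice
  have hchoiceρ : ∀ t, ∃ ρ : L2W0 Ω e.sStar, t ∈ Icc 0 T →
      ρ.1 = (Q (u t), -e.fluxLp (hA t) (m t).1.1) := fun t => by
    by_cases ht : t ∈ Icc 0 T
    · exact ⟨⟨_, (hm t ht).2.mem_L2W0⟩, fun _ => rfl⟩
    · exact ⟨0, fun h => absurd h ht⟩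
  choose ρ hρ using hchoiceρ
  have hρ1 : ∀ t ∈ Icc 0 T, L2W0.toL2 (ρ t) = Q (u t) := fun t ht => by
    rw [L2W0.toL2, hρ t ht]
  have huc : ContinuousOn u (Icc 0 T) := by
    refine (LipschitzOnWith.of_dist_le_mul (K := M.toNNReal) fun r hr t ht => ?_).continuousOn
    have hM0 : 0 ≤ M := (norm_nonneg _).trans (haM r hr)
    rw [Real.coe_toNNReal _ hM0, Real.dist_eq, dist_eq_norm]
    rcases le_total r t with h | h
    · rw [norm_sub_rev, abs_sub_comm, abs_of_nonneg (sub_nonneg.2 h)]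
      exact huL r hr t ht h
    · rw [abs_of_nonneg (sub_nonneg.2 h)]
      exact huL t ht r hr h
  have hQu : ContinuousOn (fun t => Q (u t)) (Icc 0 T) := Q.continuous.comp_continuousOn huc
  have hdiv : ∀ t ∈ Icc 0 T, ‖(m t).1.2‖ ≤ M / c := fun t ht => by
    rw [le_div_iff₀ hc, mul_comm]
    exact (hQ _).trans ((hm t ht).1 ▸ haM t ht)
  -- Uniqueness of the field for given time and density identifies the limit supplied by
  -- `IsMomentum.tendsto` with `m t₀`, which gives continuity in time.
  have hseq : ∀ (t : ℕ → ℝ) (t₀ : ℝ), (∀ k, t k ∈ Icc 0 T) → t₀ ∈ Icc 0 T →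
      Tendsto t atTop (𝓝 t₀) → Tendsto (fun k => (m (t k)).1.1) atTop (𝓝 (m t₀).1.1) ∧
      Tendsto (fun k => e.fluxLp (hA (t k)) (m (t k)).1.1) atTop
        (𝓝 (e.fluxLp (hA t₀) (m t₀).1.1)) ∧
      ∀ h, Tendsto (fun k => inner ℝ (m (t k)).1.2 h) atTop (𝓝 (inner ℝ (m t₀).1.2 h)) := by
    intro t t₀ ht ht₀ htt
    have h1 : Tendsto (fun k => Q (u (t k))) atTop (𝓝 (Q (u t₀))) :=
      (hQu t₀ ht₀).tendsto.comp (tendsto_nhdsWithin_iff.2 ⟨htt, Eventually.of_forall ht⟩)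
    obtain ⟨n, hn, hn'⟩ := IsMomentum.tendsto hL hL0 htt h1 (fun k => hdiv _ (ht k))
      (fun k => (hm _ (ht k)).2)
    rw [IsMomentum.unique hL (hm t₀ ht₀).2 hn]
    exact hn'
  have hmc : ContinuousOn (fun t => (m t).1.1) (Icc 0 T) :=
    continuousOn_of_seq fun t t₀ ht ht₀ htt => (hseq t t₀ ht ht₀ htt).1
  have hxc : ContinuousOn (fun t => e.fluxLp (hA t) (m t).1.1) (Icc 0 T) :=
    continuousOn_of_seq fun t t₀ ht ht₀ htt => (hseq t t₀ ht ht₀ htt).2.1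
  have hdc : ∀ h, ContinuousOn (fun t => (inner ℝ (m t).1.2 h : ℝ)) (Icc 0 T) := fun h =>
    continuousOn_of_seq fun t t₀ ht ht₀ htt => (hseq t t₀ ht ht₀ htt).2.2 h
  have hfc : Continuous f := by
    refine (LipschitzWith.of_dist_le_mul (K := L'.toNNReal) fun r t => ?_).continuous
    rw [dist_eq_norm, Real.dist_eq]
    exact (hf r t).trans (mul_le_mul_of_nonneg_right (Real.le_coe_toNNReal _) (abs_nonneg _))
  -- The divergence is only weakly continuous in time, so its strong measurability comes from
  -- Pettis' theorem in the separable space `L²`.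
  have hdL : MemLp (fun t => (m t).1.2) ∞ (timeMeas T) := by
    have : Fact ((2 : ℝ≥0∞) ≠ ∞) := ⟨by simp⟩
    refine memLp_top_of_bound (aestronglyMeasurable_of_inner fun w => ?_) (M / c) ?_
    · simp_rw [real_inner_comm _ w]
      exact (hdc w).memLp_top_timeMeas.1
    · filter_upwards [ae_restrict_mem measurableSet_Ioo] with t ht
      exact hdiv t (Ioo_subset_Icc_self ht)
  have hg : MemLp (fun t => Q (Q (f t - (m t).1.2))) ∞ (timeMeas T) :=
    (Q.comp Q).comp_memLp' (hfc.continuousOn.memLp_top_timeMeas.sub hdL)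
  have hρc : ContinuousOn (fun t => L2W0.toL2 (ρ t)) (Icc 0 T) := hQu.congr hρ1
  refine ⟨m, ρ, memLp_top_subtype_prod hmc.memLp_top_timeMeas hdL,
    memLp_top_subtype_prod hρc.memLp_top_timeMeas ?_, hg,
    hasWeakTimeDeriv_of_inner hT hρc hg (fun w => ?_) fun t ht w => ?_,
    fun t ht => hρ1 t ht ▸ (hm t ht).2, hρc, by rw [hρ1 0 h0, hu0]⟩
  · refine ContinuousOn.memLp_top_timeMeas (hxc.neg.congr fun t ht => ?_)
    simp only [hρ t ht]
    rfl
  · simp_rw [hQs, inner_sub_left]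
    exact (hfc.inner continuous_const).continuousOn.sub (hdc _)
  · rw [hρ1 t ht, hρ1 0 h0, ← map_sub, hQs, hu0, hint t ht]
    refine intervalIntegral.integral_congr fun r hr => ?_
    rw [uIcc_of_le ht.1] at hr
    rw [(hm r ⟨hr.1, hr.2.trans ht.2⟩).1, ← map_sub, hQs _ w]

end Existence

/-! ### Pairings, and the theorem itself. -/

theorem Lp.ae_norm_le_norm {X V : Type*} [MeasurableSpace X] {μ : Measure X}
    [NormedAddCommGroup V] (g : Lp V ∞ μ) : ∀ᵐ x ∂μ, ‖g x‖ ≤ ‖g‖ := by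
  have hfin : eLpNorm g ∞ μ ≠ ∞ := Lp.eLpNorm_ne_top g
  filter_upwards [enorm_ae_le_eLpNormEssSup g μ] with x hx
  rw [Lp.norm_def, ← toReal_enorm]
  exact ENNReal.toReal_mono hfin (by rwa [eLpNorm_exponent_top])

theorem integral_mul_eq_inner {X : Type*} [MeasurableSpace X] {μ : Measure X} (u v : Lp ℝ 2 μ) :
    ∫ x, u x * v x ∂μ = inner ℝ u v := by
  rw [L2.inner_def]
  refine integral_congr_ae (ae_of_all _ fun x => ?_)
  simp only [RCLike.inner_apply, conj_trivial]
  ring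

theorem integrable_inner_of_memLp_top {X H : Type*} [MeasurableSpace X] {μ : Measure X}
    [NormedAddCommGroup H] [InnerProductSpace ℝ H] {u v : X → H} (hu : MemLp u ∞ μ)
    (hv : MemLp v 1 μ) : Integrable (fun t => (inner ℝ (u t) (v t) : ℝ)) μ :=
  memLp_one_iff_integrable.1 ((innerSL ℝ).memLp_of_bilin 1 hu hv)

theorem theorem4p1 {d N : ℕ} (hd : 2 ≤ d)
    (Ω : Opens (Euc d)) (hΩ : Bornology.IsBounded (Ω : Set (Euc d)))
    (T : ℝ) (hT : 0 < T)
    (e : ForchheimerExponents N)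
    -- the coefficients `a i t = a_i(·,t)`
    (a : Fin (N + 1) → ℝ → Lp ℝ ∞ (volOn Ω)) (aLow aUp : ℝ) (haLow : 0 < aLow)
    (ha_zero : ∀ t ∈ Icc 0 T, ∀ᵐ x ∂volOn Ω, aLow ≤ a 0 t x)
    (ha_last : ∀ t ∈ Icc 0 T, ∀ᵐ x ∂volOn Ω, aLow ≤ a (Fin.last N) t x)
    (ha : ∀ i, ∀ t ∈ Icc 0 T, ∀ᵐ x ∂volOn Ω, 0 ≤ a i t x ∧ a i t x ≤ aUp)
    -- the porosity
    (φ : Euc d → ℝ) (hφm : AEStronglyMeasurable φ (volOn Ω))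
    (φLow φUp : ℝ) (hφLow : 0 < φLow)
    (hφ : ∀ᵐ x ∂volOn Ω, φLow ≤ φ x ∧ φ x ≤ φUp)
    -- the source term
    (f : ℝ → Lp ℝ 2 (volOn Ω)) (hf : MemLp f ∞ (timeMeas T))
    -- Lipschitz continuity in time
    (L : ℝ≥0) (ha_lip : ∀ i, LipschitzOnWith L (a i) (Icc 0 T))
    (hf_lip : LipschitzOnWith L f (Icc 0 T))
    -- the initial density
    (ρ₀ : L2W0 Ω e.sStar) :
    ∃ (m : ℝ → Wdiv Ω e.s) (ρ : ℝ → L2W0 Ω e.sStar) (ρ' : ℝ → Lp ℝ 2 (volOn Ω)),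
      MemLp m ∞ (timeMeas T) ∧
      MemLp ρ ∞ (timeMeas T) ∧
      MemLp ρ' ∞ (timeMeas T) ∧
      HasWeakTimeDeriv T (fun t => L2W0.toL2 (ρ t)) ρ' ∧
      (∀ v : ℝ → Wdiv Ω e.s, MemLp v 1 (timeMeas T) →
        (∫ t in Ioo 0 T, ∫ x in Ω,
            e.poly (fun i => a i t x) ‖Wdiv.field (m t) x‖ * inner ℝ (Wdiv.field (m t) x) (Wdiv.field (v t) x))
          - (∫ t in Ioo 0 T, ∫ x in Ω, Wdiv.div (v t) x * L2W0.toL2 (ρ t) x) = 0) ∧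
      (∀ q : ℝ → Lp ℝ 2 (volOn Ω), MemLp q 1 (timeMeas T) →
        (∫ t in Ioo 0 T, ∫ x in Ω, φ x * ρ' t x * q t x)
          + (∫ t in Ioo 0 T, ∫ x in Ω, Wdiv.div (m t) x * q t x)
          = ∫ t in Ioo 0 T, ∫ x in Ω, f t x * q t x) ∧
      ((∃ m₀ : Wdiv Ω e.s, ∀ᵐ x ∂volOn Ω,
          e.poly (fun i => a i 0 x) ‖Wdiv.field m₀ x‖ • Wdiv.field m₀ x = - L2W0.grad ρ₀ x) →
        HasInitialValue T (fun t => L2W0.toL2 (ρ t)) (L2W0.toL2 ρ₀)) := by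
  have hfin : IsFiniteMeasure (volOn Ω) :=
    ⟨by rw [Measure.restrict_apply_univ]; exact hΩ.measure_lt_top⟩
  have h0 : (0 : ℝ) ∈ Icc 0 T := ⟨le_rfl, hT.le⟩
  -- extension of the data to all times
  set κ : ℝ → ℝ := fun t => projIcc 0 T hT.le t with hκ
  have hκmem : ∀ t, κ t ∈ Icc 0 T := fun t => (projIcc 0 T hT.le t).2
  have hκid : ∀ t ∈ Icc 0 T, κ t = t := fun t ht => by rw [hκ]; simp [projIcc_of_mem hT.le ht]
  have hκlip : ∀ t r, |κ t - κ r| ≤ |t - r| := fun t r => by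
    simpa [Subtype.dist_eq, Real.dist_eq] using (LipschitzWith.projIcc hT.le).dist_le_mul t r
  -- For empty `Ω` the almost everywhere bounds are vacuous and `aUp` may be negative; hence the
  -- maximum with `0`.
  have hA : ∀ t, ForchheimerExponents.AdmissibleField aLow (max aUp 0) (volOn Ω)
      (fun i => (a i (κ t) : Euc d → ℝ)) := fun t => by
    refine ⟨haLow, le_max_right _ _, fun i => Lp.aestronglyMeasurable _, ?_⟩
    filter_upwards [ha_zero _ (hκmem t), ha_last _ (hκmem t),
      ae_all_iff.2 fun i => ha i _ (hκmem t)] with x h1 h2 h3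
    exact ⟨fun i => (h3 i).1, fun i => (h3 i).2.trans (le_max_left _ _), h1, h2⟩
  have hL : ∀ t r, ∀ᵐ x ∂volOn Ω, ∀ i, |a i (κ t) x - a i (κ r) x| ≤ L * |t - r| := fun t r => by
    refine ae_all_iff.2 fun i => ?_
    filter_upwards [Lp.ae_norm_le_norm (a i (κ t) - a i (κ r)),
      Lp.coeFn_sub (a i (κ t)) (a i (κ r))] with x h1 h2
    rw [h2, Pi.sub_apply, Real.norm_eq_abs] at h1
    refine h1.trans ?_
    rw [← dist_eq_norm]
    refine ((ha_lip i).dist_le_mul _ (hκmem t) _ (hκmem r)).trans ?_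
    exact mul_le_mul_of_nonneg_left (hκlip t r) L.2
  have hfL : ∀ t r, ‖f (κ t) - f (κ r)‖ ≤ L * |t - r| := fun t r => by
    rw [← dist_eq_norm]
    refine (hf_lip.dist_le_mul _ (hκmem t) _ (hκmem r)).trans ?_
    exact mul_le_mul_of_nonneg_left (hκlip t r) L.2
  obtain ⟨F, hF⟩ := isCompact_Icc.exists_bound_of_continuousOn hf_lip.continuousOn
  -- multiplication by `φ ^ (-1/2)` and by `φ ^ (1/2)`
  have hsm : AEStronglyMeasurable (fun x => √(φ x)) (volOn Ω) :=
    Real.continuous_sqrt.comp_aestronglyMeasurable hφm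
  have hs : MemLp (fun x => √(φ x)) ∞ (volOn Ω) := by
    refine memLp_top_of_bound hsm (√φUp) ?_
    filter_upwards [hφ] with x hx
    rw [Real.norm_of_nonneg (Real.sqrt_nonneg _)]
    exact Real.sqrt_le_sqrt hx.2
  have hi : MemLp (fun x => (√(φ x))⁻¹) ∞ (volOn Ω) := by
    refine memLp_top_of_bound hsm.aemeasurable.inv.aestronglyMeasurable ((√φLow)⁻¹) ?_
    filter_upwards [hφ] with x hx
    rw [Real.norm_of_nonneg (inv_nonneg.2 (Real.sqrt_nonneg _))]
    exact inv_anti₀ (Real.sqrt_pos.2 hφLow) (Real.sqrt_le_sqrt hx.1)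
  -- Likewise nothing forces `φUp` to be positive when `Ω` is empty; the maximum with `φLow` keeps
  -- the constant positive.
  have hc : 0 < (√(max φLow φUp))⁻¹ :=
    inv_pos.2 (Real.sqrt_pos.2 (hφLow.trans_le (le_max_left _ _)))
  have hQ := mul_norm_le_norm_mulOp hi hc (by
    filter_upwards [hφ] with x hx
    exact inv_anti₀ (Real.sqrt_pos.2 (hφLow.trans_le hx.1))
      (Real.sqrt_le_sqrt (hx.2.trans (le_max_right _ _))))
  have hQsurj : ∀ u, mulOp hi (mulOp hs u) = u := fun u => by
    refine Lp.ext ?_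
    filter_upwards [coeFn_mulOp hi (mulOp hs u), coeFn_mulOp hs u, hφ] with x h1 h2 h3
    rw [h1, h2, inv_mul_cancel_left₀ (Real.sqrt_pos.2 (hφLow.trans_le h3.1)).ne']
  -- `Q ∘ Q` is division by `φ`, so the derivative `Q (Q (f - div m))` satisfies the mass equation.
  have hφQ : ∀ u : Lp ℝ 2 (volOn Ω),
      (fun x => φ x * mulOp hi (mulOp hi u) x) =ᵐ[volOn Ω] u := fun u => by
    filter_upwards [coeFn_mulOp hi (mulOp hi u), coeFn_mulOp hi u, hφ] with x h1 h2 h3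
    have hpos := hφLow.trans_le h3.1
    rw [h1, h2, ← mul_assoc (√(φ x))⁻¹, ← mul_inv, Real.mul_self_sqrt hpos.le,
      mul_inv_cancel_left₀ hpos.ne']
  -- If no compatible `m₀` exists, the initial value is not prescribed, and zero density with zero
  -- field solves the momentum equation at time `0`.
  have hstart : ∃ (ρ₁ : Lp ℝ 2 (volOn Ω)) (m₁ : Wdiv Ω e.s), IsMomentum e hA 0 ρ₁ m₁ ∧
      ((∃ m₀ : Wdiv Ω e.s, ∀ᵐ x ∂volOn Ω,
        e.poly (fun i => a i 0 x) ‖Wdiv.field m₀ x‖ • Wdiv.field m₀ x = - L2W0.grad ρ₀ x) →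
        ρ₁ = L2W0.toL2 ρ₀) := by
    by_cases h : ∃ m₀ : Wdiv Ω e.s, ∀ᵐ x ∂volOn Ω,
        e.poly (fun i => a i 0 x) ‖Wdiv.field m₀ x‖ • Wdiv.field m₀ x = - L2W0.grad ρ₀ x
    · obtain ⟨m₀, hm₀⟩ := h
      refine ⟨L2W0.toL2 ρ₀, m₀, isMomentum_of_gradient hA ρ₀ m₀ ?_, fun _ => rfl⟩
      rw [hκid 0 h0]
      exact hm₀
    · refine ⟨0, 0, isMomentum_of_gradient hA (0 : L2W0 Ω e.sStar) 0 ?_, fun h' => absurd h' h⟩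
      filter_upwards [Lp.coeFn_zero (Euc d) e.s (volOn Ω),
        Lp.coeFn_zero (Euc d) e.sStar (volOn Ω)] with x h1 h2
      change e.flux _ ((0 : Lp (Euc d) e.s (volOn Ω)) x) = -(0 : Lp (Euc d) e.sStar (volOn Ω)) x
      rw [h1, h2, ForchheimerExponents.flux]
      simp
  obtain ⟨ρ₁, m₁, hm₁, hρ₁⟩ := hstart
  obtain ⟨m, ρ, hm, hρ, hρ', hderiv, hmom, hcont, hinit⟩ := exists_flow (hA := hA) hL L.2 hc hQ
    (inner_mulOp hi) hT (f := fun t => f (κ t)) (fun t => hF _ (hκmem t)) hfL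
    (u₀ := mulOp hs ρ₁) (m₀ := m₁) (by rwa [hQsurj])
  refine ⟨m, ρ, _, hm, hρ, hρ', hderiv, fun v _ => ?_, fun q hq => ?_, fun h =>
    ⟨_, hcont, ae_eq_refl _, by rw [hinit, hQsurj, hρ₁ h]⟩⟩
  · rw [sub_eq_zero]
    -- The momentum equation holds at every time, so the two time integrands agree pointwise.
    refine setIntegral_congr_fun measurableSet_Ioo fun t ht => ?_
    have ht' := Ioo_subset_Icc_self ht
    have h1 := hmom t ht' (v t)
    rw [innerPairing_eq, real_inner_comm, ← integral_mul_eq_inner] at h1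
    refine Eq.trans (integral_congr_ae ?_) h1
    filter_upwards [e.coeFn_fluxLp (hA t) (m t).1.1] with x hx
    rw [hx, ForchheimerExponents.flux, real_inner_smul_left, hκid t ht']
    rfl
  · have hmd : MemLp (fun t => (m t).1.2) ∞ (timeMeas T) :=
      ((ContinuousLinearMap.snd ℝ _ _).comp (Wdiv Ω e.s).subtypeL).comp_memLp' hm
    have e1 : ∫ t in Ioo 0 T, ∫ x in Ω, φ x * mulOp hi (mulOp hi (f (κ t) - (m t).1.2)) x * q t x =
        ∫ t in Ioo 0 T, (inner ℝ (f t - (m t).1.2) (q t) : ℝ) := by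
      refine setIntegral_congr_fun measurableSet_Ioo fun t ht => ?_
      simp only
      rw [← integral_mul_eq_inner, hκid t (Ioo_subset_Icc_self ht)]
      refine integral_congr_ae ?_
      filter_upwards [hφQ (f t - (m t).1.2)] with x hx
      rw [hx]
    have e2 : ∀ w : ℝ → Lp ℝ 2 (volOn Ω), ∫ t in Ioo 0 T, ∫ x in Ω, w t x * q t x =
        ∫ t in Ioo 0 T, (inner ℝ (w t) (q t) : ℝ) := fun w => by
      simp_rw [integral_mul_eq_inner]
    have e3 := e2 (fun t => (m t).1.2)
    rw [e1, e2 f]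
    refine (congrArg _ e3).trans ?_
    have hfm : MemLp (fun t => f t - (m t).1.2) ∞ (timeMeas T) := hf.sub hmd
    rw [← integral_add (integrable_inner_of_memLp_top hfm hq)
      (integrable_inner_of_memLp_top hmd hq)]
    simp_rw [← inner_add_left, sub_add_cancel]
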